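/- Let $g\ge 2$ and let $f\in\mathbb{C}[x]$ have degree $2g+1$ or $2g+2$ and no multiple root (equivalently, the binary form $F(x,y)=y^{2g+2}f(x/y)$ of degree $2g+2$ has non-zero discriminant). Let $C_f$ be the hyperelliptic curve over $\mathbb{C}$ obtained by gluing the affine curves $V(z^2-f(x))$ and $V(\tilde z^2-\tilde x^{2g+2}f(1/\tilde x))$ by $(\tilde x,\tilde z)=(1/x,\,z/x^{g+1})$, let $\mathrm{Aut}(C_f)$ be its group of automorphisms over $\mathbb{C}$, and let $H^0(C_f,\Omega)$ be the space of global sections of the sheaf of Kähler differentials, on which $\varphi\in\mathrm{Aut}(C_f)$ acts by the pullback $\varphi^*$ (an action from the right). Let $\Gamma(\rho)$ be the group of all pairs $(\gamma,u)\in \mathrm{SL}(2,\mathbb{C})\times\mathbb{C}^\times$, $\gamma=\begin{pmatrix}a&b\\c&d\end{pmatrix}$, with $F(ax+by,cx+dy)=u^2F(x,y)$, that is, which preserve $V(z^2-f(x))$ under $$(x,z)\mapsto\Bigl(\frac{ax+b}{cx+d},\ \frac{uz}{(cx+d)^{g+1}}\Bigr).\qquad(*)$$ Let $\mathsf V_{g-1}$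 be the $(g-1)$st symmetric power of the fundamental representation of $\mathrm{SL}(2,\mathbb{C})$, realized as the space of binary forms $p(X,Y)$ of degree $g-1$, on which $\gamma$ acts (from the right) by $p(X,Y)\mapsto p(aX+bY,cX+dY)$, and let $\mathsf V_{g-1}(-1)$ be the same space with $(\gamma,u)\in\Gamma(\rho)$ acting by $u^{-1}$ times the action of $\gamma$. Then for every $(\gamma,u)\in\Gamma(\rho)$ there is exactly one automorphism of $C_f$ given by $(*)$; this defines a surjective group homomorphism $\Gamma(\rho)\to\mathrm{Aut}(C_f)$; the action of $\Gamma(\rho)$ on $\mathsf V_{g-1}(-1)$ factors through it; and, as (right) representations of $\mathrm{Aut}(C_f)$, $$H^0(C_f,\Omega)\cong \mathsf V_{g-1}(-1).$$ More precisely, the forms $\omega_i=x^i\,dx/z$, $0\le i<g$, are a basis of $H^0(C_f,\Omega)$, and the linear map with $X^iY^{g-1-i}\mapsto\omega_i$ is such an isomorphism. -/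

import Mathlib

open CategoryTheory AlgebraicGeometry Polynomial
open scoped KaehlerDifferential

noncomputable section

namespace HyperellipticDifferentials

/-! ### The hyperelliptic curve as a scheme over `ℂ` -/

/-- The coordinate ring `ℂ[x, z] / (z² - h(x))` of the affine curve `V(z² - h(x))`. -/
abbrev Chart (h : ℂ[X]) : Type := AdjoinRoot (X ^ 2 - C h : ℂ[X][X])

/-- The coordinate function `x`. -/
def Chart.x (h : ℂ[X]) : Chart h := AdjoinRoot.of _ X

/-- The coordinate function `z`. -/
def Chart.z (h : ℂ[X]) : Chart h := AdjoinRoot.root _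

/-- The coordinate ring `ℂ[x, z, x⁻¹] / (z² - h(x))` of the open subset `x ≠ 0`. -/
abbrev Punctured (h : ℂ[X]) : Type := Localization.Away (Chart.x h)

/-- The function `1 / x` on the open subset `x ≠ 0`. -/
def invX (h : ℂ[X]) : Punctured h := IsLocalization.Away.invSelf (Chart.x h)

/-- `k(x) = x ^ (2n) h(1/x)`, where `h` has degree at most `2n`. -/
structure IsReversal (n : ℕ) (h k : ℂ[X]) : Prop where
  natDegree_le : h.natDegree ≤ 2 * n
  eq_reflect : k = h.reflect (2 * n)

theorem IsReversal.symm {n : ℕ} {h k : ℂ[X]} (H : IsReversal n h k) : IsReversal n k h := by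
  obtain ⟨h1, rfl⟩ := H
  refine ⟨?_, by simp⟩
  exact natDegree_reflect_le.trans (by simp [h1])

theorem x_mul_invX (h : ℂ[X]) : algebraMap (Chart h) (Punctured h) (Chart.x h) * invX h = 1 :=
  IsLocalization.Away.mul_invSelf _

theorem Chart.z_sq (h : ℂ[X]) : Chart.z h ^ 2 = aeval (Chart.x h) h := by
  have h1 := AdjoinRoot.eval₂_root (X ^ 2 - C h : ℂ[X][X])
  rw [eval₂_sub, eval₂_C, eval₂_X_pow, sub_eq_zero] at h1
  have h2 : aeval (Chart.x h) h = AdjoinRoot.of (X ^ 2 - C h : ℂ[X][X]) (aeval X h) :=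
    aeval_algHom_apply (AdjoinRoot.ofAlgHom ℂ (X ^ 2 - C h : ℂ[X][X])) X h
  rw [h2, aeval_X_left_apply]
  exact h1

theorem transition_aux {n : ℕ} {h k : ℂ[X]} (H : IsReversal n h k) :
    (algebraMap (Chart h) (Punctured h) (Chart.z h) * invX h ^ n) ^ 2 = aeval (invX h) k := by
  set a : Punctured h := algebraMap (Chart h) (Punctured h) (Chart.x h) with ha
  have hx : a * invX h = 1 := x_mul_invX h
  let _ : Invertible a := ⟨invX h, by rw [mul_comm]; exact hx, hx⟩
  have h1 : aeval (invX h) k * a ^ (2 * n) = aeval a h := by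
    have := eval₂_reflect_mul_pow (algebraMap ℂ (Punctured h)) a (2 * n) h H.natDegree_le
    rw [← H.eq_reflect] at this
    exact this
  have h2 : aeval a h = algebraMap (Chart h) (Punctured h) (Chart.z h) ^ 2 := by
    rw [← map_pow, Chart.z_sq, ha]
    exact aeval_algebraMap_apply (Punctured h) (Chart.x h) h
  have h3 : a ^ (2 * n) * invX h ^ (2 * n) = 1 := by rw [← mul_pow, hx, one_pow]
  rw [mul_pow, ← h2, ← h1, ← pow_mul, mul_comm n 2, mul_assoc, h3, mul_one]

/-- The `ℂ`-algebra map `x̃ ↦ 1 / x`, `z̃ ↦ z / x ^ n` into the functions on `x ≠ 0`. -/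
def chartTransition {n : ℕ} {h k : ℂ[X]} (H : IsReversal n h k) : Chart k →ₐ[ℂ] Punctured h :=
  AdjoinRoot.liftAlgHom (X ^ 2 - C k : ℂ[X][X]) (aeval (invX h))
    (algebraMap (Chart h) (Punctured h) (Chart.z h) * invX h ^ n) (by
      rw [eval₂_sub, eval₂_C, eval₂_X_pow, transition_aux H]
      exact sub_self _)

theorem chartTransition_x {n : ℕ} {h k : ℂ[X]} (H : IsReversal n h k) :
    chartTransition H (Chart.x k) = invX h :=
   (AdjoinRoot.liftAlgHom_of (X ^ 2 - C k : ℂ[X][X]) (aeval (invX h)) _ _ X).trans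
    (aeval_X _)

theorem chartTransition_z {n : ℕ} {h k : ℂ[X]} (H : IsReversal n h k) :
    chartTransition H (Chart.z k) = algebraMap (Chart h) (Punctured h) (Chart.z h) * invX h ^ n := by
  simp [chartTransition, Chart.z]

theorem isUnit_chartTransition_x {n : ℕ} {h k : ℂ[X]} (H : IsReversal n h k) :
    IsUnit (chartTransition H (Chart.x k)) := by
  rw [chartTransition_x]
  exact IsUnit.of_mul_eq_one_right _ (x_mul_invX h)

/-- The same map on the functions on `x̃ ≠ 0`. -/
def transition {n : ℕ} {h k : ℂ[X]} (H : IsReversal n h k) : Punctured k →ₐ[ℂ] Punctured h :=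
  IsLocalization.liftAlgHom (M := Submonoid.powers (Chart.x k)) (f := chartTransition H) (by
    rintro ⟨_, m, rfl⟩
    simpa using (isUnit_chartTransition_x H).pow m)

theorem transition_algebraMap {n : ℕ} {h k : ℂ[X]} (H : IsReversal n h k) (a : Chart k) :
    transition H (algebraMap _ _ a) = chartTransition H a := by
  simp [transition]

theorem transition_invX {n : ℕ} {h k : ℂ[X]} (H : IsReversal n h k) :
    transition H (invX k) = algebraMap (Chart h) (Punctured h) (Chart.x h) := by
  have h1 : invX h * transition H (invX k) = 1 := by
    rw [← chartTransition_x H, ← transition_algebraMap, ← map_mul, x_mul_invX, map_one]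
  calc transition H (invX k)
      = algebraMap (Chart h) (Punctured h) (Chart.x h) * invX h * transition H (invX k) := by
        rw [x_mul_invX, one_mul]
    _ = _ := by rw [mul_assoc, h1, mul_one]

theorem transition_comp {n : ℕ} {h k : ℂ[X]} (H : IsReversal n h k) :
    (transition H).comp (transition H.symm) = AlgHom.id ℂ (Punctured h) := by
  apply IsLocalization.algHom_ext (Submonoid.powers (Chart.x h))
  apply AdjoinRoot.algHom_ext'
  · apply Polynomial.algHom_ext
    change transition H (transition H.symm (algebraMap _ _ (Chart.x h))) =
      algebraMap _ _ (Chart.x h)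
    rw [transition_algebraMap, chartTransition_x, transition_invX]
  · change transition H (transition H.symm (algebraMap _ _ (Chart.z h))) =
      algebraMap _ _ (Chart.z h)
    rw [transition_algebraMap, chartTransition_z, map_mul, map_pow, transition_invX,
      transition_algebraMap, chartTransition_z, mul_assoc, ← mul_pow, mul_comm (invX h),
      x_mul_invX, one_pow, mul_one]

/-- The identification `(x̃, z̃) = (1 / x, z / x ^ n)` of the open subsets `x̃ ≠ 0` and `x ≠ 0` of
the two affine curves. -/
def transitionEquiv {n : ℕ} {h k : ℂ[X]} (H : IsReversal n h k) : Punctured k ≃ₐ[ℂ] Punctured h :=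
  AlgEquiv.ofAlgHom (transition H) (transition H.symm) (transition_comp H) (transition_comp H.symm)

section Gluing

variable {n : ℕ} {h k : ℂ[X]} (H : IsReversal n h k)

/-- The inclusion of the open subset `x ≠ 0` into `V(z² - h(x))`. -/
def inclLeft (h : ℂ[X]) :
    Spec (CommRingCat.of (Punctured h)) ⟶ Spec (CommRingCat.of (Chart h)) :=
  Spec.map (CommRingCat.ofHom (algebraMap (Chart h) (Punctured h)))

instance (h : ℂ[X]) : IsOpenImmersion (inclLeft h) :=
  IsOpenImmersion.of_isLocalization (Chart.x h)

/-- The open immersion of the open subset `x ≠ 0` of `V(z² - h(x))` into `V(z̃² - k(x̃))`. -/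
def inclRight : Spec (CommRingCat.of (Punctured h)) ⟶ Spec (CommRingCat.of (Chart k)) :=
  Spec.map (transitionEquiv H).toRingEquiv.toCommRingCatIso.hom ≫ inclLeft k

instance : IsOpenImmersion (inclRight H) := by
  unfold inclRight
  infer_instance

/-- The diagram `V(z² - h(x)) ⟵ {x ≠ 0} ⟶ V(z̃² - k(x̃))`. -/
abbrev gluingDiagram : Limits.WidePushoutShape Limits.WalkingPair ⥤ Scheme.{0} :=
  Limits.span (inclLeft h) (inclRight H)

instance {i j : Limits.WidePushoutShape Limits.WalkingPair} (φ : i ⟶ j) :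
    IsOpenImmersion ((gluingDiagram H).map φ) := by
  rcases φ with _ | (_ | _)
  · exact inferInstanceAs (IsOpenImmersion ((gluingDiagram H).map (𝟙 i)))
  · exact inferInstanceAs (IsOpenImmersion (inclLeft h))
  · exact inferInstanceAs (IsOpenImmersion (inclRight H))

/-- The scheme obtained by gluing `V(z² - h(x))` and `V(z̃² - k(x̃))`. -/
def glued : Scheme.{0} := Limits.colimit (gluingDiagram H)

/-- The first chart. -/
def chartLeft : Spec (CommRingCat.of (Chart h)) ⟶ glued H :=
  Limits.colimit.ι (gluingDiagram H) (some Limits.WalkingPair.left)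

/-- The second chart. -/
def chartRight : Spec (CommRingCat.of (Chart k)) ⟶ glued H :=
  Limits.colimit.ι (gluingDiagram H) (some Limits.WalkingPair.right)

instance : IsOpenImmersion (chartLeft H) :=
  inferInstanceAs (IsOpenImmersion (Limits.colimit.ι (gluingDiagram H) _))

instance : IsOpenImmersion (chartRight H) :=
  inferInstanceAs (IsOpenImmersion (Limits.colimit.ι (gluingDiagram H) _))

/-- The structure morphism of an affine curve. -/
def chartStructure (h : ℂ[X]) : Spec (CommRingCat.of (Chart h)) ⟶ Spec (CommRingCat.of ℂ) :=
  Spec.map (CommRingCat.ofHom (algebraMap ℂ (Chart h)))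

theorem incl_chartStructure :
    inclLeft h ≫ chartStructure h = inclRight H ≫ chartStructure k := by
  simp only [inclRight, inclLeft, chartStructure, ← Spec.map_comp]
  congr 1
  ext c
  change algebraMap (Chart h) (Punctured h) (algebraMap ℂ (Chart h) c) =
    transition H (algebraMap (Chart k) (Punctured k) (algebraMap ℂ (Chart k) c))
  rw [transition_algebraMap, AlgHom.commutes, ← IsScalarTower.algebraMap_apply]

/-- The glued curve over `Spec ℂ`. -/
def gluedOver : Over (Spec (CommRingCat.of ℂ)) :=
  Over.mk (Y := glued H)
    (Limits.pushout.desc (chartStructure h) (chartStructure k) (incl_chartStructure H))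

end Gluing

theorem isReversal_reflect {g : ℕ} {f : ℂ[X]} (hf : f.natDegree ≤ 2 * g + 2) :
    IsReversal (g + 1) f (f.reflect (2 * (g + 1))) :=
  ⟨by omega, rfl⟩

/-- The hyperelliptic curve `C_f` over `ℂ`: the gluing of `V(z² - f(x))` and
`V(z̃² - x̃ ^ (2g+2) f(1/x̃))` by `(x̃, z̃) = (1 / x, z / x ^ (g+1))`. -/
def Curve (g : ℕ) (f : ℂ[X]) (hf : f.natDegree ≤ 2 * g + 2) : Over (Spec (CommRingCat.of ℂ)) :=
  gluedOver (isReversal_reflect hf)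

/-! ### Global differential forms on a scheme over `ℂ` -/

section Differentials

/-- The map `Ω[A⁄ℂ] → Ω[B⁄ℂ]`, `a d b ↦ φ(a) d φ(b)`, induced by `φ : A → B`. -/
def kaehlerMap {A B : Type} [CommRing A] [CommRing B] [Algebra ℂ A] [Algebra ℂ B]
    (φ : A →ₐ[ℂ] B) : Ω[A⁄ℂ] →ₗ[ℂ] Ω[B⁄ℂ] :=
  letI := φ.toRingHom.toAlgebra
  haveI : IsScalarTower ℂ A B := IsScalarTower.of_algebraMap_eq' φ.comp_algebraMap.symm
  (KaehlerDifferential.map ℂ ℂ A B).restrictScalars ℂ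

theorem kaehler_map_smul_D {A B : Type} [CommRing A] [CommRing B] [Algebra ℂ A] [Algebra ℂ B]
    [Algebra A B] [IsScalarTower ℂ A B] (a b : A) :
    KaehlerDifferential.map ℂ ℂ A B (a • KaehlerDifferential.D ℂ A b) =
      algebraMap A B a • KaehlerDifferential.D ℂ B (algebraMap A B b) := by
  rw [LinearMap.map_smul, KaehlerDifferential.map_D, algebraMap_smul]

theorem kaehlerMap_smul_D {A B : Type} [CommRing A] [CommRing B] [Algebra ℂ A] [Algebra ℂ B]
    (φ : A →ₐ[ℂ] B) (a b : A) :
    kaehlerMap φ (a • KaehlerDifferential.D ℂ A b) =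
      φ a • KaehlerDifferential.D ℂ B (φ b) :=
  letI := φ.toRingHom.toAlgebra
  haveI : IsScalarTower ℂ A B := IsScalarTower.of_algebraMap_eq' φ.comp_algebraMap.symm
  kaehler_map_smul_D a b

theorem kaehler_hom_ext {A : Type} [CommRing A] [Algebra ℂ A] {M : Type*} [AddCommGroup M]
    [Module ℂ M] {F G : Ω[A⁄ℂ] →ₗ[ℂ] M}
    (hFG : ∀ a b : A, F (a • KaehlerDifferential.D ℂ A b) =
      G (a • KaehlerDifferential.D ℂ A b)) : F = G := by
  refine LinearMap.ext fun w => ?_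
  have hw : w ∈ Submodule.span A (Set.range (KaehlerDifferential.D ℂ A)) := by
    rw [KaehlerDifferential.span_range_derivation]; trivial
  induction hw using Submodule.closure_induction with
  | zero => simp
  | add _ _ _ _ h1 h2 => rw [map_add, map_add, h1, h2]
  | smul_mem a x hx =>
    obtain ⟨b, rfl⟩ := hx
    exact hFG a b

theorem kaehlerMap_id {A : Type} [CommRing A] [Algebra ℂ A] (w : Ω[A⁄ℂ]) :
    kaehlerMap (AlgHom.id ℂ A) w = w := by
  have : kaehlerMap (AlgHom.id ℂ A) = LinearMap.id :=
    kaehler_hom_ext fun a b => by rw [kaehlerMap_smul_D]; rfl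
  rw [this]; rfl

theorem kaehlerMap_comp {A B D : Type} [CommRing A] [CommRing B] [CommRing D] [Algebra ℂ A]
    [Algebra ℂ B] [Algebra ℂ D] (φ : A →ₐ[ℂ] B) (ψ : B →ₐ[ℂ] D) (w : Ω[A⁄ℂ]) :
    kaehlerMap ψ (kaehlerMap φ w) = kaehlerMap (ψ.comp φ) w := by
  have : kaehlerMap ψ ∘ₗ kaehlerMap φ = kaehlerMap (ψ.comp φ) :=
    kaehler_hom_ext fun a b => by
      rw [LinearMap.comp_apply, kaehlerMap_smul_D, kaehlerMap_smul_D, kaehlerMap_smul_D]; rfl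
  rw [← this]; rfl

variable (Y Z : Over (Spec (CommRingCat.of ℂ)))

/-- The ring `𝒪(U)` of regular functions on an open subset `U`. -/
def Sections (U : Y.left.Opens) : Type := Γ(Y.left, U)

instance (U : Y.left.Opens) : CommRing (Sections Y U) :=
  inferInstanceAs (CommRing Γ(Y.left, U))

/-- The structure morphism. -/
def structureMap : Y.left ⟶ Spec (CommRingCat.of ℂ) := Y.hom

theorem le_preimage_top (U : Y.left.Opens) : U ≤ structureMap Y ⁻¹ᵁ ⊤ := fun _ _ => trivial

/-- The constant functions. -/
def scalars (U : Y.left.Opens) : ℂ →+* Sections Y U :=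
  ((Scheme.ΓSpecIso (CommRingCat.of ℂ)).inv ≫
    (structureMap Y).appLE ⊤ U (le_preimage_top Y U)).hom

instance (U : Y.left.Opens) : Algebra ℂ (Sections Y U) := (scalars Y U).toAlgebra

/-- Restriction of functions. -/
def restrict {V U : Y.left.Opens} (e : U ≤ V) : Sections Y V →ₐ[ℂ] Sections Y U where
  __ := (Y.left.presheaf.map (homOfLE e).op).hom
  commutes' c := by
    change ((Scheme.ΓSpecIso (CommRingCat.of ℂ)).inv ≫
      (structureMap Y).appLE ⊤ V (le_preimage_top Y V) ≫
        Y.left.presheaf.map (homOfLE e).op).hom c = _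
    rw [Scheme.Hom.appLE_map]
    rfl

variable {Y Z}

/-- Pullback of functions along a morphism of schemes over `ℂ`, from an open set `V` to an open
set `U` that is mapped into `V`. -/
def pullSections (φ : Y ⟶ Z) (V : Z.left.Opens) (U : Y.left.Opens) (e : U ≤ φ.left ⁻¹ᵁ V) :
    Sections Z V →ₐ[ℂ] Sections Y U where
  __ := (φ.left.appLE V U e).hom
  commutes' c := by
    change ((Scheme.ΓSpecIso (CommRingCat.of ℂ)).inv ≫
      (structureMap Z).appLE ⊤ V (le_preimage_top Z V) ≫ φ.left.appLE V U e).hom c = _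
    rw [Scheme.Hom.appLE_comp_appLE]
    have h1 : φ.left ≫ structureMap Z = structureMap Y := Over.w φ
    simp only [h1]
    rfl

theorem pullSections_comp {W : Over (Spec (CommRingCat.of ℂ))} (φ : Y ⟶ Z) (ψ : Z ⟶ W)
    (T : W.left.Opens) (V : Z.left.Opens) (U : Y.left.Opens) (e₁ : V ≤ ψ.left ⁻¹ᵁ T)
    (e₂ : U ≤ φ.left ⁻¹ᵁ V) (e₃ : U ≤ (φ ≫ ψ).left ⁻¹ᵁ T) :
    (pullSections φ V U e₂).comp (pullSections ψ T V e₁) = pullSections (φ ≫ ψ) T U e₃ := by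
  ext s
  change (ψ.left.appLE T V e₁ ≫ φ.left.appLE V U e₂).hom s = ((φ ≫ ψ).left.appLE T U e₃).hom s
  rw [Scheme.Hom.appLE_comp_appLE]
  rfl

theorem pullSections_restrict (φ : Y ⟶ Z) {V V' : Z.left.Opens} {U : Y.left.Opens} (e : V' ≤ V)
    (e₁ : U ≤ φ.left ⁻¹ᵁ V') (e₂ : U ≤ φ.left ⁻¹ᵁ V) :
    (pullSections φ V' U e₁).comp (restrict Z e) = pullSections φ V U e₂ := by
  ext s
  change (Z.left.presheaf.map (homOfLE e).op ≫ φ.left.appLE V' U e₁).hom s =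
    (φ.left.appLE V U e₂).hom s
  rw [Scheme.Hom.map_appLE]

theorem restrict_pullSections (φ : Y ⟶ Z) {V : Z.left.Opens} {U U' : Y.left.Opens} (e : U' ≤ U)
    (e₁ : U ≤ φ.left ⁻¹ᵁ V) (e₂ : U' ≤ φ.left ⁻¹ᵁ V) :
    (restrict Y e).comp (pullSections φ V U e₁) = pullSections φ V U' e₂ := by
  ext s
  change (φ.left.appLE V U e₁ ≫ Y.left.presheaf.map (homOfLE e).op).hom s =
    (φ.left.appLE V U' e₂).hom s
  rw [Scheme.Hom.appLE_map]

theorem pullSections_id (U : Y.left.Opens) (e : U ≤ (𝟙 Y : Y ⟶ Y).left ⁻¹ᵁ U) :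
    pullSections (𝟙 Y) U U e = AlgHom.id ℂ _ := by
  ext s
  have h1 : (𝟙 Y.left : Y.left ⟶ Y.left).appLE U U e = 𝟙 _ := by
    simp only [Scheme.Hom.appLE, Scheme.Hom.id_app]
    exact (Category.id_comp _).trans (Y.left.presheaf.map_id _)
  change ((𝟙 Y.left : Y.left ⟶ Y.left).appLE U U e).hom s = s
  rw [h1]
  rfl

variable (Y) in
/-- `H⁰(Y, Ω)`: the global sections of the sheaf of Kähler differentials of `Y` over `ℂ`, that is,
the compatible families of elements of `Ω[𝒪(U)⁄ℂ]`, for `U` running over the affine open subsets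
of `Y`. -/
def GlobalForms : Submodule ℂ (∀ U : Y.left.affineOpens, Ω[Sections Y U.1⁄ℂ]) where
  carrier := {ω | ∀ (V U : Y.left.affineOpens) (e : U.1 ≤ V.1),
    kaehlerMap (restrict Y e) (ω V) = ω U}
  add_mem' h₁ h₂ V U e := by
    rw [Pi.add_apply, map_add, h₁ V U e, h₂ V U e, Pi.add_apply]
  zero_mem' V U e := by rw [Pi.zero_apply, map_zero, Pi.zero_apply]
  smul_mem' c _ h V U e := by rw [Pi.smul_apply, map_smul, h V U e, Pi.smul_apply]

/-- The image of an affine open subset under an isomorphism. -/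
def imageOpen (φ : Y ≅ Z) (U : Y.left.affineOpens) : Z.left.affineOpens :=
  ⟨φ.inv.left ⁻¹ᵁ U.1,
    haveI : IsIso φ.inv.left := inferInstanceAs (IsIso ((Over.forget _).map φ.inv))
    U.2.preimage_of_isIso φ.inv.left⟩

theorem le_imageOpen (φ : Y ≅ Z) (U : Y.left.affineOpens) :
    U.1 ≤ φ.hom.left ⁻¹ᵁ (imageOpen φ U).1 := by
  change U.1 ≤ φ.hom.left ⁻¹ᵁ (φ.inv.left ⁻¹ᵁ U.1)
  rw [← Scheme.Hom.comp_preimage, ← Over.comp_left, φ.hom_inv_id]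
  exact le_refl _

theorem imageOpen_le (φ : Y ≅ Z) (U : Y.left.affineOpens) (V : Z.left.affineOpens)
    (e : U.1 ≤ φ.hom.left ⁻¹ᵁ V.1) : (imageOpen φ U).1 ≤ V.1 := by
  have h1 : (imageOpen φ U).1 ≤ φ.inv.left ⁻¹ᵁ (φ.hom.left ⁻¹ᵁ V.1) := fun p hp => e hp
  rw [← Scheme.Hom.comp_preimage, ← Over.comp_left, φ.inv_hom_id] at h1
  exact h1

/-- The value on `U` of the pullback `φ^* ω`. -/
def pullFamily (φ : Y ≅ Z) (ω : ∀ V : Z.left.affineOpens, Ω[Sections Z V.1⁄ℂ])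
    (U : Y.left.affineOpens) : Ω[Sections Y U.1⁄ℂ] :=
  kaehlerMap (pullSections φ.hom (imageOpen φ U).1 U.1 (le_imageOpen φ U)) (ω (imageOpen φ U))

theorem pullFamily_eq (φ : Y ≅ Z) {ω : ∀ V : Z.left.affineOpens, Ω[Sections Z V.1⁄ℂ]}
    (hω : ω ∈ GlobalForms Z) (U : Y.left.affineOpens) (V : Z.left.affineOpens)
    (e : U.1 ≤ φ.hom.left ⁻¹ᵁ V.1) :
    pullFamily φ ω U = kaehlerMap (pullSections φ.hom V.1 U.1 e) (ω V) := by
  unfold pullFamily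
  rw [← hω V (imageOpen φ U) (imageOpen_le φ U V e), kaehlerMap_comp,
    pullSections_restrict φ.hom _ _ e]

/-- The pullback `φ^* : H⁰(Z, Ω) → H⁰(Y, Ω)` along an isomorphism `φ : Y ≅ Z`. -/
def pullForms (φ : Y ≅ Z) : GlobalForms Z →ₗ[ℂ] GlobalForms Y where
  toFun ω := ⟨pullFamily φ ω.1, fun V U e => by
    have eV := le_imageOpen φ V
    have eU : U.1 ≤ φ.hom.left ⁻¹ᵁ (imageOpen φ V).1 := e.trans eV
    rw [pullFamily_eq φ ω.2 U (imageOpen φ V) eU, pullFamily_eq φ ω.2 V (imageOpen φ V) eV,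
      kaehlerMap_comp, restrict_pullSections φ.hom e eV eU]⟩
  map_add' ω η := by
    ext U : 2
    exact map_add (kaehlerMap _) _ _
  map_smul' c ω := by
    ext U : 2
    exact map_smul (kaehlerMap _) _ _

theorem pullForms_refl (ω : GlobalForms Y) : pullForms (Iso.refl Y) ω = ω := by
  ext U : 2
  change pullFamily (Iso.refl Y) ω.1 U = ω.1 U
  rw [pullFamily_eq (Iso.refl Y) ω.2 U U (le_refl _)]
  exact (congrArg (fun F => kaehlerMap F (ω.1 U)) (pullSections_id U.1 _)).trans
    (kaehlerMap_id _)

theorem pullForms_trans {W : Over (Spec (CommRingCat.of ℂ))} (φ : Y ≅ Z) (ψ : Z ≅ W)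
    (ω : GlobalForms W) : pullForms (φ ≪≫ ψ) ω = pullForms φ (pullForms ψ ω) := by
  ext U : 2
  change pullFamily (φ ≪≫ ψ) ω.1 U = pullFamily φ (pullForms ψ ω).1 U
  have e₁ := le_imageOpen φ U
  have e₂ := le_imageOpen ψ (imageOpen φ U)
  rw [pullFamily_eq φ (pullForms ψ ω).2 U (imageOpen φ U) e₁]
  change _ = kaehlerMap _ (pullFamily ψ ω.1 (imageOpen φ U))
  rw [pullFamily_eq ψ ω.2 (imageOpen φ U) _ e₂, kaehlerMap_comp,
    pullSections_comp φ.hom ψ.hom _ _ _ _ _ (fun p hp => e₂ (e₁ hp))]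
  exact pullFamily_eq (φ ≪≫ ψ) ω.2 U _ _

variable (Y) in
/-- `H⁰(Y, Ω)` as a representation of `Aut(Y)`: an automorphism `φ` acts by the pullback `φ^*`.
Since `(φ ∘ ψ)^* = ψ^* ∘ φ^*`, this is an action from the right, that is, a representation of the
opposite group. -/
def formsRep : Representation ℂ (Aut Y)ᵐᵒᵖ (GlobalForms Y) where
  toFun φ := pullForms φ.unop
  map_one' := by
    ext1 ω
    exact pullForms_refl ω
  map_mul' φ ψ := by
    ext1 ω
    exact pullForms_trans φ.unop ψ.unop ω

end Differentials

/-! ### The group `Γ(ρ)` and the modules `V_k(n)` -/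

section Forms

/-- The substitution `p(X, Y) ↦ p(a X + b Y, c X + d Y)`. -/
def subst (γ : Matrix.SpecialLinearGroup (Fin 2) ℂ) :
    MvPolynomial (Fin 2) ℂ →ₐ[ℂ] MvPolynomial (Fin 2) ℂ :=
  MvPolynomial.aeval fun i => ∑ j, MvPolynomial.C (γ i j) * MvPolynomial.X j

theorem subst_one : subst 1 = AlgHom.id ℂ _ := by
  apply MvPolynomial.algHom_ext
  intro i
  fin_cases i <;> simp [subst]

theorem subst_mul (γ δ : Matrix.SpecialLinearGroup (Fin 2) ℂ) :
    subst (γ * δ) = (subst δ).comp (subst γ) := by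
  apply MvPolynomial.algHom_ext
  intro i
  simp only [subst, MvPolynomial.aeval_X, AlgHom.comp_apply, Fin.sum_univ_two, map_add, map_mul,
    MvPolynomial.algHom_C, MvPolynomial.algebraMap_eq]
  have h1 : ∀ j, (γ * δ) i j = γ i 0 * δ 0 j + γ i 1 * δ 1 j := fun j => by
    rw [Matrix.SpecialLinearGroup.coe_mul, Matrix.mul_apply, Fin.sum_univ_two]
  simp only [h1, map_add, map_mul]
  ring

/-- Binary forms of degree `k`, that is, the `k`th symmetric power of the vector space `V` with
basis `X, Y`. -/
abbrev BinaryForms (k : ℕ) : Submodule ℂ (MvPolynomial (Fin 2) ℂ) :=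
  MvPolynomial.homogeneousSubmodule (Fin 2) ℂ k

theorem subst_mem (γ : Matrix.SpecialLinearGroup (Fin 2) ℂ) {k : ℕ} {p : MvPolynomial (Fin 2) ℂ}
    (hp : p ∈ BinaryForms k) : subst γ p ∈ BinaryForms k := by
  have h1 : (subst γ p).IsHomogeneous (1 * k) := by
    refine MvPolynomial.IsHomogeneous.aeval hp _ fun i => ?_
    refine MvPolynomial.IsHomogeneous.sum _ _ _ fun j _ => ?_
    simpa using (MvPolynomial.isHomogeneous_C _ (γ i j)).mul (MvPolynomial.isHomogeneous_X ℂ j)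
  rwa [one_mul] at h1

/-- The action of `γ` on binary forms of degree `k` by substitution: the `k`th symmetric power of
`X ↦ a X + b Y`, `Y ↦ c X + d Y`. -/
def substForms (k : ℕ) (γ : Matrix.SpecialLinearGroup (Fin 2) ℂ) :
    BinaryForms k →ₗ[ℂ] BinaryForms k :=
  (subst γ).toLinearMap.restrict fun _ hp => subst_mem γ hp

/-- `V_k(n)`: the element `(γ, u)` acts on the `k`th symmetric power `V_k` of the fundamental
representation by `u ^ n` times the action of `γ`. Like the pullback of differential forms, the
action of `γ` by substitution is an action from the right (the fundamental representation is the
space of row vectors, on which `γ` acts by right multiplication). -/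
def symRep (k : ℕ) (n : ℤ) :
    Representation ℂ (Matrix.SpecialLinearGroup (Fin 2) ℂ × ℂˣ)ᵐᵒᵖ (BinaryForms k) where
  toFun h := ((h.unop.2 ^ n : ℂˣ) : ℂ) • substForms k h.unop.1
  map_one' := by
    ext1 p
    apply Subtype.ext
    change (((1 : ℂˣ) ^ n : ℂˣ) : ℂ) • subst 1 p.1 = p.1
    rw [subst_one]
    simp
  map_mul' h h' := by
    ext1 p
    apply Subtype.ext
    change (((h'.unop.2 * h.unop.2) ^ n : ℂˣ) : ℂ) • subst (h'.unop.1 * h.unop.1) p.1 =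
      ((h.unop.2 ^ n : ℂˣ) : ℂ) • subst h.unop.1 (((h'.unop.2 ^ n : ℂˣ) : ℂ) • subst h'.unop.1 p.1)
    rw [subst_mul, map_smul, smul_smul, mul_zpow, Units.val_mul, mul_comm]
    rfl

/-- The group `Γ(ρ)` of the pairs `(γ, u)` that preserve the subvariety `V(z² - f(x))` under
`(x, z) ↦ ((a x + b) / (c x + d), u z / (c x + d) ^ (g+1))`, that is, with
`F(a x + b y, c x + d y) = u² F(x, y)`, where `F(x, y) = y ^ (2g+2) f(x/y)`. -/
def GammaRho (g : ℕ) (f : ℂ[X]) : Subgroup (Matrix.SpecialLinearGroup (Fin 2) ℂ × ℂˣ) where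
  carrier := {h | subst h.1 (f.homogenize (2 * g + 2)) =
    ((h.2 : ℂ) ^ 2) • f.homogenize (2 * g + 2)}
  one_mem' := by
    change subst 1 _ = _
    rw [subst_one]
    simp
  mul_mem' {h h'} h₁ h₂ := by
    change subst (h.1 * h'.1) _ = _
    have h₁ : subst h.1 _ = _ := h₁
    have h₂ : subst h'.1 _ = _ := h₂
    rw [subst_mul, AlgHom.comp_apply, h₁, map_smul, h₂, smul_smul]
    simp [mul_pow]
  inv_mem' {h} h₁ := by
    change subst h.1⁻¹ _ = _
    have h₁ : subst h.1 _ = _ := h₁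
    have h₂ := congrArg (subst h.1⁻¹) h₁
    rw [← AlgHom.comp_apply, ← subst_mul, mul_inv_cancel, subst_one, map_smul] at h₂
    have h₃ : f.homogenize (2 * g + 2) =
        ((h.2 : ℂ) ^ 2) • subst h.1⁻¹ (f.homogenize (2 * g + 2)) := h₂
    conv_rhs => rw [h₃]
    rw [smul_smul]
    simp

end Forms

/-! ### The action on the curve and the forms `xⁱ dx / z` -/

section Action

variable (g : ℕ) (f : ℂ[X]) (hf : f.natDegree ≤ 2 * g + 2)

/-- The affine open subset `V(z² - f(x))` of `C_f`. -/
def affinePart : (Curve g f hf).left.affineOpens :=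
  ⟨(chartLeft (isReversal_reflect hf)) ''ᵁ ⊤,
    (isAffineOpen_top _).image_of_isOpenImmersion (chartLeft (isReversal_reflect hf))⟩

/-- An element of the coordinate ring of `V(z² - f(x))` as a regular function on that open subset
of `C_f`. -/
def coordinate (a : Chart f) : Sections (Curve g f hf) (affinePart g f hf).1 :=
  ((Scheme.ΓSpecIso (CommRingCat.of (Chart f))).inv ≫
    ((chartLeft (isReversal_reflect hf)).appIso ⊤).inv).hom a

/-- The automorphism `φ` of `C_f` is given by
`(x, z) ↦ ((a x + b) / (c x + d), u z / (c x + d) ^ (g+1))`: the equations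
`(c x + d) φ^*x = a x + b` and `(c x + d) ^ (g+1) φ^*z = u z` hold on the open set of the points
`p` such that `p` and `φ(p)` lie in the affine part `V(z² - f(x))`. -/
def IsInducedBy (h : Matrix.SpecialLinearGroup (Fin 2) ℂ × ℂˣ) (φ : Aut (Curve g f hf)) : Prop :=
  let U : (Curve g f hf).left.Opens := (affinePart g f hf).1
  let W : (Curve g f hf).left.Opens := U ⊓ φ.hom.left ⁻¹ᵁ U
  let x := restrict (Curve g f hf) (inf_le_left : W ≤ U) (coordinate g f hf (Chart.x f))
  let z := restrict (Curve g f hf) (inf_le_left : W ≤ U) (coordinate g f hf (Chart.z f))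
  let x' := pullSections φ.hom U W inf_le_right (coordinate g f hf (Chart.x f))
  let z' := pullSections φ.hom U W inf_le_right (coordinate g f hf (Chart.z f))
  (h.1 1 0 • x + algebraMap ℂ _ (h.1 1 1)) * x' =
      h.1 0 0 • x + algebraMap ℂ _ (h.1 0 1) ∧
    (h.1 1 0 • x + algebraMap ℂ _ (h.1 1 1)) ^ (g + 1) * z' = (h.2 : ℂ) • z

/-- The global form `ω` is `xⁱ dx / z` on the affine part `V(z² - f(x))`. -/
def IsStandardForm (i : ℕ) (ω : GlobalForms (Curve g f hf)) : Prop :=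
  coordinate g f hf (Chart.z f) • ω.1 (affinePart g f hf) =
    coordinate g f hf (Chart.x f) ^ i •
      KaehlerDifferential.D ℂ (Sections (Curve g f hf) (affinePart g f hf).1)
        (coordinate g f hf (Chart.x f))

end Action

/-- The binary form `X ^ i Y ^ (g-1-i)` of degree `g-1`, for `0 ≤ i < g`. -/
def monomialForm (g : ℕ) (i : Fin g) : BinaryForms (g - 1) :=
  ⟨MvPolynomial.X 0 ^ (i : ℕ) * MvPolynomial.X 1 ^ (g - 1 - i : ℕ), by
    have h1 := (MvPolynomial.isHomogeneous_X_pow (R := ℂ) (0 : Fin 2) (i : ℕ)).mul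
      (MvPolynomial.isHomogeneous_X_pow (R := ℂ) (1 : Fin 2) (g - 1 - i : ℕ))
    rwa [Nat.add_sub_cancel' (Nat.le_sub_one_of_lt i.2)] at h1⟩

end HyperellipticDifferentials

end

open HyperellipticDifferentials

noncomputable section

namespace HyperellipticDifferentials

/-! ### The coordinate ring of an affine chart -/

section ChartAlgebra

variable {h : ℂ[X]} {S : Type*} [CommRing S] [Algebra ℂ S]

/-! Write `K` for the fraction field of ℂ[x, z]/(z² - f) and n = g + 1. Everything is read off at
the generic point Spec K → C_f.

Forms. The vector field 2z ∂/∂x + f'(x) ∂/∂z identifies the differentials of a chart with its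
coordinate ring, with generator dx/2z; this uses that f and f', and likewise the reversed polynomial
and its derivative, are coprime (`exists_generator`, `squarefree_reflect`). As functions and forms
on both charts embed in `K`, a global form is the same thing as an element of `K` that is locally
the coefficient of a form (`globalCoeff_injective`, `exists_globalCoeff_eq`). The generator of the
second chart is -x^(n-2) dx/2z. Comparing p(x) + q(x)z with -x^(n-2) (r(1/x) + s(1/x) z/xⁿ) leaves q
= 0 and deg p ≤ n - 2 = g - 1 (`exists_polynomial`, `exists_form`).

Automorphisms. A pair (γ, u) gives the morphism with weighted homogeneous coordinates (ax + b : cx +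
d : uz) on the first chart and (a + bx̃ : c + dx̃ : uz̃) on the second (`exists_moebius`).
Endomorphisms of the curve that agree at the generic point are equal (`hom_ext_of_generic`), so
uniqueness and the group law become identities in `K`.

Surjectivity. For an automorphism φ put y = φ^*x. The pullbacks of xⁱ dx/2z have coefficients Pᵢ(x)
with deg Pᵢ ≤ g - 1 and Pᵢ = yⁱ P₀. If y = q/p in lowest terms, then P_(g-1) = y^(g-1) P₀ forces
p^(g-1) to divide P₀ and q^(g-1) to divide P_(g-1). As g - 1 ≥ 1, both p and q have degree at most
1, so y = (ax + b)/(cx + d), and P₀ = e (cx + d)^(g-1) (`exists_linear_fraction`). Since dy = dx/(cx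
+ d)² for determinant 1, this gives φ^*z = e⁻¹ z/(cx + d)^(g+1), that is, u = e⁻¹; the equation of
the curve then yields F ∘ γ = u² F.

Representation. In the pullback of p(x, 1) dx/z, the factor dx contributes (cx + d)^(-2) and 1/z
contributes u⁻¹ (cx + d)^(g+1); the remaining power (cx + d)^(g-1) turns p(y, 1) into p(ax + b, cx +
d) (`pullForms_formsEquiv`). -/

theorem Chart.monic (h : ℂ[X]) : (X ^ 2 - C h : ℂ[X][X]).Monic :=
  monic_X_pow_sub_C h two_ne_zero

theorem Chart.of_eq_aeval (p : ℂ[X]) :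
    AdjoinRoot.of (X ^ 2 - C h : ℂ[X][X]) p = aeval (Chart.x h) p := by
  have h2 : aeval (Chart.x h) p = AdjoinRoot.of (X ^ 2 - C h : ℂ[X][X]) (aeval X p) :=
    aeval_algHom_apply (AdjoinRoot.ofAlgHom ℂ (X ^ 2 - C h : ℂ[X][X])) X p
  rw [h2, aeval_X_left_apply]

theorem Chart.exists_eq (a : Chart h) :
    ∃ p q : ℂ[X], a = aeval (Chart.x h) p + aeval (Chart.x h) q * Chart.z h := by
  obtain ⟨b, rfl⟩ := AdjoinRoot.mk_surjective a
  rw [← AdjoinRoot.mk_leftInverse (Chart.monic h) (AdjoinRoot.mk _ b), AdjoinRoot.modByMonicHom_mk]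
  have hd : (b %ₘ (X ^ 2 - C h)).degree ≤ 1 := by
    have h1 := degree_modByMonic_lt b (Chart.monic h)
    rw [degree_X_pow_sub_C two_pos] at h1
    exact Order.le_of_lt_succ h1
  rw [eq_X_add_C_of_degree_le_one hd]
  refine ⟨(b %ₘ (X ^ 2 - C h)).coeff 0, (b %ₘ (X ^ 2 - C h)).coeff 1, ?_⟩
  rw [map_add, map_mul, AdjoinRoot.mk_C, AdjoinRoot.mk_C, AdjoinRoot.mk_X, Chart.of_eq_aeval,
    Chart.of_eq_aeval, add_comm]
  rfl

theorem Chart.eq_zero_of_add_eq_zero {p q : ℂ[X]}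
    (hpq : aeval (Chart.x h) p + aeval (Chart.x h) q * Chart.z h = 0) : p = 0 ∧ q = 0 := by
  have h1 : AdjoinRoot.mk (X ^ 2 - C h : ℂ[X][X]) (C q * X + C p) = 0 := by
    rw [map_add, map_mul, AdjoinRoot.mk_C, AdjoinRoot.mk_C, AdjoinRoot.mk_X, Chart.of_eq_aeval,
      Chart.of_eq_aeval, add_comm]
    exact hpq
  rw [AdjoinRoot.mk_eq_zero] at h1
  have h2 : (C q * X + C p : ℂ[X][X]) = 0 := by
    refine eq_zero_of_dvd_of_degree_lt h1 ?_
    rw [degree_X_pow_sub_C two_pos]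
    exact degree_linear_lt
  constructor
  · simpa using congrArg (fun r => coeff r 0) h2
  · simpa using congrArg (fun r => coeff r 1) h2

theorem Chart.algHom_ext {a b : Chart h →ₐ[ℂ] S} (hx : a (Chart.x h) = b (Chart.x h))
    (hz : a (Chart.z h) = b (Chart.z h)) : a = b := by
  apply AdjoinRoot.algHom_ext'
  · apply Polynomial.algHom_ext
    exact hx
  · exact hz

/-- The homomorphism `x ↦ a`, `z ↦ b`, where `b² = h(a)`. -/
def Chart.lift (a b : S) (hab : b ^ 2 = aeval a h) : Chart h →ₐ[ℂ] S :=
  AdjoinRoot.liftAlgHom (X ^ 2 - C h : ℂ[X][X]) (aeval a) b (by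
    rw [eval₂_sub, eval₂_C, eval₂_X_pow, hab]
    exact sub_self _)

theorem Chart.lift_x (a b : S) (hab : b ^ 2 = aeval a h) :
    Chart.lift a b hab (Chart.x h) = a :=
  (AdjoinRoot.liftAlgHom_of (X ^ 2 - C h : ℂ[X][X]) (aeval a) _ _ X).trans (aeval_X _)

theorem Chart.lift_z (a b : S) (hab : b ^ 2 = aeval a h) :
    Chart.lift a b hab (Chart.z h) = b := by
  simp [Chart.lift, Chart.z]

theorem Chart.map_aeval (a : Chart h →ₐ[ℂ] S) (p : ℂ[X]) :
    a (aeval (Chart.x h) p) = aeval (a (Chart.x h)) p :=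
  (aeval_algHom_apply a (Chart.x h) p).symm

theorem Chart.map_z_sq (a : Chart h →ₐ[ℂ] S) : a (Chart.z h) ^ 2 = aeval (a (Chart.x h)) h := by
  rw [← map_pow, Chart.z_sq, Chart.map_aeval]

theorem Chart.adjoin_eq_top : Algebra.adjoin ℂ {Chart.x h, Chart.z h} = ⊤ := by
  rw [eq_top_iff]
  rintro a -
  obtain ⟨p, q, rfl⟩ := Chart.exists_eq a
  have hx (p : ℂ[X]) : aeval (Chart.x h) p ∈ Algebra.adjoin ℂ {Chart.x h, Chart.z h} :=
    Algebra.adjoin_mono (by simp) (aeval_mem_adjoin_singleton ℂ (Chart.x h))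
  have hz : Chart.z h ∈ Algebra.adjoin ℂ {Chart.x h, Chart.z h} :=
    Algebra.subset_adjoin (by simp)
  exact add_mem (hx p) (mul_mem (hx q) hz)

/-- A root of the monic quadratic z² - h would make h a square r²; squarefreeness then makes r, and
hence h, a unit. -/
theorem Chart.isDomain (hsq : Squarefree h) (hu : ¬ IsUnit h) : IsDomain (Chart h) := by
  refine AdjoinRoot.isDomain_of_prime ?_
  rw [← irreducible_iff_prime]
  have hd : (X ^ 2 - C h : ℂ[X][X]).natDegree = 2 := natDegree_X_pow_sub_C
  rw [(Chart.monic h).irreducible_iff_roots_eq_zero_of_degree_le_three hd.ge (by omega)]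
  refine Multiset.eq_zero_of_forall_notMem fun r hr => hu ?_
  have h1 : r ^ 2 - h = 0 := by simpa using (mem_roots'.1 hr).2
  have h2 : r * r = h := by rw [← pow_two]; exact sub_eq_zero.1 h1
  have h3 := hsq r (h2 ▸ dvd_rfl)
  exact h2 ▸ h3.mul h3

end ChartAlgebra

/-! ### Differentials of an affine chart -/

section Hamiltonian

variable (h : ℂ[X])

/-- To first order in ε both sides have ε-part 2z h'(x): the vector field is tangent to the curve.
Dual numbers turn the wanted derivation into an algebra homomorphism, which can be prescribed on x
and z. -/
theorem hamiltonian_aux :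
    (TrivSqZeroExt.inl (Chart.z h) +
      TrivSqZeroExt.inr (aeval (Chart.x h) (derivative h))) ^ 2 =
      aeval (TrivSqZeroExt.inl (Chart.x h) +
        TrivSqZeroExt.inr (2 * Chart.z h) : DualNumber (Chart h)) h := by
  have h1 (p : ℂ[X]) : aeval (TrivSqZeroExt.inl (Chart.x h) : DualNumber (Chart h)) p =
      TrivSqZeroExt.inl (aeval (Chart.x h) p) :=
    aeval_algebraMap_apply (DualNumber (Chart h)) (Chart.x h) p
  rw [aeval_add_of_sq_eq_zero _ _ _ (by rw [pow_two, TrivSqZeroExt.inr_mul_inr]),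
    h1, h1, ← Chart.z_sq]
  apply TrivSqZeroExt.ext
  · simp
  · simp [pow_two]
    ring

/-- The first-order deformation of the identity of `Chart h` along the Hamiltonian vector field. -/
def hamiltonianLift : Chart h →ₐ[ℂ] DualNumber (Chart h) :=
  Chart.lift _ _ (hamiltonian_aux h)

theorem fst_hamiltonianLift (a : Chart h) : (hamiltonianLift h a).fst = a := by
  have h1 : (TrivSqZeroExt.fstHom ℂ (Chart h) (Chart h)).comp (hamiltonianLift h) =
      AlgHom.id ℂ (Chart h) := by
    refine Chart.algHom_ext ?_ ?_
    · simp [hamiltonianLift, Chart.lift_x]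
    · simp [hamiltonianLift, Chart.lift_z]
  exact DFunLike.congr_fun h1 a

/-- The Hamiltonian vector field `2 z ∂/∂x + h'(x) ∂/∂z` on the curve `z² = h(x)`. -/
def hamiltonian : Derivation ℂ (Chart h) (Chart h) :=
  Derivation.mk' ((TrivSqZeroExt.sndHom (Chart h) (Chart h)).restrictScalars ℂ ∘ₗ
    (hamiltonianLift h).toLinearMap) fun a b => by
      simp [fst_hamiltonianLift, mul_comm]

theorem hamiltonian_x : hamiltonian h (Chart.x h) = 2 * Chart.z h := by
  change (hamiltonianLift h (Chart.x h)).snd = _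
  simp [hamiltonianLift, Chart.lift_x]

theorem hamiltonian_z : hamiltonian h (Chart.z h) = aeval (Chart.x h) (derivative h) := by
  change (hamiltonianLift h (Chart.z h)).snd = _
  simp [hamiltonianLift, Chart.lift_z]

/-- The coefficient of a differential form with respect to `dx / 2z`. -/
def chartCoeff : Ω[Chart h⁄ℂ] →ₗ[Chart h] Chart h :=
  (hamiltonian h).liftKaehlerDifferential

theorem chartCoeff_D (a : Chart h) :
    chartCoeff h (KaehlerDifferential.D ℂ (Chart h) a) = hamiltonian h a :=
  Derivation.liftKaehlerDifferential_comp_D _ _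

variable {h}

theorem chart_two_z_smul_D_z :
    (2 * Chart.z h) • KaehlerDifferential.D ℂ (Chart h) (Chart.z h) =
      aeval (Chart.x h) (derivative h) • KaehlerDifferential.D ℂ (Chart h) (Chart.x h) := by
  rw [← Derivation.map_aeval, ← Chart.z_sq, Derivation.leibniz_pow]
  simp [mul_smul, two_smul]

/-- If `h` and `h'` are coprime, `dx / 2z` is a basis of the module of differentials. -/
theorem exists_generator (hc : IsCoprime h (derivative h)) :
    ∃ η : Ω[Chart h⁄ℂ], chartCoeff h η = 1 ∧ ∀ w, w = chartCoeff h w • η := by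
  obtain ⟨u, v, huv⟩ := hc
  set x := Chart.x h
  set z := Chart.z h
  set D := KaehlerDifferential.D ℂ (Chart h)
  have huv' : aeval x u * z ^ 2 + aeval x v * aeval x (derivative h) = 1 := by
    rw [Chart.z_sq, ← map_mul, ← map_mul, ← map_add, huv, map_one]
  have h2 : algebraMap ℂ (Chart h) (1/2) * 2 = 1 := by
    rw [← map_ofNat (algebraMap ℂ (Chart h)) 2, ← map_mul]; norm_num
  -- From u h + v h' = 1 and z² = h, the form (uz/2) dx + v dz has coefficient u z² + v h' = 1.
  set r := algebraMap ℂ (Chart h) (1/2) * aeval x u * z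
  set s := aeval x v
  have hrs : r * (2 * z) + s * aeval x (derivative h) = 1 := by
    linear_combination huv' + (aeval x u * z ^ 2) * h2
  have hz : (2 * z) • D z = aeval x (derivative h) • D x := chart_two_z_smul_D_z
  refine ⟨r • D x + s • D z, ?_, ?_⟩
  · rw [map_add, map_smul, map_smul, chartCoeff_D, chartCoeff_D, hamiltonian_x, hamiltonian_z,
      smul_eq_mul, smul_eq_mul]
    exact hrs
  · have hx1 : (2 * z) • (r • D x + s • D z) = D x := by
      rw [smul_add, smul_comm (2 * z) s, hz, smul_smul, smul_smul, ← add_smul, mul_comm (2 * z) r,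
        hrs, one_smul]
    have hz1 : aeval x (derivative h) • (r • D x + s • D z) = D z := by
      rw [smul_add, smul_comm _ r, ← hz, smul_smul, smul_smul, ← add_smul, mul_comm _ s, hrs,
        one_smul]
    set η := r • D x + s • D z
    -- Derivations that agree on x and z are equal, so every da is a multiple of η.
    have hD : D = ((LinearMap.toSpanSingleton (Chart h) _ η).compDer (hamiltonian h)) := by
      refine Derivation.ext_of_adjoin_eq_top _ Chart.adjoin_eq_top ?_
      rintro a (rfl | rfl)
      · change D x = hamiltonian h (Chart.x h) • η
        rw [hamiltonian_x, hx1]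
      · change D z = hamiltonian h (Chart.z h) • η
        rw [hamiltonian_z, hz1]
    have key : (LinearMap.toSpanSingleton (Chart h) _ η) ∘ₗ chartCoeff h = LinearMap.id := by
      refine Derivation.liftKaehlerDifferential_unique _ _ ?_
      apply Derivation.ext
      intro a
      change chartCoeff h (D a) • η = D a
      conv_rhs => rw [hD]
      rw [chartCoeff_D]
      rfl
    intro w
    exact (DFunLike.congr_fun key w).symm

theorem chartCoeff_injective (hc : IsCoprime h (derivative h)) :
    Function.Injective (chartCoeff h) := by
  obtain ⟨η, -, hη⟩ := exists_generator hc
  intro v w hvw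
  rw [hη v, hη w, hvw]

theorem chartCoeff_surjective (hc : IsCoprime h (derivative h)) :
    Function.Surjective (chartCoeff h) := by
  obtain ⟨η, h1, -⟩ := exists_generator hc
  exact fun a => ⟨a • η, by rw [map_smul, h1, smul_eq_mul, mul_one]⟩

end Hamiltonian

/-! ### Points with values in an algebra and evaluation of functions -/

section Evaluation

/-- The spectrum of a `ℂ`-algebra as a scheme over `ℂ`. -/
def specOver (S : Type) [CommRing S] [Algebra ℂ S] : Over (Spec (CommRingCat.of ℂ)) :=
  Over.mk (Spec.map (CommRingCat.ofHom (algebraMap ℂ S)))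

theorem specMap_appLE_top {R S : CommRingCat.{0}} (f : R ⟶ S)
    (e : (⊤ : (Spec S).Opens) ≤ Spec.map f ⁻¹ᵁ ⊤) :
    (Spec.map f).appLE ⊤ ⊤ e ≫ (Scheme.ΓSpecIso S).hom = (Scheme.ΓSpecIso R).hom ≫ f := by
  rw [← Scheme.ΓSpecIso_naturality]
  congr 1

variable {S T : Type} [CommRing S] [Algebra ℂ S] [CommRing T] [Algebra ℂ T]
  {Y Z : Over (Spec (CommRingCat.of ℂ))}

/-- The morphism of spectra of a homomorphism of `ℂ`-algebras. -/
def specOverMap (a : S →ₐ[ℂ] T) : specOver T ⟶ specOver S :=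
  Over.homMk (Spec.map (CommRingCat.ofHom a.toRingHom)) (by
    change Spec.map _ ≫ Spec.map _ = Spec.map _
    rw [← Spec.map_comp, ← CommRingCat.ofHom_comp]
    congr 2
    exact a.comp_algebraMap)

theorem specOverMap_comp {R : Type} [CommRing R] [Algebra ℂ R] (a : R →ₐ[ℂ] S) (b : S →ₐ[ℂ] T) :
    specOverMap (b.comp a) = specOverMap b ≫ specOverMap a := by
  apply Over.OverMorphism.ext
  change Spec.map _ = Spec.map _ ≫ Spec.map _
  rw [← Spec.map_comp, ← CommRingCat.ofHom_comp]
  rfl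

variable (S) in
/-- The global functions on the spectrum of `S`. -/
def topEval : Sections (specOver S) ⊤ →ₐ[ℂ] S where
  __ := (Scheme.ΓSpecIso (CommRingCat.of S)).hom.hom
  commutes' c := by
    change ((Scheme.ΓSpecIso (CommRingCat.of ℂ)).inv ≫
      (Spec.map (CommRingCat.ofHom (algebraMap ℂ S))).appLE ⊤ ⊤ _ ≫
        (Scheme.ΓSpecIso (CommRingCat.of S)).hom).hom c = _
    refine (congrArg (fun t => ((Scheme.ΓSpecIso (CommRingCat.of ℂ)).inv ≫ t).hom c)
      (specMap_appLE_top (CommRingCat.ofHom (algebraMap ℂ S)) le_top)).trans ?_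
    simp only [Iso.inv_hom_id_assoc]
    rfl

theorem topEval_bijective : Function.Bijective (topEval S) :=
  ConcreteCategory.bijective_of_isIso (Scheme.ΓSpecIso (CommRingCat.of S)).hom

/-- The value at an `S`-valued point of a function defined near it. -/
def evalAt (ψ : specOver S ⟶ Y) (U : Y.left.Opens) (e : ⊤ ≤ ψ.left ⁻¹ᵁ U) :
    Sections Y U →ₐ[ℂ] S :=
  (topEval S).comp (pullSections ψ U ⊤ e)

theorem evalAt_comp_restrict (ψ : specOver S ⟶ Y) {U V : Y.left.Opens} (h : U ≤ V)
    (e : ⊤ ≤ ψ.left ⁻¹ᵁ U) (e' : ⊤ ≤ ψ.left ⁻¹ᵁ V) :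
    (evalAt ψ U e).comp (restrict Y h) = evalAt ψ V e' := by
  unfold evalAt
  rw [AlgHom.comp_assoc, pullSections_restrict]

theorem evalAt_restrict (ψ : specOver S ⟶ Y) {U V : Y.left.Opens} (h : U ≤ V)
    (e : ⊤ ≤ ψ.left ⁻¹ᵁ U) (s : Sections Y V) :
    evalAt ψ U e (restrict Y h s) = evalAt ψ V (fun _ hp => h (e hp)) s :=
  DFunLike.congr_fun (evalAt_comp_restrict ψ h e _) s

theorem evalAt_comp_pullSections (ψ : specOver S ⟶ Y) (φ : Y ⟶ Z) {U : Y.left.Opens}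
    {V : Z.left.Opens} (e : ⊤ ≤ ψ.left ⁻¹ᵁ U) (e' : U ≤ φ.left ⁻¹ᵁ V)
    (e'' : ⊤ ≤ (ψ ≫ φ).left ⁻¹ᵁ V) :
    (evalAt ψ U e).comp (pullSections φ V U e') = evalAt (ψ ≫ φ) V e'' := by
  unfold evalAt
  rw [AlgHom.comp_assoc, pullSections_comp]

theorem evalAt_specOverMap (a : S →ₐ[ℂ] T) (ψ : specOver S ⟶ Y) (U : Y.left.Opens)
    (e : ⊤ ≤ ψ.left ⁻¹ᵁ U) (e' : ⊤ ≤ (specOverMap a ≫ ψ).left ⁻¹ᵁ U) :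
    evalAt (specOverMap a ≫ ψ) U e' = a.comp (evalAt ψ U e) := by
  have h1 : (topEval T).comp (pullSections (specOverMap a) ⊤ ⊤ le_top) = a.comp (topEval S) := by
    ext s
    change ((Spec.map (CommRingCat.ofHom a.toRingHom)).appLE ⊤ ⊤ _ ≫
      (Scheme.ΓSpecIso (CommRingCat.of T)).hom).hom s =
      ((Scheme.ΓSpecIso (CommRingCat.of S)).hom ≫ CommRingCat.ofHom a.toRingHom).hom s
    exact congrArg (fun t => t.hom s) (specMap_appLE_top (CommRingCat.ofHom a.toRingHom) le_top)
  unfold evalAt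
  rw [← AlgHom.comp_assoc, ← h1, AlgHom.comp_assoc]
  exact congrArg _ (pullSections_comp _ _ _ _ _ _ _ _).symm

end Evaluation

/-! ### Localization of functions and forms -/

section Localization

theorem kaehlerMap_smul {A B : Type} [CommRing A] [CommRing B] [Algebra ℂ A] [Algebra ℂ B]
    (φ : A →ₐ[ℂ] B) (a : A) (w : Ω[A⁄ℂ]) : kaehlerMap φ (a • w) = φ a • kaehlerMap φ w := by
  let _ := φ.toRingHom.toAlgebra
  have : IsScalarTower ℂ A B := IsScalarTower.of_algebraMap_eq' φ.comp_algebraMap.symm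
  change KaehlerDifferential.map ℂ ℂ A B (a • w) =
    algebraMap A B a • KaehlerDifferential.map ℂ ℂ A B w
  rw [LinearMap.map_smul, algebraMap_smul]

theorem kaehlerMap_D {A B : Type} [CommRing A] [CommRing B] [Algebra ℂ A] [Algebra ℂ B]
    (φ : A →ₐ[ℂ] B) (a : A) :
    kaehlerMap φ (KaehlerDifferential.D ℂ A a) = KaehlerDifferential.D ℂ B (φ a) := by
  have := kaehlerMap_smul_D φ 1 a
  rwa [one_smul, map_one, one_smul] at this

section
variable {A B : Type} [CommRing A] [CommRing B] [Algebra ℂ A] [Algebra ℂ B]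
  (φ : A →ₐ[ℂ] B) (M : Submonoid A)

theorem exists_smul_eq_kaehlerMap (hφ : @IsLocalization _ _ M B _ φ.toRingHom.toAlgebra)
    (w : Ω[B⁄ℂ]) : ∃ r ∈ M, ∃ m : Ω[A⁄ℂ], φ r • w = kaehlerMap φ m := by
  let _ := φ.toRingHom.toAlgebra
  have : IsScalarTower ℂ A B := IsScalarTower.of_algebraMap_eq' φ.comp_algebraMap.symm
  obtain ⟨⟨m, r⟩, h⟩ := IsLocalizedModule.surj M (KaehlerDifferential.map ℂ ℂ A B) w
  refine ⟨r, r.2, m, ?_⟩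
  change _ = KaehlerDifferential.map ℂ ℂ A B m
  rw [← h]
  exact algebraMap_smul B (r : A) w

theorem exists_smul_eq_zero_of_kaehlerMap_eq_zero
    (hφ : @IsLocalization _ _ M B _ φ.toRingHom.toAlgebra) {m : Ω[A⁄ℂ]}
    (hm : kaehlerMap φ m = 0) : ∃ r ∈ M, r • m = 0 := by
  let _ := φ.toRingHom.toAlgebra
  have : IsScalarTower ℂ A B := IsScalarTower.of_algebraMap_eq' φ.comp_algebraMap.symm
  obtain ⟨r, hr⟩ := (IsLocalizedModule.eq_zero_iff M (KaehlerDifferential.map ℂ ℂ A B)).1 hm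
  exact ⟨r, r.2, hr⟩

end

variable {Y : Over (Spec (CommRingCat.of ℂ))}

/-- `W` is a variable with an equation, so that one open set can serve as a basic open set of two
affine open sets at once. -/
theorem isLocalization_restrict {U : Y.left.Opens} (hU : IsAffineOpen U) (r : Sections Y U)
    {W : Y.left.Opens} (hW : W = Y.left.basicOpen (show Γ(Y.left, U) from r)) (e : W ≤ U) :
    @IsLocalization _ _ (Submonoid.powers r) (Sections Y W) _
      (restrict Y e).toRingHom.toAlgebra := by
  subst hW
  exact hU.isLocalization_basicOpen r

theorem isUnit_restrict {U : Y.left.Opens} (r : Sections Y U)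
    {W : Y.left.Opens} (hW : W = Y.left.basicOpen (show Γ(Y.left, U) from r)) (e : W ≤ U) :
    IsUnit (restrict Y e r) := by
  subst hW
  exact RingedSpace.isUnit_res_basicOpen _ (show Γ(Y.left, U) from r)

/-- The basic open sets of the elements of `I` cover `U`, so these elements generate the unit ideal.
In the applications `I` is an annihilator or an ideal of denominators. -/
theorem ideal_eq_top {U : Y.left.Opens} (hU : IsAffineOpen U) (I : Ideal (Sections Y U))
    (hI : ∀ p ∈ U, ∃ (r : Sections Y U) (n : ℕ), r ^ n ∈ I ∧
      p ∈ Y.left.basicOpen (show Γ(Y.left, U) from r)) : I = ⊤ := by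
  have h1 := (IsAffineOpen.iSup_basicOpen_eq_self_iff hU (s := (I : Set (Sections Y U)))).1 (by
    apply le_antisymm
    · exact iSup_le fun r => Y.left.basicOpen_le _
    · intro p hp
      obtain ⟨r, n, hr, hp'⟩ := hI p hp
      -- The exponent is raised by one because `n` may be 0, and only positive powers keep the basic
      -- open set.
      have h2 := Y.left.basicOpen_pow (show Γ(Y.left, U) from r) n.succ_pos
      have h3 : r ^ (n + 1) ∈ I := pow_succ r n ▸ I.mul_mem_right r hr
      exact TopologicalSpace.Opens.mem_iSup.2 ⟨⟨r ^ (n + 1), h3⟩, h2.ge hp'⟩)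
  exact (Ideal.span_eq I).symm.trans h1

theorem exists_basicOpen_subset {V : Y.left.Opens} (hV : IsAffineOpen V) {U : Y.left.Opens}
    {p : Y.left} (hpU : p ∈ U) (hpV : p ∈ V) :
    ∃ (f : Sections Y V) (W : Y.left.Opens),
      W = Y.left.basicOpen (show Γ(Y.left, V) from f) ∧ p ∈ W ∧ W ≤ U ∧ W ≤ V := by
  obtain ⟨f, hf, hpf⟩ := hV.exists_basicOpen_le ⟨p, hpU⟩ hpV
  exact ⟨f, _, rfl, hpf, hf, Y.left.basicOpen_le f⟩

theorem exists_basicOpen_inter {U V : Y.left.Opens} (hU : IsAffineOpen U) (hV : IsAffineOpen V)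
    {p : Y.left} (hpU : p ∈ U) (hpV : p ∈ V) :
    ∃ (f : Sections Y U) (g : Sections Y V) (W : Y.left.Opens),
      W = Y.left.basicOpen (show Γ(Y.left, U) from f) ∧
      W = Y.left.basicOpen (show Γ(Y.left, V) from g) ∧ p ∈ W ∧ W ≤ U ∧ W ≤ V := by
  obtain ⟨f, g, hfg, hpf⟩ := exists_basicOpen_le_affine_inter hU hV p ⟨hpU, hpV⟩
  exact ⟨f, g, _, rfl, hfg, hpf, Y.left.basicOpen_le f, hfg ▸ Y.left.basicOpen_le g⟩

end Localization

/-! ### Global forms in terms of a rational coordinate -/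

section Good

variable {Y : Over (Spec (CommRingCat.of ℂ))} {K : Type} [Field K] [Algebra ℂ K]
  (ι : specOver K ⟶ Y) (δ : Ω[K⁄ℂ] →ₗ[K] K)

/-- The coefficient of a form on `U` at a generic point, with respect to a functional `δ`. -/
def formCoeff (U : Y.left.Opens) (e : ⊤ ≤ ι.left ⁻¹ᵁ U) : Ω[Sections Y U⁄ℂ] →ₗ[ℂ] K :=
  δ.restrictScalars ℂ ∘ₗ kaehlerMap (evalAt ι U e)

theorem formCoeff_apply {U : Y.left.Opens} (e : ⊤ ≤ ι.left ⁻¹ᵁ U) (w : Ω[Sections Y U⁄ℂ]) :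
    formCoeff ι δ U e w = δ (kaehlerMap (evalAt ι U e) w) := rfl

theorem formCoeff_smul {U : Y.left.Opens} (e : ⊤ ≤ ι.left ⁻¹ᵁ U) (r : Sections Y U)
    (w : Ω[Sections Y U⁄ℂ]) :
    formCoeff ι δ U e (r • w) = evalAt ι U e r * formCoeff ι δ U e w := by
  rw [formCoeff_apply, kaehlerMap_smul, map_smul, smul_eq_mul]
  rfl

theorem formCoeff_restrict {U V : Y.left.Opens} (h : U ≤ V) (e : ⊤ ≤ ι.left ⁻¹ᵁ U)
    (e' : ⊤ ≤ ι.left ⁻¹ᵁ V) (w : Ω[Sections Y V⁄ℂ]) :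
    formCoeff ι δ U e (kaehlerMap (restrict Y h) w) = formCoeff ι δ V e' w := by
  rw [formCoeff_apply, kaehlerMap_comp, evalAt_comp_restrict ι h e e', formCoeff_apply]

/-- Functions and forms on `V` are determined by their values at the generic point. -/
structure IsGood (V : Y.left.affineOpens) : Prop where
  le : ⊤ ≤ ι.left ⁻¹ᵁ V.1
  eval_injective : Function.Injective (evalAt ι V.1 le)
  coeff_injective : Function.Injective (formCoeff ι δ V.1 le)

variable {ι δ}
variable (hc : ∀ p : Y.left, ∃ V : Y.left.affineOpens, p ∈ V.1 ∧ IsGood ι δ V)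

include hc

/-- Around `p` the set contains a basic open set D(f) of a good `V`. Since D(f) is not empty, f ≠ 0,
so its value is non-zero in the field `K`, hence a unit, and the `K`-point lies in D(f). -/
theorem le_preimage_of_mem {U : Y.left.Opens} {p : Y.left} (hp : p ∈ U) :
    ⊤ ≤ ι.left ⁻¹ᵁ U := by
  obtain ⟨V, hpV, hV⟩ := hc p
  obtain ⟨f, W, rfl, hpf, hf, -⟩ := exists_basicOpen_subset V.2 hp hpV
  have h1 : IsUnit (evalAt ι V.1 hV.le f) := by
    rw [isUnit_iff_ne_zero]
    intro h0
    have h2 : f = 0 := hV.eval_injective (h0.trans (map_zero _).symm)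
    rw [h2] at hpf
    exact (Y.left.basicOpen_zero V.1).le hpf
  have h2 : IsUnit (pullSections ι V.1 ⊤ hV.le f) :=
    (MulEquiv.isUnit_map (AlgEquiv.ofBijective (topEval K) topEval_bijective)).1 h1
  have h3 := Scheme.basicOpen_appLE ι.left _ _ hV.le f
  have h4 := Scheme.basicOpen_of_isUnit _ h2
  exact fun q hq => hf (h3.le (h4.ge hq)).2

/-- On a basic open set of a good `V` a function is a fraction whose numerator is determined by its
value in `K`. So a function with value 0 vanishes locally, hence vanishes; `U` need not be affine.
-/
theorem evalAt_injective (U : Y.left.Opens) (e : ⊤ ≤ ι.left ⁻¹ᵁ U) :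
    Function.Injective (evalAt ι U e) := by
  rw [injective_iff_map_eq_zero]
  intro s hs
  have key : ∀ p : U, ∃ W : Y.left.Opens, ∃ h : W ≤ U, p.1 ∈ W ∧ restrict Y h s = 0 := by
    intro p
    obtain ⟨V, hpV, hV⟩ := hc p
    obtain ⟨f, W, hW, hpf, hf, eV⟩ := exists_basicOpen_subset V.2 p.2 hpV
    refine ⟨W, hf, hpf, ?_⟩
    have eW := le_preimage_of_mem hc hpf
    let _ := (restrict Y eV).toRingHom.toAlgebra
    have := isLocalization_restrict V.2 f hW eV
    obtain ⟨⟨m, r⟩, hr⟩ := IsLocalization.surj (Submonoid.powers f) (restrict Y hf s)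
    have hr' : restrict Y hf s * restrict Y eV r = restrict Y eV m := hr
    have hm : m = 0 := by
      apply hV.eval_injective
      have h1 := congrArg (evalAt ι _ eW) hr'
      rw [map_mul, evalAt_restrict ι hf eW, hs, zero_mul, evalAt_restrict ι eV eW] at h1
      rw [← h1, map_zero]
    rw [hm, map_zero] at hr'
    exact (IsLocalization.map_units (Sections Y W) r).mul_left_eq_zero.1 hr'
  choose W hW hpW h0 using key
  refine TopCat.Sheaf.eq_of_locally_eq' Y.left.sheaf W U (fun p => homOfLE (hW p)) ?_ _ _ ?_
  · exact fun p hp => TopologicalSpace.Opens.mem_iSup.2 ⟨⟨p, hp⟩, hpW ⟨p, hp⟩⟩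
  · intro p
    exact (h0 p).trans (map_zero (restrict Y (hW p))).symm

/-- The annihilator of a form with coefficient 0 is the unit ideal: on a common basic open set of
`U` and a good `V` the form is a fraction of a form on `V` with coefficient 0, so it vanishes there
and is killed by a power of `f`. -/
theorem formCoeff_injective (U : Y.left.affineOpens) (e : ⊤ ≤ ι.left ⁻¹ᵁ U.1) :
    Function.Injective (formCoeff ι δ U.1 e) := by
  rw [injective_iff_map_eq_zero]
  intro t ht
  suffices h : (Ideal.torsionOf (Sections Y U.1) _ t) = ⊤ by
    have := (Ideal.eq_top_iff_one _).1 h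
    rwa [Ideal.mem_torsionOf_iff, one_smul] at this
  refine ideal_eq_top U.2 _ fun p hp => ?_
  obtain ⟨V, hpV, hV⟩ := hc p
  obtain ⟨f, g, W, hW, hfg, hpf, eU, eV⟩ := exists_basicOpen_inter U.2 V.2 hp hpV
  have eW := le_preimage_of_mem hc hpf
  obtain ⟨_, ⟨n, rfl⟩, m, hm⟩ := exists_smul_eq_kaehlerMap (restrict Y eV) _
    (isLocalization_restrict V.2 g hfg eV) (kaehlerMap (restrict Y eU) t)
  have hm0 : m = 0 := by
    apply hV.coeff_injective
    rw [← formCoeff_restrict ι δ eV eW, ← hm, formCoeff_smul,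
      formCoeff_restrict ι δ eU eW e, ht, mul_zero, map_zero]
  have hu : IsUnit (restrict Y eV (g ^ n)) := by
    rw [map_pow]
    exact (isUnit_restrict g hfg eV).pow n
  have ht0 : kaehlerMap (restrict Y eU) t = 0 := by
    rw [hm0, map_zero] at hm
    exact hu.smul_eq_zero.1 hm
  obtain ⟨_, ⟨k, rfl⟩, hk⟩ := exists_smul_eq_zero_of_kaehlerMap_eq_zero (restrict Y eU) _
    (isLocalization_restrict U.2 f hW eU) ht0
  exact ⟨f, k, hk, hW.le hpf⟩

/-- The functions r such that r k is the coefficient of a form on `U` form an ideal of denominators.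
Realizing k near each point puts into it a power of a function that does not vanish at that point.
-/
theorem exists_formCoeff_eq (U : Y.left.affineOpens) (e : ⊤ ≤ ι.left ⁻¹ᵁ U.1) (k : K)
    (hk : ∀ p ∈ U.1, ∃ (V : Y.left.affineOpens) (eV : ⊤ ≤ ι.left ⁻¹ᵁ V.1),
      p ∈ V.1 ∧ k ∈ Set.range (formCoeff ι δ V.1 eV)) :
    ∃ w, formCoeff ι δ U.1 e w = k := by
  let J : Ideal (Sections Y U.1) :=
    { carrier := {r | ∃ w, formCoeff ι δ U.1 e w = evalAt ι U.1 e r * k}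
      add_mem' := by
        rintro a b ⟨v, hv⟩ ⟨w, hw⟩
        exact ⟨v + w, by rw [map_add, hv, hw, map_add, add_mul]⟩
      zero_mem' := ⟨0, by rw [map_zero, map_zero, zero_mul]⟩
      smul_mem' := by
        rintro a b ⟨v, hv⟩
        exact ⟨a • v, by rw [formCoeff_smul, hv, smul_eq_mul, map_mul, mul_assoc]⟩ }
  suffices h : J = ⊤ by
    obtain ⟨w, hw⟩ := (Ideal.eq_top_iff_one J).1 h
    exact ⟨w, by rw [hw, map_one, one_mul]⟩
  refine ideal_eq_top U.2 _ fun p hp => ?_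
  obtain ⟨V, eV', hpV, m, rfl⟩ := hk p hp
  obtain ⟨f, g, W, hW, hfg, hpf, eU, eV⟩ := exists_basicOpen_inter U.2 V.2 hp hpV
  have eW := le_preimage_of_mem hc hpf
  obtain ⟨_, ⟨n, rfl⟩, m', hm'⟩ := exists_smul_eq_kaehlerMap (restrict Y eU) _
    (isLocalization_restrict U.2 f hW eU) (kaehlerMap (restrict Y eV) m)
  refine ⟨f, n, ⟨m', ?_⟩, hW.le hpf⟩
  rw [← formCoeff_restrict ι δ eU eW, ← hm', formCoeff_smul, formCoeff_restrict ι δ eV eW eV',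
    evalAt_restrict]

/-- The coefficient of a global form. -/
def globalCoeff (V : Y.left.affineOpens) (eV : ⊤ ≤ ι.left ⁻¹ᵁ V.1) : GlobalForms Y →ₗ[ℂ] K :=
  formCoeff ι δ V.1 eV ∘ₗ LinearMap.proj V ∘ₗ (GlobalForms Y).subtype

/-- Both open sets contain the image of the `K`-point, and an affine neighbourhood of it inside the
intersection compares the two coefficients. -/
theorem formCoeff_eq_globalCoeff (V : Y.left.affineOpens) (eV : ⊤ ≤ ι.left ⁻¹ᵁ V.1)
    (U : Y.left.affineOpens) (eU : ⊤ ≤ ι.left ⁻¹ᵁ U.1) (ω : GlobalForms Y) :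
    formCoeff ι δ U.1 eU (ω.1 U) = globalCoeff (δ := δ) V eV ω := by
  let q : PrimeSpectrum K := ⊥
  have hq : ι.left q ∈ U.1 ⊓ V.1 := ⟨eU (x := q) trivial, eV (x := q) trivial⟩
  obtain ⟨W, hW, hqW, hWUV⟩ := exists_isAffineOpen_mem_and_subset hq
  have e₁ : W ≤ U.1 := fun p hp => (hWUV hp).1
  have e₂ : W ≤ V.1 := fun p hp => (hWUV hp).2
  have eW := le_preimage_of_mem hc hqW
  change _ = formCoeff ι δ V.1 eV (ω.1 V)
  rw [← formCoeff_restrict ι δ e₁ eW eU, ← formCoeff_restrict ι δ e₂ eW eV,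
    ω.2 U ⟨W, hW⟩ e₁, ω.2 V ⟨W, hW⟩ e₂]

theorem subsingleton_forms_of_not_le {U : Y.left.Opens} (hU : ¬ ⊤ ≤ ι.left ⁻¹ᵁ U) :
    Subsingleton Ω[Sections Y U⁄ℂ] := by
  have h1 : U = ⊥ := by
    by_contra h
    obtain ⟨p, hp⟩ := (TopologicalSpace.Opens.ne_bot_iff_nonempty U).1 h
    exact hU (le_preimage_of_mem hc hp)
  subst h1
  have : Subsingleton (Sections Y ⊥) := inferInstanceAs (Subsingleton Γ(Y.left, ⊥))
  exact Module.subsingleton (Sections Y ⊥) _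

theorem globalCoeff_injective (V : Y.left.affineOpens) (eV : ⊤ ≤ ι.left ⁻¹ᵁ V.1) :
    Function.Injective (globalCoeff (δ := δ) V eV) := by
  intro ω η h
  ext U : 2
  by_cases eU : ⊤ ≤ ι.left ⁻¹ᵁ U.1
  · apply formCoeff_injective hc U eU
    rw [formCoeff_eq_globalCoeff hc V eV, h, formCoeff_eq_globalCoeff hc V eV]
  · exact (subsingleton_forms_of_not_le hc eU).elim _ _

/-- An element of `K` that is locally the coefficient of a form is the coefficient of a global
form. -/
theorem exists_globalCoeff_eq (V : Y.left.affineOpens) (eV : ⊤ ≤ ι.left ⁻¹ᵁ V.1) (k : K)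
    (hk : ∀ p : Y.left, ∃ (V : Y.left.affineOpens) (eV : ⊤ ≤ ι.left ⁻¹ᵁ V.1),
      p ∈ V.1 ∧ k ∈ Set.range (formCoeff ι δ V.1 eV)) :
    ∃ ω, globalCoeff (δ := δ) V eV ω = k := by
  have key (U : Y.left.affineOpens) : ∃ w : Ω[Sections Y U.1⁄ℂ],
      ∀ eU : ⊤ ≤ ι.left ⁻¹ᵁ U.1, formCoeff ι δ U.1 eU w = k := by
    by_cases eU : ⊤ ≤ ι.left ⁻¹ᵁ U.1
    · obtain ⟨w, hw⟩ := exists_formCoeff_eq hc U eU k fun p _ => hk p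
      exact ⟨w, fun _ => hw⟩
    · exact ⟨0, fun h => absurd h eU⟩
  choose ω hω using key
  refine ⟨⟨ω, fun V U e => ?_⟩, hω V eV⟩
  by_cases eU : ⊤ ≤ ι.left ⁻¹ᵁ U.1
  · apply formCoeff_injective hc U eU
    have eV : ⊤ ≤ ι.left ⁻¹ᵁ V.1 := fun _ hp => e (eU hp)
    rw [formCoeff_restrict ι δ e eU eV, hω, hω]
  · exact (subsingleton_forms_of_not_le hc eU).elim _ _

end Good

/-! ### Affine charts and morphisms from affine schemes -/

section AffineCharts

open scoped TensorProduct

variable {R S T : Type} [CommRing R] [Algebra ℂ R] [CommRing S] [Algebra ℂ S] [CommRing T]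
  [Algebra ℂ T] {Y Z : Over (Spec (CommRingCat.of ℂ))}

instance : IsAffine (specOver S).left :=
  inferInstanceAs (IsAffine (Spec (CommRingCat.of S)))

/-- The image of an affine chart. -/
def chartOpen (j : specOver R ⟶ Y) [IsOpenImmersion j.left] : Y.left.affineOpens :=
  ⟨j.left ''ᵁ ⊤, (isAffineOpen_top (specOver R).left).image_of_isOpenImmersion j.left⟩

variable (j : specOver R ⟶ Y) [IsOpenImmersion j.left]

theorem le_preimage_chartOpen : ⊤ ≤ j.left ⁻¹ᵁ (chartOpen j).1 :=
  (Scheme.Hom.preimage_image_eq j.left ⊤).ge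

theorem mem_chartOpen_iff {p : Y.left} : p ∈ (chartOpen j).1 ↔ ∃ q, j.left q = p := by
  change p ∈ j.left '' Set.univ ↔ _
  simp

theorem evalAt_chartOpen_bijective :
    Function.Bijective (evalAt j (chartOpen j).1 (le_preimage_chartOpen j)) := by
  refine topEval_bijective.comp ?_
  change Function.Bijective (j.left.appLE (j.left ''ᵁ ⊤) ⊤ _).hom
  have h1 := Scheme.Hom.appIso_hom' j.left ⊤
  have h2 : IsIso (j.left.appLE (j.left ''ᵁ ⊤) ⊤ (le_preimage_chartOpen j)) :=
    h1 ▸ inferInstance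
  exact ConcreteCategory.bijective_of_isIso (j.left.appLE (j.left ''ᵁ ⊤) ⊤ _)

theorem exists_lift (θ : specOver S ⟶ Y) (h : ⊤ ≤ θ.left ⁻¹ᵁ (chartOpen j).1) :
    ∃ a : R →ₐ[ℂ] S, θ = specOverMap a ≫ j := by
  have hr : Set.range θ.left ⊆ Set.range j.left := by
    rintro _ ⟨q, rfl⟩
    exact (mem_chartOpen_iff j).1 (h (x := q) trivial)
  let l : (specOver S).left ⟶ (specOver R).left :=
    IsOpenImmersion.lift j.left θ.left hr
  have hl : l ≫ j.left = θ.left := IsOpenImmersion.lift_fac _ _ _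
  have hl' : l ≫ Spec.map (CommRingCat.ofHom (algebraMap ℂ R)) =
      Spec.map (CommRingCat.ofHom (algebraMap ℂ S)) := by
    have h1 : j.left ≫ Y.hom = Spec.map (CommRingCat.ofHom (algebraMap ℂ R)) := Over.w j
    have h2 : θ.left ≫ Y.hom = Spec.map (CommRingCat.ofHom (algebraMap ℂ S)) := Over.w θ
    rw [← h1, ← h2, ← hl]
    exact (Category.assoc _ _ _).symm
  obtain ⟨a, ha⟩ : ∃ a : CommRingCat.of R ⟶ CommRingCat.of S, Spec.map a = l :=
    ⟨_, Spec.map_preimage _⟩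
  rw [← ha] at hl'
  have h3 : CommRingCat.ofHom (algebraMap ℂ R) ≫ a = CommRingCat.ofHom (algebraMap ℂ S) :=
    Spec.map_injective ((Spec.map_comp _ _).trans hl')
  refine ⟨{ a.hom with commutes' := fun c => congrArg (fun t => t.hom c) h3 }, ?_⟩
  apply Over.OverMorphism.ext
  rw [← hl, ← ha]
  rfl

variable {j} in
theorem specOverMap_comp_injective {a b : R →ₐ[ℂ] S}
    (h : specOverMap a ≫ j = specOverMap b ≫ j) : a = b := by
  have h1 : (specOverMap a).left ≫ j.left = (specOverMap b).left ≫ j.left :=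
    congrArg (fun t => t.left) h
  rw [cancel_mono] at h1
  have h2 : CommRingCat.ofHom a.toRingHom = CommRingCat.ofHom b.toRingHom := Spec.map_injective h1
  ext r
  exact congrArg (fun t => t.hom r) h2

/-- An affine open subset as an affine chart. -/
def openChart (W : Y.left.affineOpens) : specOver (Sections Y W.1) ⟶ Y :=
  Over.homMk (U := specOver (Sections Y W.1)) W.2.fromSpec (by
    have h1 := IsAffineOpen.SpecMap_appLE_fromSpec (structureMap Y)
      (isAffineOpen_top (Spec (CommRingCat.of ℂ))) W.2 (le_preimage_top Y W.1)
    rw [IsAffineOpen.fromSpec_top, Scheme.isoSpec_Spec_inv, ← Spec.map_comp] at h1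
    exact h1.symm)

instance (W : Y.left.affineOpens) : IsOpenImmersion (openChart W).left :=
  IsAffineOpen.isOpenImmersion_fromSpec W.2

theorem chartOpen_openChart (W : Y.left.affineOpens) : (chartOpen (openChart W)).1 = W.1 := by
  have h1 := W.2.opensRange_fromSpec
  rw [← Scheme.Hom.image_top_eq_opensRange] at h1
  exact h1

theorem over_hom_ext {φ ψ : Y ⟶ Z} (h : ∀ p : Y.left, ∃ W : Y.left.affineOpens, p ∈ W.1 ∧
    openChart W ≫ φ = openChart W ≫ ψ) : φ = ψ := by
  apply Over.OverMorphism.ext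
  refine Scheme.hom_ext_of_forall _ _ fun p => ?_
  obtain ⟨W, hp, hW⟩ := h p
  refine ⟨W.1, hp, ?_⟩
  have h1 : W.2.fromSpec ≫ φ.left = W.2.fromSpec ≫ ψ.left := congrArg (fun t => t.left) hW
  rw [← W.2.isoSpec_hom_fromSpec, Category.assoc, Category.assoc, h1]

theorem pullback_fst_comp_eq {R S T : Type} [CommRing R] [CommRing S] [CommRing T] [Algebra R S]
    [Algebra R T] {X : Scheme.{0}} (φ : Spec (CommRingCat.of S) ⟶ X)
    (ψ : Spec (CommRingCat.of T) ⟶ X)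
    (h : Spec.map (CommRingCat.ofHom
        (Algebra.TensorProduct.includeLeftRingHom : S →+* S ⊗[R] T)) ≫ φ =
      Spec.map (CommRingCat.ofHom
        (Algebra.TensorProduct.includeRight : T →ₐ[R] S ⊗[R] T).toRingHom) ≫ ψ) :
    Limits.pullback.fst (Spec.map (CommRingCat.ofHom (algebraMap R S)))
        (Spec.map (CommRingCat.ofHom (algebraMap R T))) ≫ φ =
      Limits.pullback.snd (Spec.map (CommRingCat.ofHom (algebraMap R S)))
        (Spec.map (CommRingCat.ofHom (algebraMap R T))) ≫ ψ := by
  rw [← cancel_epi (pullbackSpecIso R S T).inv, pullbackSpecIso_inv_fst_assoc,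
    pullbackSpecIso_inv_snd_assoc]
  exact h

theorem span_range_eq_top {R : Type} [CommRing R] {r₀ r₁ : R} (hr : IsCoprime r₀ r₁) :
    Ideal.span (Set.range fun i : Bool => bif i then r₁ else r₀) = ⊤ := by
  rw [Ideal.eq_top_iff_one]
  obtain ⟨u, v, huv⟩ := hr
  rw [← huv]
  exact add_mem (Ideal.mul_mem_left _ _ (Ideal.subset_span ⟨false, rfl⟩))
    (Ideal.mul_mem_left _ _ (Ideal.subset_span ⟨true, rfl⟩))

theorem away_algHom_ext {r : R} {a b : Localization.Away r →ₐ[ℂ] T}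
    (h : ∀ s : R, a (algebraMap _ _ s) = b (algebraMap _ _ s)) : a = b :=
  IsLocalization.algHom_ext (Submonoid.powers r) (by ext s; exact h s)

theorem hom_ext_of_isCoprime {r₀ r₁ : R} (hr : IsCoprime r₀ r₁) {φ ψ : specOver R ⟶ Y}
    (h₀ : specOverMap (IsScalarTower.toAlgHom ℂ R (Localization.Away r₀)) ≫ φ =
      specOverMap (IsScalarTower.toAlgHom ℂ R (Localization.Away r₀)) ≫ ψ)
    (h₁ : specOverMap (IsScalarTower.toAlgHom ℂ R (Localization.Away r₁)) ≫ φ =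
      specOverMap (IsScalarTower.toAlgHom ℂ R (Localization.Away r₁)) ≫ ψ) : φ = ψ := by
  apply Over.OverMorphism.ext
  refine Scheme.Cover.hom_ext (Scheme.affineOpenCoverOfSpanRangeEqTop (R := CommRingCat.of R) _
    (span_range_eq_top hr)).openCover _ _ fun i => ?_
  cases i
  · exact congrArg (fun t => t.left) h₀
  · exact congrArg (fun t => t.left) h₁

/-- Morphisms from an affine scheme can be glued on two basic open subsets. -/
theorem exists_glue {r₀ r₁ : R} (hr : IsCoprime r₀ r₁)
    (φ₀ : specOver (Localization.Away r₀) ⟶ Y) (φ₁ : specOver (Localization.Away r₁) ⟶ Y)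
    (h : ∀ (T : Type) [CommRing T] [Algebra ℂ T] (a : Localization.Away r₀ →ₐ[ℂ] T)
      (b : Localization.Away r₁ →ₐ[ℂ] T),
      (∀ r : R, a (algebraMap _ _ r) = b (algebraMap _ _ r)) →
        specOverMap a ≫ φ₀ = specOverMap b ≫ φ₁) :
    ∃ φ : specOver R ⟶ Y,
      specOverMap (IsScalarTower.toAlgHom ℂ R (Localization.Away r₀)) ≫ φ = φ₀ ∧
      specOverMap (IsScalarTower.toAlgHom ℂ R (Localization.Away r₁)) ≫ φ = φ₁ := by
  let s : Bool → R := fun i => bif i then r₁ else r₀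
  let φ : ∀ i, specOver (Localization.Away (s i)) ⟶ Y := fun i =>
    match i with
    | false => φ₀
    | true => φ₁
  let 𝒰 := (Scheme.affineOpenCoverOfSpanRangeEqTop (R := CommRingCat.of R) s
    (span_range_eq_top hr)).openCover
  have key (i k : Bool) (T : Type) [CommRing T] [Algebra ℂ T]
      (a : Localization.Away (s i) →ₐ[ℂ] T) (b : Localization.Away (s k) →ₐ[ℂ] T)
      (hab : ∀ r : R, a (algebraMap _ _ r) = b (algebraMap _ _ r)) :
      specOverMap a ≫ φ i = specOverMap b ≫ φ k := by
    -- For equal indices, maps out of a localization that agree on `R` are equal.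
    cases i <;> cases k
    · rw [away_algHom_ext hab]
    · exact h T a b hab
    · exact (h T b a fun r => (hab r).symm).symm
    · rw [away_algHom_ext hab]
  have hglue (i k : Bool) : Limits.pullback.fst (𝒰.f i) (𝒰.f k) ≫ (φ i).left =
      Limits.pullback.snd (𝒰.f i) (𝒰.f k) ≫ (φ k).left := by
    -- The overlap is the spectrum of the tensor product, so compatibility is tested on its two
    -- inclusions.
    have h3 := key i k (Localization.Away (s i) ⊗[R] Localization.Away (s k))
      Algebra.TensorProduct.includeLeft
      ((Algebra.TensorProduct.includeRight (R := R)).restrictScalars ℂ) fun r =>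
        ((Algebra.TensorProduct.includeLeft : Localization.Away (s i) →ₐ[R]
          Localization.Away (s i) ⊗[R] Localization.Away (s k)).commutes r).trans
        ((Algebra.TensorProduct.includeRight : Localization.Away (s k) →ₐ[R]
          Localization.Away (s i) ⊗[R] Localization.Away (s k)).commutes r).symm
    exact pullback_fst_comp_eq (R := R) (S := Localization.Away (s i))
      (T := Localization.Away (s k)) (φ i).left (φ k).left (congrArg (fun t => t.left) h3)
  let Φ : (specOver R).left ⟶ Y.left := 𝒰.glueMorphisms (fun i => (φ i).left) hglue
  have hΦ (i : Bool) : 𝒰.f i ≫ Φ = (φ i).left := 𝒰.ι_glueMorphisms _ _ i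
  refine ⟨Over.homMk Φ ?_, ?_, ?_⟩
  · refine Scheme.Cover.hom_ext 𝒰 _ _ fun i => ?_
    refine ((Category.assoc (𝒰.f i) Φ Y.hom).symm.trans
      (congrArg (fun t => t ≫ Y.hom) (hΦ i))).trans ((Over.w (φ i)).trans ?_)
    exact (Over.w (specOverMap (IsScalarTower.toAlgHom ℂ R (Localization.Away (s i))))).symm
  · apply Over.OverMorphism.ext
    exact hΦ false
  · apply Over.OverMorphism.ext
    exact hΦ true

end AffineCharts

/-! ### Values of binary forms -/

section BinaryFormValues

variable {S : Type*} [CommRing S] [Algebra ℂ S]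

theorem aeval_homogenize_eq_sum (p : ℂ[X]) (m : ℕ) (a b : S) :
    MvPolynomial.aeval ![a, b] (p.homogenize m) =
      ∑ i ∈ Finset.range (m + 1), algebraMap ℂ S (p.coeff i) * (a ^ i * b ^ (m - i)) := by
  rw [homogenize, map_sum, Finset.Nat.sum_antidiagonal_eq_sum_range_succ_mk]
  refine Finset.sum_congr rfl fun i _ => ?_
  rw [MvPolynomial.aeval_monomial, Finsupp.prod_fintype _ _ fun _ => pow_zero _, Fin.prod_univ_two]
  simp

theorem aeval_homogenize_mul_left {p : ℂ[X]} {m : ℕ} (hp : p.natDegree ≤ m) (y b : S) :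
    MvPolynomial.aeval ![b * y, b] (p.homogenize m) = b ^ m * aeval y p := by
  rw [aeval_homogenize_eq_sum, aeval_eq_sum_range' (Nat.lt_succ_of_le hp), Finset.mul_sum]
  refine Finset.sum_congr rfl fun i hi => ?_
  have h1 : b ^ m = b ^ i * b ^ (m - i) := by
    rw [← pow_add, Nat.add_sub_cancel' (Nat.lt_succ_iff.1 (Finset.mem_range.1 hi))]
  rw [Algebra.smul_def, h1]
  ring

theorem aeval_homogenize_mul_right {p : ℂ[X]} {m : ℕ} (hp : p.natDegree ≤ m) (y b : S) :
    MvPolynomial.aeval ![b, b * y] (p.homogenize m) = b ^ m * aeval y (p.reflect m) := by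
  have h2 : (p.reflect m).natDegree ≤ m := natDegree_reflect_le.trans (by simp [hp])
  rw [aeval_homogenize_eq_sum, aeval_eq_sum_range' (Nat.lt_succ_of_le h2), Finset.mul_sum,
    ← Finset.sum_range_reflect]
  refine Finset.sum_congr rfl fun i hi => ?_
  have hi' : i ≤ m := Nat.lt_succ_iff.1 (Finset.mem_range.1 hi)
  have h1 : b ^ m = b ^ (m - i) * b ^ i := by rw [← pow_add, Nat.sub_add_cancel hi']
  rw [Algebra.smul_def, h1, coeff_reflect, revAt_le hi', show m + 1 - 1 - i = m - i by omega,
    show m - (m - i) = i by omega]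
  ring

theorem aeval_pair_map {T : Type*} [CommRing T] [Algebra ℂ T] (e : S →ₐ[ℂ] T) (p q : S)
    (F : MvPolynomial (Fin 2) ℂ) :
    e (MvPolynomial.aeval ![p, q] F) = MvPolynomial.aeval ![e p, e q] F := by
  rw [MvPolynomial.comp_aeval_apply]
  congr 2
  ext i
  fin_cases i <;> rfl

end BinaryFormValues

/-! ### Morphisms into the curve -/

section CurveMorphisms

variable {n : ℕ} {h k : ℂ[X]} (H : IsReversal n h k) {R S : Type} [CommRing R] [Algebra ℂ R]
  [CommRing S] [Algebra ℂ S]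

/-- The first chart over `ℂ`. -/
def leftChart : specOver (Chart h) ⟶ gluedOver H :=
  Over.homMk (U := specOver (Chart h)) (V := gluedOver H) (chartLeft H)
    (Limits.pushout.inl_desc _ _ (incl_chartStructure H))

/-- The second chart over `ℂ`. -/
def rightChart : specOver (Chart k) ⟶ gluedOver H :=
  Over.homMk (U := specOver (Chart k)) (V := gluedOver H) (chartRight H)
    (Limits.pushout.inr_desc _ _ (incl_chartStructure H))

instance : IsOpenImmersion (leftChart H).left := inferInstanceAs (IsOpenImmersion (chartLeft H))

instance : IsOpenImmersion (rightChart H).left := inferInstanceAs (IsOpenImmersion (chartRight H))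

theorem inclRight_eq :
    inclRight H = Spec.map (CommRingCat.ofHom (chartTransition H).toRingHom) := by
  rw [inclRight, inclLeft, ← Spec.map_comp]
  congr 1
  exact CommRingCat.hom_ext (RingHom.ext fun a => transition_algebraMap H a)

theorem incl_leftChart :
    specOverMap (IsScalarTower.toAlgHom ℂ (Chart h) (Punctured h)) ≫ leftChart H =
      specOverMap (chartTransition H) ≫ rightChart H := by
  apply Over.OverMorphism.ext
  have h1 : inclLeft h ≫ chartLeft H = inclRight H ≫ chartRight H :=
    Limits.pushout.condition (f := inclLeft h) (g := inclRight H)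
  rw [inclRight_eq] at h1
  exact h1

theorem exists_desc {Y : Over (Spec (CommRingCat.of ℂ))} (φ : specOver (Chart h) ⟶ Y)
    (ψ : specOver (Chart k) ⟶ Y)
    (hφψ : specOverMap (IsScalarTower.toAlgHom ℂ (Chart h) (Punctured h)) ≫ φ =
      specOverMap (chartTransition H) ≫ ψ) :
    ∃ Φ : gluedOver H ⟶ Y, leftChart H ≫ Φ = φ ∧ rightChart H ≫ Φ = ψ := by
  have h3 : inclLeft h ≫ φ.left = inclRight H ≫ ψ.left := by
    rw [inclRight_eq]
    exact congrArg (fun t => t.left) hφψ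
  let Φ : (gluedOver H).left ⟶ Y.left :=
    Limits.pushout.desc (f := inclLeft h) (g := inclRight H) φ.left ψ.left h3
  have hl : chartLeft H ≫ Φ = φ.left := Limits.pushout.inl_desc _ _ h3
  have hr : chartRight H ≫ Φ = ψ.left := Limits.pushout.inr_desc _ _ h3
  refine ⟨Over.homMk Φ ?_, ?_, ?_⟩
  · refine Limits.pushout.hom_ext (f := inclLeft h) (g := inclRight H) ?_ ?_
    · change chartLeft H ≫ Φ ≫ Y.hom = chartLeft H ≫ (gluedOver H).hom
      refine ((Category.assoc (chartLeft H) Φ Y.hom).symm.trans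
        (congrArg (fun t => t ≫ Y.hom) hl)).trans ((Over.w φ).trans (Over.w (leftChart H)).symm)
    · change chartRight H ≫ Φ ≫ Y.hom = chartRight H ≫ (gluedOver H).hom
      refine ((Category.assoc (chartRight H) Φ Y.hom).symm.trans
        (congrArg (fun t => t ≫ Y.hom) hr)).trans ((Over.w ψ).trans (Over.w (rightChart H)).symm)
  · apply Over.OverMorphism.ext
    exact hl
  · apply Over.OverMorphism.ext
    exact hr

/-- The first relation makes x invertible, so `a` extends to the open set x ≠ 0; the two relations
then say that `b` is the gluing map followed by this extension. -/
theorem charts_agree (a : Chart h →ₐ[ℂ] S) (b : Chart k →ₐ[ℂ] S)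
    (hx : a (Chart.x h) * b (Chart.x k) = 1)
    (hz : b (Chart.z k) * a (Chart.x h) ^ n = a (Chart.z h)) :
    specOverMap a ≫ leftChart H = specOverMap b ≫ rightChart H := by
  have hu : IsUnit (a (Chart.x h)) := IsUnit.of_mul_eq_one _ hx
  let a' : Punctured h →ₐ[ℂ] S :=
    IsLocalization.liftAlgHom (M := Submonoid.powers (Chart.x h)) (f := a) (by
      rintro ⟨_, m, rfl⟩
      simpa using hu.pow m)
  have ha' (r : Chart h) : a' (algebraMap _ _ r) = a r := by simp [a']
  have hinv : a' (invX h) = b (Chart.x k) := by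
    have h1 := congrArg a' (x_mul_invX h)
    rw [map_mul, ha', map_one, ← hx] at h1
    exact hu.mul_left_cancel h1
  have h1 : a = a'.comp (IsScalarTower.toAlgHom ℂ (Chart h) (Punctured h)) := by
    exact AlgHom.ext fun r => (ha' r).symm
  have h2 : b = a'.comp (chartTransition H) := by
    refine Chart.algHom_ext ?_ ?_
    · rw [AlgHom.comp_apply, chartTransition_x, hinv]
    · rw [AlgHom.comp_apply, chartTransition_z, map_mul, map_pow, ha', hinv, ← hz, mul_assoc,
        ← mul_pow, hx, one_pow, mul_one]
  rw [h1, h2, specOverMap_comp, specOverMap_comp, Category.assoc, Category.assoc, incl_leftChart]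

/-- The point is (p/q, r/qⁿ); its affine equation is the weighted homogeneous one divided by q^(2n).
-/
theorem exists_left_point (H : IsReversal n h k) {p q r : S} (hq : IsUnit q)
    (hr : r ^ 2 = MvPolynomial.aeval ![p, q] (h.homogenize (2 * n))) :
    ∃ ψ : Chart h →ₐ[ℂ] S, q * ψ (Chart.x h) = p ∧ q ^ n * ψ (Chart.z h) = r := by
  obtain ⟨u, hu⟩ := hq.exists_right_inv
  have hp : p = q * (p * u) := by linear_combination (-p) * hu
  rw [hp, aeval_homogenize_mul_left H.natDegree_le] at hr
  have hun : q ^ n * u ^ n = 1 := by rw [← mul_pow, hu, one_pow]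
  refine ⟨Chart.lift (p * u) (r * u ^ n) ?_, ?_, ?_⟩
  · rw [mul_pow, hr, pow_mul', ← pow_mul u, mul_comm n 2, pow_mul' u]
    linear_combination (aeval (p * u) h) * (q ^ n * u ^ n + 1) * hun
  · rw [Chart.lift_x, ← hp]
  · rw [Chart.lift_z]
    linear_combination r * hun

theorem exists_right_point (H : IsReversal n h k) {p q r : S} (hp : IsUnit p)
    (hr : r ^ 2 = MvPolynomial.aeval ![p, q] (h.homogenize (2 * n))) :
    ∃ ψ : Chart k →ₐ[ℂ] S, p * ψ (Chart.x k) = q ∧ p ^ n * ψ (Chart.z k) = r := by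
  obtain ⟨u, hu⟩ := hp.exists_right_inv
  have hq : q = p * (q * u) := by linear_combination (-q) * hu
  rw [hq, aeval_homogenize_mul_right H.natDegree_le, ← H.eq_reflect] at hr
  have hun : p ^ n * u ^ n = 1 := by rw [← mul_pow, hu, one_pow]
  refine ⟨Chart.lift (q * u) (r * u ^ n) ?_, ?_, ?_⟩
  · rw [mul_pow, hr, pow_mul', ← pow_mul u, mul_comm n 2, pow_mul' u]
    linear_combination (aeval (q * u) k) * (p ^ n * u ^ n + 1) * hun
  · rw [Chart.lift_x, ← hq]
  · rw [Chart.lift_z]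
    linear_combination r * hun

theorem point_unique {m : ℂ[X]} {p q r : S} (hq : IsUnit q) {ψ ψ' : Chart m →ₐ[ℂ] S}
    (h₁ : q * ψ (Chart.x m) = p) (h₂ : q ^ n * ψ (Chart.z m) = r)
    (h₁' : q * ψ' (Chart.x m) = p) (h₂' : q ^ n * ψ' (Chart.z m) = r) : ψ = ψ' :=
  Chart.algHom_ext (hq.mul_left_cancel (h₁.trans h₁'.symm))
    ((hq.pow n).mul_left_cancel (h₂.trans h₂'.symm))

theorem exists_away_lift {r : R} (a : R →ₐ[ℂ] S) (hr : IsUnit (a r)) :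
    ∃ a' : Localization.Away r →ₐ[ℂ] S,
      a = a'.comp (IsScalarTower.toAlgHom ℂ R (Localization.Away r)) := by
  refine ⟨IsLocalization.liftAlgHom (M := Submonoid.powers r) (f := a) (by
      rintro ⟨_, m, rfl⟩
      simpa using hr.pow m), ?_⟩
  ext s
  simp

/-- `φ` is the morphism `(p : q : r)` to the curve `r² = F(p, q)` in a weighted projective
plane. -/
structure IsGivenBy (p q r : R) (φ : specOver R ⟶ gluedOver H) : Prop where
  left : ∀ (S : Type) [CommRing S] [Algebra ℂ S] (a : R →ₐ[ℂ] S) (ψ : Chart h →ₐ[ℂ] S),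
    IsUnit (a q) → a q * ψ (Chart.x h) = a p → a q ^ n * ψ (Chart.z h) = a r →
    specOverMap a ≫ φ = specOverMap ψ ≫ leftChart H
  right : ∀ (S : Type) [CommRing S] [Algebra ℂ S] (a : R →ₐ[ℂ] S) (ψ : Chart k →ₐ[ℂ] S),
    IsUnit (a p) → a p * ψ (Chart.x k) = a q → a p ^ n * ψ (Chart.z k) = a r →
    specOverMap a ≫ φ = specOverMap ψ ≫ rightChart H

/-- By coprimality D(p) and D(q) cover Spec R. Use (p/q, r/qⁿ) in the first chart over D(q) and
(q/p, r/pⁿ) in the second over D(p); where both are defined they satisfy the gluing relations. -/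
theorem exists_isGivenBy {p q r : R} (hpq : IsCoprime p q)
    (hr : r ^ 2 = MvPolynomial.aeval ![p, q] (h.homogenize (2 * n))) :
    ∃ φ : specOver R ⟶ gluedOver H, IsGivenBy H p q r φ := by
  let ε (s : R) := IsScalarTower.toAlgHom ℂ R (Localization.Away s)
  have hε (s : R) : IsUnit (ε s s) := IsLocalization.Away.algebraMap_isUnit s
  have hF {T : Type} [CommRing T] [Algebra ℂ T] (a : R →ₐ[ℂ] T) :
      a r ^ 2 = MvPolynomial.aeval ![a p, a q] (h.homogenize (2 * n)) := by
    rw [← map_pow, hr, aeval_pair_map]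
  obtain ⟨ψ₀, hx₀, hz₀⟩ := exists_right_point H (hε p) (hF (ε p))
  obtain ⟨ψ₁, hx₁, hz₁⟩ := exists_left_point H (hε q) (hF (ε q))
  obtain ⟨φ, hφ₀, hφ₁⟩ := exists_glue hpq (specOverMap ψ₀ ≫ rightChart H)
    (specOverMap ψ₁ ≫ leftChart H) (by
      intro T _ _ a b hab
      rw [← Category.assoc, ← Category.assoc, ← specOverMap_comp, ← specOverMap_comp]
      have hab' (s : R) : a (ε p s) = b (ε q s) := hab s
      have hp : IsUnit (b (ε q p)) := hab' p ▸ (hε p).map a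
      have hq : IsUnit (b (ε q q)) := (hε q).map b
      have h1 := congrArg a hx₀
      have h2 := congrArg a hz₀
      have h3 := congrArg b hx₁
      have h4 := congrArg b hz₁
      simp only [map_mul, map_pow, hab'] at h1 h2 h3 h4
      refine (charts_agree H _ _ ?_ ?_).symm
      · refine (hp.mul hq).mul_left_cancel ?_
        simp only [AlgHom.comp_apply]
        linear_combination b (ε q q) * b (ψ₁ (Chart.x h)) * h1 + b (ε q q) * h3
      · refine ((hp.pow n).mul (hq.pow n)).mul_left_cancel ?_
        simp only [AlgHom.comp_apply]
        have h5 := congrArg (fun t => t ^ n) h3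
        simp only [mul_pow] at h5
        linear_combination b (ε q q) ^ n * b (ψ₁ (Chart.x h)) ^ n * h2 + b (ε q r) * h5 -
          b (ε q p) ^ n * h4)
  refine ⟨φ, ?_, ?_⟩
  · intro S _ _ a ψ hq hx hz
    obtain ⟨a', rfl⟩ := exists_away_lift a hq
    rw [specOverMap_comp, Category.assoc, hφ₁, ← Category.assoc, ← specOverMap_comp]
    have h3 := congrArg a' hx₁
    have h4 := congrArg a' hz₁
    rw [map_mul] at h3
    rw [map_mul, map_pow] at h4
    rw [point_unique hq (ψ := ψ) (ψ' := a'.comp ψ₁) hx hz h3 h4]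
  · intro S _ _ a ψ hp hx hz
    obtain ⟨a', rfl⟩ := exists_away_lift a hp
    rw [specOverMap_comp, Category.assoc, hφ₀, ← Category.assoc, ← specOverMap_comp]
    have h3 := congrArg a' hx₀
    have h4 := congrArg a' hz₀
    rw [map_mul] at h3
    rw [map_mul, map_pow] at h4
    rw [point_unique hp (ψ := ψ) (ψ' := a'.comp ψ₀) hx hz h3 h4]

/-- (p : q : r) and (lp : lq : lⁿr) are the same point of the weighted projective plane: the factor
l cancels in either chart. -/
theorem IsGivenBy.eq_of_rescale {R' : Type} [CommRing R'] [Algebra ℂ R'] {H : IsReversal n h k}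
    {p q r : R} {p' q' r' : R'} {φ : specOver R ⟶ gluedOver H} {φ' : specOver R' ⟶ gluedOver H}
    (hφ : IsGivenBy H p q r φ) (hφ' : IsGivenBy H p' q' r' φ') (i : R →ₐ[ℂ] S) (t : R' →ₐ[ℂ] S)
    {l : S} (hl : IsUnit l) (hp : t p' = i p * l) (hq : t q' = i q * l) (hr : t r' = i r * l ^ n)
    (hpq : IsCoprime p q) (hF : r ^ 2 = MvPolynomial.aeval ![p, q] (h.homogenize (2 * n))) :
    specOverMap i ≫ φ = specOverMap t ≫ φ' := by
  have hF' {T : Type} [CommRing T] [Algebra ℂ T] (e : R →ₐ[ℂ] T) :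
      e r ^ 2 = MvPolynomial.aeval ![e p, e q] (h.homogenize (2 * n)) := by
    rw [← map_pow, hF, aeval_pair_map]
  refine hom_ext_of_isCoprime (hpq.map (i : R →+* S)) ?_ ?_
  · let e := IsScalarTower.toAlgHom ℂ S (Localization.Away (i p))
    have hu : IsUnit (e.comp i p) :=
      IsLocalization.Away.algebraMap_isUnit (S := Localization.Away (i p)) (i p)
    obtain ⟨ψ, hx, hz⟩ := exists_right_point H hu (hF' (e.comp i))
    have hx' : e (i p) * ψ (Chart.x k) = e (i q) := hx
    have hz' : e (i p) ^ n * ψ (Chart.z k) = e (i r) := hz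
    have h1 : specOverMap (e.comp i) ≫ φ = specOverMap (e.comp t) ≫ φ' := by
      rw [hφ.right _ (e.comp i) ψ hu hx hz, hφ'.right _ (e.comp t) ψ]
      · rw [AlgHom.comp_apply, hp, map_mul]
        exact hu.mul (hl.map e)
      · rw [AlgHom.comp_apply, AlgHom.comp_apply, hp, hq, map_mul, map_mul]
        linear_combination e l * hx'
      · rw [AlgHom.comp_apply, AlgHom.comp_apply, hp, hr, map_mul, map_mul, map_pow]
        linear_combination e l ^ n * hz'
    rwa [specOverMap_comp, specOverMap_comp, Category.assoc, Category.assoc] at h1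
  · let e := IsScalarTower.toAlgHom ℂ S (Localization.Away (i q))
    have hu : IsUnit (e.comp i q) :=
      IsLocalization.Away.algebraMap_isUnit (S := Localization.Away (i q)) (i q)
    obtain ⟨ψ, hx, hz⟩ := exists_left_point H hu (hF' (e.comp i))
    have hx' : e (i q) * ψ (Chart.x h) = e (i p) := hx
    have hz' : e (i q) ^ n * ψ (Chart.z h) = e (i r) := hz
    have h1 : specOverMap (e.comp i) ≫ φ = specOverMap (e.comp t) ≫ φ' := by
      rw [hφ.left _ (e.comp i) ψ hu hx hz, hφ'.left _ (e.comp t) ψ]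
      · rw [AlgHom.comp_apply, hq, map_mul]
        exact hu.mul (hl.map e)
      · rw [AlgHom.comp_apply, AlgHom.comp_apply, hp, hq, map_mul, map_mul]
        linear_combination e l * hx'
      · rw [AlgHom.comp_apply, AlgHom.comp_apply, hq, hr, map_mul, map_mul, map_pow]
        linear_combination e l ^ n * hz'
    rwa [specOverMap_comp, specOverMap_comp, Category.assoc, Category.assoc] at h1

/-- The endomorphism `(x, z) ↦ ((a x + b) / (c x + d), u z / (c x + d) ^ n)` of the curve, where
`F(a x + b y, c x + d y) = u² F(x, y)`. -/
theorem exists_moebius {a b c d u : ℂ} (hdet : a * d - b * c = 1)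
    (hF : ∀ (S : Type) [CommRing S] [Algebra ℂ S] (p q : S),
      MvPolynomial.aeval ![a • p + b • q, c • p + d • q] (h.homogenize (2 * n)) =
        u ^ 2 • MvPolynomial.aeval ![p, q] (h.homogenize (2 * n))) :
    ∃ Φ : gluedOver H ⟶ gluedOver H,
      ∀ (S : Type) [CommRing S] [Algebra ℂ S] (ψ ψ' : Chart h →ₐ[ℂ] S),
        IsUnit (c • ψ (Chart.x h) + d • 1) →
        (c • ψ (Chart.x h) + d • 1) * ψ' (Chart.x h) = a • ψ (Chart.x h) + b • 1 →
        (c • ψ (Chart.x h) + d • 1) ^ n * ψ' (Chart.z h) = u • ψ (Chart.z h) →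
        specOverMap ψ ≫ leftChart H ≫ Φ = specOverMap ψ' ≫ leftChart H := by
  have hcop {S : Type} [CommRing S] [Algebra ℂ S] (p q p' q' : S) (h1 : p' * p + q' * q = 1) :
      IsCoprime (a • p + b • q) (c • p + d • q) := by
    have hdet' := congrArg (algebraMap ℂ S) hdet
    rw [map_sub, map_mul, map_mul, map_one] at hdet'
    -- These are the coefficients (p', q') multiplied by the inverse matrix.
    refine ⟨d • p' - c • q', a • q' - b • p', ?_⟩
    simp only [Algebra.smul_def]
    linear_combination (p' * p + q' * q) * hdet' + h1
  -- The base coordinates are (x : 1) on the first chart and (1 : x̃) on the second.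
  have hxl := hcop (Chart.x h) 1 0 1 (by ring)
  have hxr := hcop 1 (Chart.x k) 1 0 (by ring)
  have hzl : (u • Chart.z h) ^ 2 = MvPolynomial.aeval ![a • Chart.x h + b • 1,
      c • Chart.x h + d • (1 : Chart h)] (h.homogenize (2 * n)) := by
    have := aeval_homogenize_mul_left H.natDegree_le (Chart.x h) 1
    rw [one_mul, one_pow, one_mul] at this
    rw [hF, this, _root_.smul_pow, Chart.z_sq]
  have hzr : (u • Chart.z k) ^ 2 = MvPolynomial.aeval ![a • 1 + b • Chart.x k,
      c • (1 : Chart k) + d • Chart.x k] (h.homogenize (2 * n)) := by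
    have := aeval_homogenize_mul_right H.natDegree_le (Chart.x k) 1
    rw [one_mul, one_pow, one_mul, ← H.eq_reflect] at this
    rw [hF, this, _root_.smul_pow, Chart.z_sq]
  obtain ⟨φ, hφ⟩ := exists_isGivenBy H hxl hzl
  obtain ⟨φ', hφ'⟩ := exists_isGivenBy H hxr hzr
  have hix : algebraMap (Chart h) (Punctured h) (Chart.x h) * invX h = 1 := x_mul_invX h
  -- On the overlap the second triple is the first one rescaled by l = 1/x.
  have hlin (s t : ℂ) : chartTransition H (s • 1 + t • Chart.x k) =
      IsScalarTower.toAlgHom ℂ (Chart h) (Punctured h) (s • Chart.x h + t • 1) * invX h := by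
    rw [map_add, map_smul, map_smul, map_one, chartTransition_x, map_add, map_smul, map_smul,
      map_one, add_mul, smul_mul_assoc, smul_mul_assoc, one_mul]
    exact congrArg (fun y => s • y + t • invX h) hix.symm
  obtain ⟨Φ, hΦ, -⟩ := exists_desc H φ φ' (hφ.eq_of_rescale hφ' _ (chartTransition H)
    (IsUnit.of_mul_eq_one_right _ hix) (hlin a b) (hlin c d) (by
      rw [map_smul, chartTransition_z, map_smul, smul_mul_assoc]
      rfl) hxl hzl)
  refine ⟨Φ, fun S _ _ ψ ψ' hu hx hz => ?_⟩
  rw [hΦ]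
  refine hφ.left S ψ ψ' ?_ ?_ ?_
  · simpa using hu
  · simpa using hx
  · simpa using hz

end CurveMorphisms

/-! ### Charts with a rational point in general position -/

section GoodCharts

variable {R K : Type} [CommRing R] [Algebra ℂ R] [Field K] [Algebra ℂ K]
  {Y : Over (Spec (CommRingCat.of ℂ))} (j : specOver R ⟶ Y) [IsOpenImmersion j.left]
  {ι : specOver K ⟶ Y} {ε : R →ₐ[ℂ] K}

/-- Regular functions on the image of a chart. -/
def chartSections : Sections Y (chartOpen j).1 ≃ₐ[ℂ] R :=
  AlgEquiv.ofBijective _ (evalAt_chartOpen_bijective j)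

theorem le_preimage_chartOpen_comp {S : Type} [CommRing S] [Algebra ℂ S] (a : R →ₐ[ℂ] S) :
    ⊤ ≤ (specOverMap a ≫ j).left ⁻¹ᵁ (chartOpen j).1 := fun p _ =>
  (mem_chartOpen_iff j).2 ⟨(specOverMap a).left p, rfl⟩

theorem evalAt_comp_chartOpen {S : Type} [CommRing S] [Algebra ℂ S] (a : R →ₐ[ℂ] S) :
    evalAt (specOverMap a ≫ j) (chartOpen j).1 (le_preimage_chartOpen_comp j a) =
      a.comp (chartSections j).toAlgHom :=
  evalAt_specOverMap a j _ (le_preimage_chartOpen j) _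

theorem le_preimage_of_eq {S : Type} [CommRing S] [Algebra ℂ S] {a : R →ₐ[ℂ] S}
    {θ : specOver S ⟶ Y} (hθ : θ = specOverMap a ≫ j) : ⊤ ≤ θ.left ⁻¹ᵁ (chartOpen j).1 :=
  hθ ▸ le_preimage_chartOpen_comp j a

theorem evalAt_chartOpen {S : Type} [CommRing S] [Algebra ℂ S] {a : R →ₐ[ℂ] S}
    {θ : specOver S ⟶ Y} (hθ : θ = specOverMap a ≫ j) :
    evalAt θ (chartOpen j).1 (le_preimage_of_eq j hθ) = a.comp (chartSections j).toAlgHom := by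
  subst hθ
  exact evalAt_comp_chartOpen j a

theorem injective_of_evalAt {S : Type} [CommRing S] [Algebra ℂ S] {a : R →ₐ[ℂ] S}
    {θ : specOver S ⟶ Y} (hθ : θ = specOverMap a ≫ j)
    (h : Function.Injective (evalAt θ (chartOpen j).1 (le_preimage_of_eq j hθ))) :
    Function.Injective a := by
  rw [evalAt_chartOpen j hθ] at h
  intro s t hst
  have h1 := @h ((chartSections j).symm s) ((chartSections j).symm t) (by simpa using hst)
  simpa using h1

theorem kaehlerMap_symm_apply {A B : Type} [CommRing A] [CommRing B] [Algebra ℂ A] [Algebra ℂ B]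
    (e : A ≃ₐ[ℂ] B) (w : Ω[A⁄ℂ]) :
    kaehlerMap e.symm.toAlgHom (kaehlerMap e.toAlgHom w) = w := by
  rw [kaehlerMap_comp]
  have h1 : e.symm.toAlgHom.comp e.toAlgHom = AlgHom.id ℂ A := by ext; simp
  rw [h1, kaehlerMap_id]

variable (δ : Ω[K⁄ℂ] →ₗ[K] K)

theorem formCoeff_chartOpen (hι : ι = specOverMap ε ≫ j)
    (w : Ω[Sections Y (chartOpen j).1⁄ℂ]) :
    formCoeff ι δ (chartOpen j).1 (le_preimage_of_eq j hι) w =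
      δ (kaehlerMap ε (kaehlerMap (chartSections j).toAlgHom w)) := by
  rw [formCoeff_apply, evalAt_chartOpen j hι, kaehlerMap_comp]

theorem isGood_chartOpen (hι : ι = specOverMap ε ≫ j) (hε : Function.Injective ε)
    (hδ : ∀ w, δ (kaehlerMap ε w) = 0 → w = 0) : IsGood ι δ (chartOpen j) := by
  refine ⟨le_preimage_of_eq j hι, ?_, ?_⟩
  · rw [evalAt_chartOpen j hι]
    exact hε.comp (chartSections j).injective
  · rw [injective_iff_map_eq_zero]
    intro w hw
    rw [formCoeff_chartOpen j δ hι] at hw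
    rw [← kaehlerMap_symm_apply (chartSections j) w, hδ _ hw, map_zero]

theorem range_formCoeff_chartOpen (hι : ι = specOverMap ε ≫ j) :
    Set.range (formCoeff ι δ (chartOpen j).1 (le_preimage_of_eq j hι)) =
      Set.range fun w => δ (kaehlerMap ε w) := by
  ext t
  constructor
  · rintro ⟨w, rfl⟩
    exact ⟨_, (formCoeff_chartOpen j δ hι w).symm⟩
  · rintro ⟨w, rfl⟩
    refine ⟨kaehlerMap (chartSections j).symm.toAlgHom w, ?_⟩
    rw [formCoeff_chartOpen j δ hι]
    exact congrArg (fun w => δ (kaehlerMap ε w)) (kaehlerMap_symm_apply (chartSections j).symm w)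

end GoodCharts

/-! ### The function field -/

section FunctionField

variable (h : ℂ[X])

/-- The field of rational functions on the curve `z² = h(x)`. -/
abbrev RationalFunctions : Type := FractionRing (Chart h)

/-- Regular functions on the affine curve as rational functions. -/
def leftEmb : Chart h →ₐ[ℂ] RationalFunctions h :=
  IsScalarTower.toAlgHom ℂ (Chart h) (RationalFunctions h)

variable {h}

theorem leftEmb_injective : Function.Injective (leftEmb h) :=
  IsFractionRing.injective (Chart h) (RationalFunctions h)

theorem leftEmb_eq_zero {p q : ℂ[X]} (hpq : aeval (leftEmb h (Chart.x h)) p +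
    aeval (leftEmb h (Chart.x h)) q * leftEmb h (Chart.z h) = 0) : p = 0 ∧ q = 0 := by
  apply Chart.eq_zero_of_add_eq_zero (h := h)
  apply leftEmb_injective
  rw [map_add, map_mul, Chart.map_aeval, Chart.map_aeval, hpq, map_zero]

theorem aeval_leftEmb_injective :
    Function.Injective (aeval (R := ℂ) (leftEmb h (Chart.x h))) := by
  rw [injective_iff_map_eq_zero]
  intro p hp
  exact (leftEmb_eq_zero (p := p) (q := 0) (by rw [hp]; simp)).1

/-! ### The coefficient of a rational form -/

variable (h) in
/-- The coefficient of a rational differential form with respect to `dx / 2z`. -/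
def fieldCoeff : Ω[RationalFunctions h⁄ℂ] →ₗ[RationalFunctions h] RationalFunctions h :=
  haveI : Algebra.FormallyEtale (Chart h) (RationalFunctions h) :=
    Algebra.FormallyEtale.of_isLocalization (nonZeroDivisors (Chart h))
  (KaehlerDifferential.isBaseChange_of_formallyEtale ℂ (Chart h) (RationalFunctions h)).lift
    (Algebra.linearMap (Chart h) (RationalFunctions h) ∘ₗ chartCoeff h)

theorem fieldCoeff_D_leftEmb (a : Chart h) :
    fieldCoeff h (KaehlerDifferential.D ℂ _ (leftEmb h a)) = leftEmb h (hamiltonian h a) := by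
  have : Algebra.FormallyEtale (Chart h) (RationalFunctions h) :=
    Algebra.FormallyEtale.of_isLocalization (nonZeroDivisors (Chart h))
  have h1 := (KaehlerDifferential.isBaseChange_of_formallyEtale ℂ (Chart h)
    (RationalFunctions h)).lift_eq
    (Algebra.linearMap (Chart h) (RationalFunctions h) ∘ₗ chartCoeff h)
    (KaehlerDifferential.D ℂ _ a)
  rw [KaehlerDifferential.map_D] at h1
  refine h1.trans ?_
  rw [LinearMap.comp_apply, chartCoeff_D]
  rfl

variable (h) in
/-- The derivation `f ↦ df / (dx / 2z)` of the field of rational functions. -/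
def fieldDerivation : Derivation ℂ (RationalFunctions h) (RationalFunctions h) :=
  (fieldCoeff h).compDer (KaehlerDifferential.D ℂ _)

theorem fieldCoeff_D (a : RationalFunctions h) :
    fieldCoeff h (KaehlerDifferential.D ℂ _ a) = fieldDerivation h a := rfl

theorem fieldDerivation_leftEmb (a : Chart h) :
    fieldDerivation h (leftEmb h a) = leftEmb h (hamiltonian h a) := fieldCoeff_D_leftEmb a

theorem fieldCoeff_kaehlerMap_leftEmb (w : Ω[Chart h⁄ℂ]) :
    fieldCoeff h (kaehlerMap (leftEmb h) w) = leftEmb h (chartCoeff h w) := by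
  have : (fieldCoeff h).restrictScalars ℂ ∘ₗ kaehlerMap (leftEmb h) =
      (leftEmb h).toLinearMap ∘ₗ (chartCoeff h).restrictScalars ℂ :=
    kaehler_hom_ext fun a b => by
      change fieldCoeff h (kaehlerMap (leftEmb h) _) = leftEmb h (chartCoeff h _)
      rw [kaehlerMap_smul_D, map_smul, map_smul, fieldCoeff_D_leftEmb, chartCoeff_D, smul_eq_mul,
        smul_eq_mul, map_mul]
  exact DFunLike.congr_fun this w

theorem leftEmb_x_ne_zero : leftEmb h (Chart.x h) ≠ 0 := fun h0 =>
  X_ne_zero ((map_eq_zero_iff _ aeval_leftEmb_injective).1 ((aeval_X _).trans h0))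

theorem leftEmb_z_ne_zero : leftEmb h (Chart.z h) ≠ 0 := fun h0 =>
  one_ne_zero (leftEmb_eq_zero (h := h) (p := 0) (q := 1) (by rw [h0]; simp)).2

theorem mem_left_or_right {n : ℕ} {k : ℂ[X]} (H : IsReversal n h k) (p : (gluedOver H).left) :
    p ∈ (chartOpen (leftChart H)).1 ∨ p ∈ (chartOpen (rightChart H)).1 := by
  obtain ⟨i, y, hy⟩ := Scheme.IsLocallyDirected.ι_jointly_surjective (gluingDiagram H) p
  match i, y, hy with
  | none, y, hy =>
    refine Or.inl ((mem_chartOpen_iff _).2 ⟨inclLeft h y, ?_⟩)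
    have h1 := Limits.colimit.w (gluingDiagram H) (Limits.WidePushoutShape.Hom.init
      Limits.WalkingPair.left)
    rw [← hy, ← h1]
    rfl
  | some .left, y, hy => exact Or.inl ((mem_chartOpen_iff _).2 ⟨y, hy⟩)
  | some .right, y, hy => exact Or.inr ((mem_chartOpen_iff _).2 ⟨y, hy⟩)

variable [IsDomain (Chart h)]

instance : CharZero (RationalFunctions h) :=
  charZero_of_injective_algebraMap (algebraMap ℂ (RationalFunctions h)).injective

variable {n : ℕ} {k : ℂ[X]}

theorem exists_rightEmb (H : IsReversal n h k) : ∃ ψ : Chart k →ₐ[ℂ] RationalFunctions h,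
    leftEmb h (Chart.x h) * ψ (Chart.x k) = 1 ∧
      leftEmb h (Chart.x h) ^ n * ψ (Chart.z k) = leftEmb h (Chart.z h) := by
  refine exists_right_point H leftEmb_x_ne_zero.isUnit ?_
  have := aeval_homogenize_mul_left H.natDegree_le (leftEmb h (Chart.x h)) 1
  rw [one_mul, one_pow, one_mul] at this
  rw [this, Chart.map_z_sq]

variable (H : IsReversal n h k)

/-- Regular functions on the second affine curve as rational functions. -/
def rightEmb : Chart k →ₐ[ℂ] RationalFunctions h := (exists_rightEmb H).choose

theorem x_mul_rightEmb_x : leftEmb h (Chart.x h) * rightEmb H (Chart.x k) = 1 :=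
  (exists_rightEmb H).choose_spec.1

theorem x_pow_mul_rightEmb_z :
    leftEmb h (Chart.x h) ^ n * rightEmb H (Chart.z k) = leftEmb h (Chart.z h) :=
  (exists_rightEmb H).choose_spec.2

/-- Both sides are the homogenization of the reversed polynomial at (a, ab) = (a, 1). -/
theorem pow_mul_aeval_inv {S : Type*} [CommRing S] [Algebra ℂ S] {a b : S} (hab : a * b = 1)
    {p : ℂ[X]} {m : ℕ} (hp : p.natDegree ≤ m) : a ^ m * aeval b p = aeval a (p.reflect m) := by
  have h2 : (p.reflect m).natDegree ≤ m := natDegree_reflect_le.trans (by simp [hp])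
  have h3 := aeval_homogenize_mul_right h2 b a
  have h4 := aeval_homogenize_mul_left h2 a 1
  rw [hab, reflect_reflect] at h3
  rw [one_mul, one_pow, one_mul] at h4
  rw [← h3, h4]

/-- Clearing denominators in r(1/x) + s(1/x) z/xⁿ gives an expression of the form A(x) + B(x)z,
whose two parts are unique. -/
theorem x_pow_mul_rightEmb {r s : ℂ[X]} {m : ℕ} (hr : r.natDegree ≤ m) (hs : s.natDegree ≤ m) :
    leftEmb h (Chart.x h) ^ (m + n) *
      rightEmb H (aeval (Chart.x k) r + aeval (Chart.x k) s * Chart.z k) =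
    aeval (leftEmb h (Chart.x h)) (X ^ n * r.reflect m) +
      aeval (leftEmb h (Chart.x h)) (s.reflect m) * leftEmb h (Chart.z h) := by
  rw [map_add, map_mul, Chart.map_aeval, Chart.map_aeval, map_mul, map_pow, aeval_X,
    ← pow_mul_aeval_inv (x_mul_rightEmb_x H) hr, ← pow_mul_aeval_inv (x_mul_rightEmb_x H) hs,
    ← x_pow_mul_rightEmb_z H]
  ring

theorem rightEmb_injective : Function.Injective (rightEmb H) := by
  rw [injective_iff_map_eq_zero]
  intro b hb
  obtain ⟨r, s, rfl⟩ := Chart.exists_eq b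
  have h1 := x_pow_mul_rightEmb H (le_max_left r.natDegree s.natDegree)
    (le_max_right r.natDegree s.natDegree)
  rw [hb, mul_zero] at h1
  obtain ⟨h2, h3⟩ := leftEmb_eq_zero h1.symm
  rw [mul_eq_zero, or_iff_right (pow_ne_zero _ X_ne_zero), reflect_eq_zero_iff] at h2
  rw [reflect_eq_zero_iff] at h3
  simp [h2, h3]

/-- The generic point of the curve. -/
def generic : specOver (RationalFunctions h) ⟶ gluedOver H :=
  specOverMap (leftEmb h) ≫ leftChart H

theorem generic_eq_right : generic H = specOverMap (rightEmb H) ≫ rightChart H := by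
  refine charts_agree H _ _ (x_mul_rightEmb_x H) ?_
  rw [mul_comm, x_pow_mul_rightEmb_z]

/-- Differentiating x x̃ = 1 and using z = xⁿ z̃ gives dx̃/2z̃ = -x^(n-2) dx/2z. Both sides obey the
Leibniz rule along `rightEmb H`, so the generators suffice; the case of z̃ follows by
differentiating z̃² = k(x̃). -/
theorem fieldDerivation_rightEmb (hn : 2 ≤ n) (b : Chart k) :
    fieldDerivation h (rightEmb H b) =
      -leftEmb h (Chart.x h) ^ (n - 2) * rightEmb H (hamiltonian k b) := by
  obtain ⟨n, rfl⟩ := Nat.exists_eq_add_of_le' hn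
  rw [Nat.add_sub_cancel]
  have hx := x_mul_rightEmb_x H
  have hz := x_pow_mul_rightEmb_z H
  have hdx : fieldDerivation h (rightEmb H (Chart.x k)) =
      -leftEmb h (Chart.x h) ^ n * (2 * rightEmb H (Chart.z k)) := by
    have h1 := congrArg (fieldDerivation h) hx
    rw [Derivation.leibniz, fieldDerivation_leftEmb, hamiltonian_x, Derivation.map_one_eq_zero,
      smul_eq_mul, smul_eq_mul, map_mul, map_ofNat] at h1
    refine mul_left_cancel₀ (pow_ne_zero 2 (leftEmb_x_ne_zero (h := h))) ?_
    linear_combination leftEmb h (Chart.x h) * h1 - 2 * leftEmb h (Chart.z h) * hx + 2 * hz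
  have hz0 : rightEmb H (Chart.z k) ≠ 0 := by
    intro h0
    rw [h0, mul_zero] at hz
    exact leftEmb_z_ne_zero hz.symm
  have hdz : fieldDerivation h (rightEmb H (Chart.z k)) =
      -leftEmb h (Chart.x h) ^ n * rightEmb H (aeval (Chart.x k) (derivative k)) := by
    have h1 := congrArg (fieldDerivation h)
      ((pow_two _).symm.trans (Chart.map_z_sq (rightEmb H)))
    rw [Derivation.map_aeval, hdx, Derivation.leibniz, smul_eq_mul, smul_eq_mul] at h1
    refine mul_left_cancel₀ (mul_ne_zero two_ne_zero hz0) ?_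
    rw [Chart.map_aeval]
    linear_combination h1
  have hb : b ∈ Algebra.adjoin ℂ {Chart.x k, Chart.z k} := Chart.adjoin_eq_top ▸ trivial
  induction hb using Algebra.adjoin_induction with
  | mem b hb =>
    rcases hb with rfl | rfl
    · rw [hdx, hamiltonian_x, map_mul, map_ofNat]
    · rw [hdz, hamiltonian_z]
  | algebraMap c => simp
  | add a b _ _ ha hb => rw [map_add, map_add, ha, hb, map_add, map_add, mul_add]
  | mul a b _ _ ha hb =>
    rw [map_mul, Derivation.leibniz, Derivation.leibniz, ha, hb, map_add]
    simp only [smul_eq_mul, map_mul]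
    ring

theorem fieldCoeff_kaehlerMap_rightEmb (hn : 2 ≤ n) (w : Ω[Chart k⁄ℂ]) :
    fieldCoeff h (kaehlerMap (rightEmb H) w) =
      -leftEmb h (Chart.x h) ^ (n - 2) * rightEmb H (chartCoeff k w) := by
  have : (fieldCoeff h).restrictScalars ℂ ∘ₗ kaehlerMap (rightEmb H) =
      LinearMap.mulLeft ℂ (-leftEmb h (Chart.x h) ^ (n - 2)) ∘ₗ (rightEmb H).toLinearMap ∘ₗ
        (chartCoeff k).restrictScalars ℂ :=
    kaehler_hom_ext fun a b => by
      change fieldCoeff h (kaehlerMap (rightEmb H) _) = _ * rightEmb H (chartCoeff k _)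
      rw [kaehlerMap_smul_D, map_smul, map_smul, fieldCoeff_D, chartCoeff_D, smul_eq_mul,
        smul_eq_mul, map_mul, fieldDerivation_rightEmb H hn]
      ring
  exact DFunLike.congr_fun this w

/-! ### Good charts and uniqueness of morphisms -/

theorem isGood_left (hc : IsCoprime h (derivative h)) :
    IsGood (generic H) (fieldCoeff h) (chartOpen (leftChart H)) := by
  refine isGood_chartOpen (leftChart H) _ rfl leftEmb_injective fun w hw => ?_
  rw [fieldCoeff_kaehlerMap_leftEmb, map_eq_zero_iff _ leftEmb_injective] at hw
  exact (map_eq_zero_iff _ (chartCoeff_injective hc)).1 hw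

theorem isGood_right (hn : 2 ≤ n) (hc : IsCoprime k (derivative k)) :
    IsGood (generic H) (fieldCoeff h) (chartOpen (rightChart H)) := by
  refine isGood_chartOpen (rightChart H) _ (generic_eq_right H) (rightEmb_injective H)
    fun w hw => ?_
  rw [fieldCoeff_kaehlerMap_rightEmb H hn, mul_eq_zero, neg_eq_zero,
    or_iff_right (pow_ne_zero _ leftEmb_x_ne_zero), map_eq_zero_iff _ (rightEmb_injective H)] at hw
  exact (map_eq_zero_iff _ (chartCoeff_injective hc)).1 hw

theorem exists_good (hn : 2 ≤ n) (hc : IsCoprime h (derivative h))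
    (hc' : IsCoprime k (derivative k)) (p : (gluedOver H).left) :
    ∃ V : (gluedOver H).left.affineOpens, p ∈ V.1 ∧ IsGood (generic H) (fieldCoeff h) V := by
  rcases mem_left_or_right H p with hp | hp
  · exact ⟨_, hp, isGood_left H hc⟩
  · exact ⟨_, hp, isGood_right H hn hc'⟩

theorem exists_lift_generic (W : (gluedOver H).left.affineOpens) {p : (gluedOver H).left}
    (hn : 2 ≤ n) (hc : IsCoprime h (derivative h)) (hc' : IsCoprime k (derivative k))
    (hp : p ∈ W.1) : ∃ e : Sections (gluedOver H) W.1 →ₐ[ℂ] RationalFunctions h,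
      Function.Injective e ∧ generic H = specOverMap e ≫ openChart W := by
  have h1 : ⊤ ≤ (generic H).left ⁻¹ᵁ (chartOpen (openChart W)).1 := by
    rw [chartOpen_openChart]
    exact le_preimage_of_mem (exists_good H hn hc hc') hp
  obtain ⟨e, he⟩ := exists_lift (openChart W) (generic H) h1
  exact ⟨e, injective_of_evalAt (openChart W) he
    (evalAt_injective (exists_good H hn hc hc') (chartOpen (openChart W)).1 h1), he⟩

/-- This plays the role of separatedness: the relations hold at the generic point, hence as
identities of functions on the intersection of the charts, and every point in both charts inherits
them. -/
theorem coordinates_agree (hn : 2 ≤ n) (hc : IsCoprime h (derivative h))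
    (hc' : IsCoprime k (derivative k)) {S : Type} [CommRing S] [Algebra ℂ S]
    {θ : specOver S ⟶ gluedOver H} {a : Chart h →ₐ[ℂ] S} {b : Chart k →ₐ[ℂ] S}
    (ha : θ = specOverMap a ≫ leftChart H) (hb : θ = specOverMap b ≫ rightChart H) :
    a (Chart.x h) * b (Chart.x k) = 1 ∧
      b (Chart.z k) * a (Chart.x h) ^ n = a (Chart.z h) := by
  set L := (chartOpen (leftChart H)).1
  set R := (chartOpen (rightChart H)).1
  let l : Chart h →ₐ[ℂ] Sections (gluedOver H) (L ⊓ R) :=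
    (restrict _ inf_le_left).comp (chartSections (leftChart H)).symm.toAlgHom
  let r : Chart k →ₐ[ℂ] Sections (gluedOver H) (L ⊓ R) :=
    (restrict _ inf_le_right).comp (chartSections (rightChart H)).symm.toAlgHom
  have key : ∀ {T : Type} [CommRing T] [Algebra ℂ T] {η : specOver T ⟶ gluedOver H}
      {c : Chart h →ₐ[ℂ] T} {d : Chart k →ₐ[ℂ] T} (hl : η = specOverMap c ≫ leftChart H)
      (hr : η = specOverMap d ≫ rightChart H), ∃ e : ⊤ ≤ η.left ⁻¹ᵁ (L ⊓ R),
      (∀ s, evalAt η (L ⊓ R) e (l s) = c s) ∧ ∀ s, evalAt η (L ⊓ R) e (r s) = d s := by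
    intro T _ _ η c d hl hr
    have eL := le_preimage_of_eq (leftChart H) hl
    have eR := le_preimage_of_eq (rightChart H) hr
    refine ⟨fun p hp => ⟨eL hp, eR hp⟩, fun s => ?_, fun s => ?_⟩
    · refine (evalAt_restrict η inf_le_left (fun p hp => ⟨eL hp, eR hp⟩) _).trans ?_
      rw [evalAt_chartOpen _ hl]
      simp
    · refine (evalAt_restrict η inf_le_right (fun p hp => ⟨eL hp, eR hp⟩) _).trans ?_
      rw [evalAt_chartOpen _ hr]
      simp
  obtain ⟨e, hl, hr⟩ := key (η := generic H) rfl (generic_eq_right H)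
  obtain ⟨e', hl', hr'⟩ := key ha hb
  have hinj := evalAt_injective (exists_good H hn hc hc') (L ⊓ R) e
  have h1 : l (Chart.x h) * r (Chart.x k) = 1 := hinj (by
    rw [map_mul, hl, hr, map_one, x_mul_rightEmb_x])
  have h2 : r (Chart.z k) * l (Chart.x h) ^ n = l (Chart.z h) := hinj (by
    rw [map_mul, map_pow, hl, hr, hl, mul_comm, x_pow_mul_rightEmb_z])
  rw [← hl', ← hl', ← hr', ← hr', ← map_mul, h1, map_one, ← map_pow, ← map_mul, h2]
  exact ⟨rfl, rfl⟩

theorem le_preimage_openChart_comp {Y Z : Over (Spec (CommRingCat.of ℂ))} {W : Y.left.affineOpens}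
    {V : Z.left.Opens} {φ : Y ⟶ Z} (e : W.1 ≤ φ.left ⁻¹ᵁ V) :
    ⊤ ≤ (openChart W ≫ φ).left ⁻¹ᵁ V := fun q _ => by
  have h1 : (openChart W).left q ∈ (chartOpen (openChart W)).1 :=
    (mem_chartOpen_iff _).2 ⟨q, rfl⟩
  rw [chartOpen_openChart] at h1
  exact e h1

theorem openChart_comp_eq (hn : 2 ≤ n) (hc : IsCoprime h (derivative h))
    (hc' : IsCoprime k (derivative k)) {φ ψ : gluedOver H ⟶ gluedOver H}
    (hφ : generic H ≫ φ = generic H ≫ ψ) {W : (gluedOver H).left.affineOpens}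
    {p : (gluedOver H).left} (hp : p ∈ W.1) {a : Chart h →ₐ[ℂ] Sections (gluedOver H) W.1}
    {b : Chart k →ₐ[ℂ] Sections (gluedOver H) W.1}
    (ha : openChart W ≫ φ = specOverMap a ≫ leftChart H)
    (hb : openChart W ≫ ψ = specOverMap b ≫ rightChart H) :
    openChart W ≫ φ = openChart W ≫ ψ := by
  obtain ⟨e, he, hge⟩ := exists_lift_generic H W hn hc hc' hp
  have h1 : generic H ≫ φ = specOverMap (e.comp a) ≫ leftChart H := by
    rw [hge, Category.assoc, ha, specOverMap_comp, Category.assoc]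
  have h2 : generic H ≫ φ = specOverMap (e.comp b) ≫ rightChart H := by
    rw [hφ, hge, Category.assoc, hb, specOverMap_comp, Category.assoc]
  obtain ⟨h3, h4⟩ := coordinates_agree H hn hc hc' h1 h2
  rw [ha, hb]
  refine charts_agree H a b (he ?_) (he ?_)
  · rw [map_mul, map_one]
    exact h3
  · rw [map_mul, map_pow]
    exact h4

theorem openChart_comp_eq_of_same {R : Type} [CommRing R] [Algebra ℂ R]
    (j : specOver R ⟶ gluedOver H) [IsOpenImmersion j.left]
    (hn : 2 ≤ n) (hc : IsCoprime h (derivative h))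
    (hc' : IsCoprime k (derivative k)) {φ ψ : gluedOver H ⟶ gluedOver H}
    (hφ : generic H ≫ φ = generic H ≫ ψ) {W : (gluedOver H).left.affineOpens}
    {p : (gluedOver H).left} (hp : p ∈ W.1) {a b : R →ₐ[ℂ] Sections (gluedOver H) W.1}
    (ha : openChart W ≫ φ = specOverMap a ≫ j) (hb : openChart W ≫ ψ = specOverMap b ≫ j) :
    openChart W ≫ φ = openChart W ≫ ψ := by
  obtain ⟨e, he, hge⟩ := exists_lift_generic H W hn hc hc' hp
  have h1 : specOverMap (e.comp a) ≫ j = specOverMap (e.comp b) ≫ j := by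
    rw [specOverMap_comp, specOverMap_comp, Category.assoc, Category.assoc, ← ha, ← hb,
      ← Category.assoc, ← Category.assoc, ← hge, hφ]
  have h2 := specOverMap_comp_injective h1
  rw [ha, hb, AlgHom.ext fun s => he (DFunLike.congr_fun h2 s)]

/-- On a small affine `W` around a point each morphism goes into one chart, so it is a ring
homomorphism into 𝒪(W), and 𝒪(W) embeds in `K`. If the charts differ, the coordinates are matched by
the gluing relations, which hold in `K` by `coordinates_agree`. -/
theorem hom_ext_of_generic (hn : 2 ≤ n) (hc : IsCoprime h (derivative h))
    (hc' : IsCoprime k (derivative k)) {φ ψ : gluedOver H ⟶ gluedOver H}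
    (hφ : generic H ≫ φ = generic H ≫ ψ) : φ = ψ := by
  refine over_hom_ext fun p => ?_
  have key : ∀ V V' : (gluedOver H).left.Opens, φ.left p ∈ V → ψ.left p ∈ V' →
      ∃ W : (gluedOver H).left.affineOpens, p ∈ W.1 ∧
        ⊤ ≤ (openChart W ≫ φ).left ⁻¹ᵁ V ∧ ⊤ ≤ (openChart W ≫ ψ).left ⁻¹ᵁ V' := by
    intro V V' hV hV'
    obtain ⟨W, hW, hp, hle⟩ := exists_isAffineOpen_mem_and_subset
      (U := φ.left ⁻¹ᵁ V ⊓ ψ.left ⁻¹ᵁ V') (x := p) ⟨hV, hV'⟩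
    exact ⟨⟨W, hW⟩, hp, le_preimage_openChart_comp (fun q hq => (hle hq).1),
      le_preimage_openChart_comp (fun q hq => (hle hq).2)⟩
  rcases mem_left_or_right H (φ.left p) with h1 | h1 <;>
  rcases mem_left_or_right H (ψ.left p) with h2 | h2 <;>
  obtain ⟨W, hp, e1, e2⟩ := key _ _ h1 h2 <;>
  obtain ⟨a, ha⟩ := exists_lift _ _ e1 <;>
  obtain ⟨b, hb⟩ := exists_lift _ _ e2 <;>
  refine ⟨W, hp, ?_⟩
  · exact openChart_comp_eq_of_same H _ hn hc hc' hφ hp ha hb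
  · exact openChart_comp_eq H hn hc hc' hφ hp ha hb
  · exact (openChart_comp_eq H hn hc hc' hφ.symm hp hb ha).symm
  · exact openChart_comp_eq_of_same H _ hn hc hc' hφ hp ha hb

end FunctionField

/-! ### Global forms on the curve -/

section CurveForms

variable {n : ℕ} {h k : ℂ[X]} (H : IsReversal n h k) [IsDomain (Chart h)]

/-- The coefficient of a global form with respect to `dx / 2z`. -/
def curveCoeff : GlobalForms (gluedOver H) →ₗ[ℂ] RationalFunctions h :=
  globalCoeff (δ := fieldCoeff h) (chartOpen (leftChart H))
    (le_preimage_of_eq (leftChart H) (θ := generic H) rfl)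

theorem curveCoeff_injective (hn : 2 ≤ n) (hc : IsCoprime h (derivative h))
    (hc' : IsCoprime k (derivative k)) : Function.Injective (curveCoeff H) :=
  globalCoeff_injective (exists_good H hn hc hc') _ _

theorem curveCoeff_eq (ω : GlobalForms (gluedOver H)) :
    curveCoeff H ω = leftEmb h (chartCoeff h
      (kaehlerMap (chartSections (leftChart H)).toAlgHom (ω.1 (chartOpen (leftChart H))))) :=
  (formCoeff_chartOpen (leftChart H) (fieldCoeff h) (ι := generic H) rfl _).trans
    (fieldCoeff_kaehlerMap_leftEmb _)

theorem curveCoeff_eq_right (hn : 2 ≤ n) (hc : IsCoprime h (derivative h))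
    (hc' : IsCoprime k (derivative k)) (ω : GlobalForms (gluedOver H)) :
    curveCoeff H ω = -leftEmb h (Chart.x h) ^ (n - 2) * rightEmb H (chartCoeff k
      (kaehlerMap (chartSections (rightChart H)).toAlgHom (ω.1 (chartOpen (rightChart H))))) :=
  (formCoeff_eq_globalCoeff (exists_good H hn hc hc') _ _ (chartOpen (rightChart H))
    (le_preimage_of_eq (rightChart H) (generic_eq_right H)) ω).symm.trans
    ((formCoeff_chartOpen (rightChart H) (fieldCoeff h) (generic_eq_right H) _).trans
      (fieldCoeff_kaehlerMap_rightEmb H hn _))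

/-- The coefficient is p + qz seen from the first chart and -x^(n-2) (r(1/x) + s(1/x) z/xⁿ) seen
from the second. After multiplication by x^(m+n) the parts with and without z can be compared by
degree. -/
theorem exists_polynomial (hn : 2 ≤ n) (hc : IsCoprime h (derivative h))
    (hc' : IsCoprime k (derivative k)) (ω : GlobalForms (gluedOver H)) :
    ∃ p : ℂ[X], p.natDegree ≤ n - 2 ∧ curveCoeff H ω = aeval (leftEmb h (Chart.x h)) p := by
  obtain ⟨p, q, hpq⟩ := Chart.exists_eq (chartCoeff h
      (kaehlerMap (chartSections (leftChart H)).toAlgHom (ω.1 (chartOpen (leftChart H)))))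
  obtain ⟨r, s, hrs⟩ := Chart.exists_eq (chartCoeff k
      (kaehlerMap (chartSections (rightChart H)).toAlgHom (ω.1 (chartOpen (rightChart H)))))
  have h1 := curveCoeff_eq H ω
  have h2 := curveCoeff_eq_right H hn hc hc' ω
  rw [hpq] at h1
  rw [hrs] at h2
  set m := max r.natDegree s.natDegree
  have h3 := x_pow_mul_rightEmb H (le_max_left r.natDegree s.natDegree)
    (le_max_right r.natDegree s.natDegree)
  have h4 : aeval (leftEmb h (Chart.x h)) (X ^ (m + n) * p + X ^ (n - 2) * (X ^ n * r.reflect m)) +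
      aeval (leftEmb h (Chart.x h)) (X ^ (m + n) * q + X ^ (n - 2) * s.reflect m) *
        leftEmb h (Chart.z h) = 0 := by
    rw [h1] at h2
    simp only [map_add, map_mul, map_pow, aeval_X, Chart.map_aeval] at h2 h3 ⊢
    linear_combination leftEmb h (Chart.x h) ^ (m + n) * h2 -
      leftEmb h (Chart.x h) ^ (n - 2) * h3
  obtain ⟨h5, h6⟩ := leftEmb_eq_zero h4
  have hdeg (t : ℂ[X]) (ht : t.natDegree ≤ m) : (t.reflect m).natDegree ≤ m :=
    natDegree_reflect_le.trans (by simp [ht])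
  -- For q ≠ 0 one side has degree at least m + n, the other at most m + n - 2.
  have hq : q = 0 := by
    by_contra hq
    have h7 := congrArg natDegree (eq_neg_of_add_eq_zero_left h6)
    rw [natDegree_X_pow_mul _ hq, natDegree_neg] at h7
    have h8 := (natDegree_mul_le (p := X ^ (n - 2)) (q := s.reflect m)).trans
      (Nat.add_le_add_left (hdeg s (le_max_right _ _)) _)
    rw [natDegree_X_pow] at h8
    omega
  refine ⟨p, ?_, ?_⟩
  -- Now deg p + (m + n) is at most (n - 2) + n + m.
  · by_cases hp : p = 0
    · simp [hp]
    have h7 := congrArg natDegree (eq_neg_of_add_eq_zero_left h5)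
    rw [natDegree_X_pow_mul _ hp, natDegree_neg] at h7
    have h8 := (natDegree_mul_le (p := X ^ (n - 2)) (q := X ^ n * r.reflect m)).trans
      (Nat.add_le_add_left (natDegree_mul_le.trans
        (Nat.add_le_add_left (hdeg r (le_max_left _ _)) _)) _)
    rw [natDegree_X_pow, natDegree_X_pow] at h8
    omega
  · rw [h1, hq, map_zero, zero_mul, add_zero, Chart.map_aeval]

theorem exists_form (hn : 2 ≤ n) (hc : IsCoprime h (derivative h))
    (hc' : IsCoprime k (derivative k)) {p : ℂ[X]} (hp : p.natDegree ≤ n - 2) :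
    ∃ ω, curveCoeff H ω = aeval (leftEmb h (Chart.x h)) p := by
  refine exists_globalCoeff_eq (exists_good H hn hc hc') _ _ _ fun y => ?_
  rcases mem_left_or_right H y with hy | hy
  · refine ⟨_, le_preimage_of_eq (leftChart H) (θ := generic H) rfl, hy, ?_⟩
    rw [range_formCoeff_chartOpen (leftChart H) _ (ι := generic H) rfl]
    obtain ⟨w, hw⟩ := chartCoeff_surjective hc (aeval (Chart.x h) p)
    exact ⟨w, by beta_reduce; rw [fieldCoeff_kaehlerMap_leftEmb, hw, Chart.map_aeval]⟩
  · refine ⟨_, le_preimage_of_eq (rightChart H) (generic_eq_right H), hy, ?_⟩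
    rw [range_formCoeff_chartOpen (rightChart H) _ (generic_eq_right H)]
    -- The reversal undoes the factor -x^(n-2) between the two generators.
    obtain ⟨w, hw⟩ := chartCoeff_surjective hc' (-aeval (Chart.x k) (p.reflect (n - 2)))
    refine ⟨w, ?_⟩
    beta_reduce
    rw [fieldCoeff_kaehlerMap_rightEmb H hn, hw, map_neg, Chart.map_aeval, neg_mul_neg,
      pow_mul_aeval_inv (x_mul_rightEmb_x H) (natDegree_reflect_le.trans (by simp [hp])),
      reflect_reflect]

/-! ### Automorphisms at the generic point -/

theorem le_preimage_inv_preimage {Y Z : Over (Spec (CommRingCat.of ℂ))} (φ : Y ≅ Z)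
    (V : Z.left.Opens) : V ≤ φ.inv.left ⁻¹ᵁ (φ.hom.left ⁻¹ᵁ V) := by
  rw [← Scheme.Hom.comp_preimage, ← Over.comp_left, φ.inv_hom_id]
  exact le_refl _

theorem pullSections_injective {Y Z : Over (Spec (CommRingCat.of ℂ))} (φ : Y ≅ Z)
    (V : Z.left.Opens) :
    Function.Injective (pullSections φ.hom V (φ.hom.left ⁻¹ᵁ V) (le_refl _)) := by
  have h1 : ∀ (χ : Z ⟶ Z) (e : V ≤ χ.left ⁻¹ᵁ V), χ = 𝟙 _ →
      pullSections χ V V e = AlgHom.id ℂ _ := by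
    rintro _ e rfl
    exact pullSections_id V e
  have e := le_preimage_inv_preimage φ V
  have h2 := (pullSections_comp φ.inv φ.hom V _ V (le_refl _) e e).trans (h1 _ e φ.inv_hom_id)
  exact Function.LeftInverse.injective (g := pullSections φ.inv _ V e) fun s =>
    DFunLike.congr_fun h2 s

/-- The preimage of the first chart under an automorphism is open and not empty, so it contains the
generic point. Injectivity holds because pulling back along an isomorphism and evaluating at the
generic point are both injective. -/
theorem exists_generic_comp (hn : 2 ≤ n) (hc : IsCoprime h (derivative h))
    (hc' : IsCoprime k (derivative k)) (φ : Aut (gluedOver H)) :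
    ∃ ψ : Chart h →ₐ[ℂ] RationalFunctions h, Function.Injective ψ ∧
      generic H ≫ φ.hom = specOverMap ψ ≫ leftChart H := by
  obtain ⟨q⟩ : Nonempty (specOver (RationalFunctions h)).left :=
    inferInstanceAs (Nonempty (PrimeSpectrum (RationalFunctions h)))
  have hq := le_preimage_of_eq (leftChart H) (θ := generic H) rfl (x := q) trivial
  have hq' : φ.inv.left ((generic H).left q) ∈ φ.hom.left ⁻¹ᵁ (chartOpen (leftChart H)).1 :=
    le_preimage_inv_preimage φ (chartOpen (leftChart H)).1 hq
  have e2 := le_preimage_of_mem (exists_good H hn hc hc') hq'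
  obtain ⟨ψ, hψ⟩ := exists_lift (leftChart H) (generic H ≫ φ.hom) e2
  refine ⟨ψ, injective_of_evalAt (leftChart H) hψ ?_, hψ⟩
  have h1 := evalAt_comp_pullSections (generic H) φ.hom e2 (le_refl _)
    (le_preimage_of_eq (leftChart H) hψ)
  have h2 := (evalAt_injective (exists_good H hn hc hc') _ e2).comp
    (pullSections_injective φ (chartOpen (leftChart H)).1)
  intro s t hst
  exact h2 ((DFunLike.congr_fun h1 s).trans (hst.trans (DFunLike.congr_fun h1 t).symm))

/-- On the first chart the form satisfies 2z ω = a dx; this relation is pulled back along `ψ`. -/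
theorem curveCoeff_pullForms (hn : 2 ≤ n) (hc : IsCoprime h (derivative h))
    (hc' : IsCoprime k (derivative k)) {φ : Aut (gluedOver H)}
    {ψ : Chart h →ₐ[ℂ] RationalFunctions h}
    (hψ : generic H ≫ φ.hom = specOverMap ψ ≫ leftChart H) {ω : GlobalForms (gluedOver H)}
    {a : Chart h} (hω : curveCoeff H ω = leftEmb h a) :
    2 * ψ (Chart.z h) * curveCoeff H (pullForms φ ω) =
      ψ a * fieldDerivation h (ψ (Chart.x h)) := by
  set A := chartOpen (leftChart H)
  have e3 := le_preimage_of_eq (leftChart H) hψ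
  obtain ⟨q⟩ : Nonempty (specOver (RationalFunctions h)).left :=
    inferInstanceAs (Nonempty (PrimeSpectrum (RationalFunctions h)))
  obtain ⟨W, hW, hqW, hle⟩ := exists_isAffineOpen_mem_and_subset
    (U := φ.hom.left ⁻¹ᵁ A.1) (x := (generic H).left q) (e3 (x := q) trivial)
  have eW : ⊤ ≤ (generic H).left ⁻¹ᵁ W := le_preimage_of_mem (exists_good H hn hc hc') hqW
  have h1 : curveCoeff H (pullForms φ ω) = fieldCoeff h (kaehlerMap ψ
      (kaehlerMap (chartSections (leftChart H)).toAlgHom (ω.1 A))) := by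
    refine (formCoeff_eq_globalCoeff (exists_good H hn hc hc') _ _ ⟨W, hW⟩ eW _).symm.trans ?_
    refine congrArg (fieldCoeff h) ?_
    change kaehlerMap _ (pullFamily φ ω.1 ⟨W, hW⟩) = _
    rw [pullFamily_eq φ ω.2 ⟨W, hW⟩ A hle, kaehlerMap_comp, kaehlerMap_comp]
    refine congrArg (fun F => kaehlerMap F (ω.1 A)) ?_
    exact (evalAt_comp_pullSections (generic H) φ.hom eW hle e3).trans
      (evalAt_chartOpen (leftChart H) hψ)
  rw [curveCoeff_eq] at hω
  set w := kaehlerMap (chartSections (leftChart H)).toAlgHom (ω.1 A)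
  have h2 : (2 * Chart.z h) • w = a • KaehlerDifferential.D ℂ (Chart h) (Chart.x h) := by
    apply chartCoeff_injective hc
    rw [map_smul, map_smul, leftEmb_injective hω, chartCoeff_D, hamiltonian_x, smul_eq_mul,
      smul_eq_mul, mul_comm]
  have h3 := congrArg (fun t => fieldCoeff h (kaehlerMap ψ t)) h2
  rw [kaehlerMap_smul_D, kaehlerMap_smul, map_smul, map_smul, fieldCoeff_D, smul_eq_mul,
    smul_eq_mul] at h3
  rw [h1, ← h3, map_mul, map_ofNat]

end CurveForms

/-! ### The automorphisms given by elements of `Γ(ρ)` -/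

section Moebius

theorem aeval_subst {S : Type*} [CommRing S] [Algebra ℂ S] (γ : Matrix.SpecialLinearGroup (Fin 2) ℂ)
    (F : MvPolynomial (Fin 2) ℂ) (p q : S) :
    MvPolynomial.aeval ![p, q] (subst γ F) =
      MvPolynomial.aeval ![γ 0 0 • p + γ 0 1 • q, γ 1 0 • p + γ 1 1 • q] F := by
  rw [subst, MvPolynomial.comp_aeval_apply]
  congr 2
  funext i
  fin_cases i <;> simp [Algebra.smul_def, MvPolynomial.algHom_C]

variable {g : ℕ} {f : ℂ[X]}

theorem aeval_of_mem_gammaRho {S : Type*} [CommRing S] [Algebra ℂ S]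
    {γ : Matrix.SpecialLinearGroup (Fin 2) ℂ × ℂˣ} (hγ : γ ∈ GammaRho g f) (p q : S) :
    MvPolynomial.aeval ![γ.1 0 0 • p + γ.1 0 1 • q, γ.1 1 0 • p + γ.1 1 1 • q]
        (f.homogenize (2 * (g + 1))) =
      (γ.2 : ℂ) ^ 2 • MvPolynomial.aeval ![p, q] (f.homogenize (2 * (g + 1))) := by
  rw [← aeval_subst, ← map_smul]
  exact congrArg _ hγ

/-- The point `ψ'` is `((a x + b) / (c x + d), u z / (c x + d) ^ (g+1))` where `ψ` is `(x, z)`. -/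
structure Transforms (g : ℕ) {S : Type*} [CommRing S] [Algebra ℂ S]
    (γ : Matrix.SpecialLinearGroup (Fin 2) ℂ × ℂˣ) (ψ ψ' : Chart f →ₐ[ℂ] S) : Prop where
  x : (γ.1 1 0 • ψ (Chart.x f) + algebraMap ℂ S (γ.1 1 1)) * ψ' (Chart.x f) =
    γ.1 0 0 • ψ (Chart.x f) + algebraMap ℂ S (γ.1 0 1)
  z : (γ.1 1 0 • ψ (Chart.x f) + algebraMap ℂ S (γ.1 1 1)) ^ (g + 1) * ψ' (Chart.z f) =
    (γ.2 : ℂ) • ψ (Chart.z f)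

section Field

variable {K : Type*} [Field K] [Algebra ℂ K] {γ γ' : Matrix.SpecialLinearGroup (Fin 2) ℂ × ℂˣ}
  {ψ ψ' ψ'' : Chart f →ₐ[ℂ] K}

/-- The cocycle rule of the automorphy factor cx + d. -/
theorem Transforms.den_mul (h1 : Transforms g γ' ψ ψ') :
    (γ * γ').1 1 0 • ψ (Chart.x f) + algebraMap ℂ K ((γ * γ').1 1 1) =
      (γ'.1 1 0 • ψ (Chart.x f) + algebraMap ℂ K (γ'.1 1 1)) *
        (γ.1 1 0 • ψ' (Chart.x f) + algebraMap ℂ K (γ.1 1 1)) := by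
  have h3 := h1.x
  simp only [Prod.fst_mul, Matrix.SpecialLinearGroup.coe_mul, Matrix.mul_apply,
    Fin.sum_univ_two, Algebra.smul_def, map_add, map_mul] at h3 ⊢
  linear_combination -algebraMap ℂ K (γ.1 1 0) * h3

theorem Transforms.mul (h1 : Transforms g γ' ψ ψ') (h2 : Transforms g γ ψ' ψ'') :
    Transforms g (γ * γ') ψ ψ'' := by
  constructor
  · rw [h1.den_mul, mul_assoc, h2.x]
    have h3 := h1.x
    simp only [Prod.fst_mul, Matrix.SpecialLinearGroup.coe_mul, Matrix.mul_apply,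
      Fin.sum_univ_two, Algebra.smul_def, map_add, map_mul] at h3 ⊢
    linear_combination algebraMap ℂ K (γ.1 0 0) * h3
  · rw [h1.den_mul, mul_pow, mul_assoc, h2.z, mul_smul_comm, h1.z, smul_smul]
    rfl

theorem Transforms.one : Transforms g 1 ψ ψ := by
  constructor <;> simp

/-- F(ax + b, cx + d) = u² F(x, 1) says that the transformed coordinates again satisfy the equation
of the curve. -/
theorem exists_transforms (hf : f.natDegree ≤ 2 * (g + 1)) (hγ : γ ∈ GammaRho g f)
    (hd : γ.1 1 0 • ψ (Chart.x f) + algebraMap ℂ K (γ.1 1 1) ≠ 0) :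
    ∃ ψ', Transforms g γ ψ ψ' := by
  set d := γ.1 1 0 • ψ (Chart.x f) + algebraMap ℂ K (γ.1 1 1) with hd'
  set a := γ.1 0 0 • ψ (Chart.x f) + algebraMap ℂ K (γ.1 0 1) with ha'
  have h1 := aeval_of_mem_gammaRho hγ (ψ (Chart.x f)) 1
  rw [← Algebra.algebraMap_eq_smul_one, ← Algebra.algebraMap_eq_smul_one, ← hd', ← ha',
    show ![a, d] = ![d * (a / d), d] by rw [mul_div_cancel₀ _ hd],
    aeval_homogenize_mul_left hf,
    show ![ψ (Chart.x f), 1] = ![1 * ψ (Chart.x f), 1] by rw [one_mul],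
    aeval_homogenize_mul_left hf, one_pow, one_mul, ← Chart.map_z_sq] at h1
  refine ⟨Chart.lift (a / d) ((γ.2 : ℂ) • ψ (Chart.z f) / d ^ (g + 1)) ?_, ?_, ?_⟩
  · rw [div_pow, _root_.smul_pow, ← h1, ← pow_mul, mul_comm (g + 1),
      mul_div_cancel_left₀ _ (pow_ne_zero _ hd)]
  · rw [Chart.lift_x, mul_div_cancel₀ _ hd]
  · rw [Chart.lift_z, mul_div_cancel₀ _ (pow_ne_zero _ hd)]

/-- The image of x is transcendental, and c, d are not both 0 in a matrix of determinant 1. -/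
theorem den_ne_zero (hψ : Function.Injective (aeval (R := ℂ) (ψ (Chart.x f)))) :
    γ.1 1 0 • ψ (Chart.x f) + algebraMap ℂ K (γ.1 1 1) ≠ 0 := by
  intro h0
  have h1 : (C (γ.1 1 0) * X + C (γ.1 1 1) : ℂ[X]) = 0 := hψ (by
    rw [map_zero, ← h0]
    simp [Algebra.smul_def])
  have h2 := congrArg (fun p => coeff p 1) h1
  have h3 := congrArg (fun p => coeff p 0) h1
  have h4 := γ.1.det_coe
  rw [Matrix.det_fin_two] at h4
  simp at h2 h3
  rw [h2, h3] at h4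
  simp at h4

end Field

variable {k : ℂ[X]} (H : IsReversal (g + 1) f k)

theorem exists_curveHom (γ : GammaRho g f) : ∃ Φ : gluedOver H ⟶ gluedOver H,
    ∀ (ψ ψ' : Chart f →ₐ[ℂ] RationalFunctions f),
      IsUnit (γ.1.1 1 0 • ψ (Chart.x f) + algebraMap ℂ _ (γ.1.1 1 1)) →
      Transforms g γ.1 ψ ψ' → specOverMap ψ ≫ leftChart H ≫ Φ = specOverMap ψ' ≫ leftChart H := by
  have h1 := γ.1.1.det_coe
  rw [Matrix.det_fin_two] at h1
  obtain ⟨Φ, hΦ⟩ := exists_moebius H h1 fun S _ _ p q => aeval_of_mem_gammaRho γ.2 p q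
  refine ⟨Φ, fun ψ ψ' hd hψ => ?_⟩
  obtain ⟨hx, hz⟩ := hψ
  rw [Algebra.algebraMap_eq_smul_one] at hd
  simp only [Algebra.algebraMap_eq_smul_one] at hx hz
  exact hΦ _ ψ ψ' hd hx hz

/-- The endomorphism of the curve given by an element of `Γ(ρ)`. -/
def curveHom (γ : GammaRho g f) : gluedOver H ⟶ gluedOver H := (exists_curveHom H γ).choose

variable [IsDomain (Chart f)]

theorem specOverMap_curveHom {γ : GammaRho g f} {ψ ψ' : Chart f →ₐ[ℂ] RationalFunctions f}
    (hd : γ.1.1 1 0 • ψ (Chart.x f) + algebraMap ℂ _ (γ.1.1 1 1) ≠ 0)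
    (h : Transforms g γ.1 ψ ψ') :
    specOverMap ψ ≫ leftChart H ≫ curveHom H γ = specOverMap ψ' ≫ leftChart H :=
  (exists_curveHom H γ).choose_spec ψ ψ' hd.isUnit h

theorem generic_den_ne_zero (γ : Matrix.SpecialLinearGroup (Fin 2) ℂ × ℂˣ) :
    γ.1 1 0 • leftEmb f (Chart.x f) + algebraMap ℂ _ (γ.1 1 1) ≠ 0 :=
  den_ne_zero aeval_leftEmb_injective

theorem generic_curveHom {γ : GammaRho g f} {ψ : Chart f →ₐ[ℂ] RationalFunctions f}
    (h : Transforms g γ.1 (leftEmb f) ψ) :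
    generic H ≫ curveHom H γ = specOverMap ψ ≫ leftChart H :=
  (Category.assoc _ _ _).trans (specOverMap_curveHom H (generic_den_ne_zero γ.1) h)

theorem exists_generic_transforms (hf : f.natDegree ≤ 2 * (g + 1)) (γ : GammaRho g f) :
    ∃ ψ, Transforms g γ.1 (leftEmb f) ψ :=
  exists_transforms hf γ.2 (generic_den_ne_zero γ.1)

variable (hg : 2 ≤ g + 1) (hc : IsCoprime f (derivative f)) (hc' : IsCoprime k (derivative k))

include hg hc hc'

/-- `γ'` acts first, which is also the order of composition in a product of automorphisms, so the
result is a homomorphism and not an antihomomorphism. -/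
theorem curveHom_mul (γ γ' : GammaRho g f) :
    curveHom H γ' ≫ curveHom H γ = curveHom H (γ * γ') := by
  refine hom_ext_of_generic H hg hc hc' ?_
  obtain ⟨ψ, hψ⟩ := exists_generic_transforms H.natDegree_le γ'
  have hd : γ.1.1 1 0 • ψ (Chart.x f) + algebraMap ℂ _ (γ.1.1 1 1) ≠ 0 := by
    have h1 := generic_den_ne_zero (f := f) (γ * γ').1
    rw [Subgroup.coe_mul, hψ.den_mul] at h1
    exact right_ne_zero_of_mul h1
  obtain ⟨ψ', hψ'⟩ := exists_transforms H.natDegree_le γ.2 hd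
  rw [← Category.assoc, generic_curveHom H hψ, Category.assoc, specOverMap_curveHom H hd hψ',
    generic_curveHom H (γ := γ * γ') (hψ.mul hψ')]

theorem curveHom_one : curveHom H (1 : GammaRho g f) = 𝟙 _ := by
  refine hom_ext_of_generic H hg hc hc' ?_
  rw [generic_curveHom H (γ := 1) (ψ := leftEmb f) Transforms.one, Category.comp_id]
  rfl

/-- The homomorphism from `Γ(ρ)` to the automorphisms of the curve. -/
def curveAut : GammaRho g f →* Aut (gluedOver H) where
  toFun γ :=
    { hom := curveHom H γ
      inv := curveHom H γ⁻¹
      hom_inv_id := by rw [curveHom_mul H hg hc hc', inv_mul_cancel, curveHom_one H hg hc hc']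
      inv_hom_id := by rw [curveHom_mul H hg hc hc', mul_inv_cancel, curveHom_one H hg hc hc'] }
  map_one' := Iso.ext (curveHom_one H hg hc hc')
  map_mul' γ γ' := Iso.ext (curveHom_mul H hg hc hc' γ γ').symm

/-- Reduces equality of automorphisms to two equations in `K`; `isInducedBy_iff` reduces the
description by coordinates to the same two. -/
theorem curveAut_eq_iff (γ : GammaRho g f) {φ : Aut (gluedOver H)}
    {ψ : Chart f →ₐ[ℂ] RationalFunctions f}
    (hψ : generic H ≫ φ.hom = specOverMap ψ ≫ leftChart H) :
    curveAut H hg hc hc' γ = φ ↔ Transforms g γ.1 (leftEmb f) ψ := by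
  constructor
  · rintro rfl
    obtain ⟨ψ', hψ'⟩ := exists_generic_transforms H.natDegree_le γ
    have h1 : specOverMap ψ ≫ leftChart H = specOverMap ψ' ≫ leftChart H :=
      hψ.symm.trans (generic_curveHom H hψ')
    rwa [specOverMap_comp_injective h1]
  · intro h
    exact Iso.ext (hom_ext_of_generic H hg hc hc' ((generic_curveHom H h).trans hψ.symm))

end Moebius

/-! ### Automorphisms described by their coordinate formula -/

section Induced

variable {g : ℕ} {f : ℂ[X]} (hf : f.natDegree ≤ 2 * g + 2)

theorem chartSections_coordinate (a : Chart f) :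
    chartSections (leftChart (isReversal_reflect hf)) (coordinate g f hf a) = a := by
  set j := chartLeft (isReversal_reflect hf)
  have h1 : (j.appIso ⊤).inv ≫ j.appLE (j ''ᵁ ⊤) ⊤ (Scheme.Hom.preimage_image_eq j ⊤).ge = 𝟙 _ := by
    rw [← Scheme.Hom.appIso_hom', Iso.inv_hom_id]
  have h2 : ((Scheme.ΓSpecIso (CommRingCat.of (Chart f))).inv ≫ (j.appIso ⊤).inv) ≫
      j.appLE (j ''ᵁ ⊤) ⊤ (Scheme.Hom.preimage_image_eq j ⊤).ge ≫
        (Scheme.ΓSpecIso (CommRingCat.of (Chart f))).hom = 𝟙 _ := by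
    rw [Category.assoc, reassoc_of% h1, Iso.inv_hom_id]
  exact congrArg (fun t => t.hom a) h2

theorem moebius_relations_iff {S K : Type*} [CommRing S] [Algebra ℂ S] [CommRing K] [Algebra ℂ K]
    {E : S →ₐ[ℂ] K} (hE : Function.Injective E) {a b c d u : ℂ} {x z x' z' : S} {X Z X' Z' : K}
    {n : ℕ} (hx : E x = X) (hz : E z = Z) (hx' : E x' = X') (hz' : E z' = Z') :
    ((c • x + algebraMap ℂ S d) * x' = a • x + algebraMap ℂ S b ∧
      (c • x + algebraMap ℂ S d) ^ n * z' = u • z) ↔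
    ((c • X + algebraMap ℂ K d) * X' = a • X + algebraMap ℂ K b ∧
      (c • X + algebraMap ℂ K d) ^ n * Z' = u • Z) := by
  rw [← hE.eq_iff, ← hE.eq_iff (a := _ ^ n * z')]
  simp [hx, hz, hx', hz']

variable [IsDomain (Chart f)]

/-- The coordinate equations live on an open set that contains the generic point, and functions on
it embed in `K`. -/
theorem isInducedBy_iff (hg : 2 ≤ g + 1) (hc : IsCoprime f (derivative f))
    (hc' : IsCoprime (f.reflect (2 * (g + 1))) (derivative (f.reflect (2 * (g + 1)))))
    (γ : Matrix.SpecialLinearGroup (Fin 2) ℂ × ℂˣ) {φ : Aut (Curve g f hf)}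
    {ψ : Chart f →ₐ[ℂ] RationalFunctions f}
    (hψ : generic (isReversal_reflect hf) ≫ φ.hom =
      specOverMap ψ ≫ leftChart (isReversal_reflect hf)) :
    IsInducedBy g f hf γ φ ↔ Transforms g γ (leftEmb f) ψ := by
  set H := isReversal_reflect hf
  have e1 := le_preimage_of_eq (leftChart H) (θ := generic H) rfl
  have e2 := le_preimage_of_eq (leftChart H) hψ
  let U : (gluedOver H).left.Opens := (chartOpen (leftChart H)).1
  let W : (gluedOver H).left.Opens := U ⊓ φ.hom.left ⁻¹ᵁ U
  have eW : ⊤ ≤ (generic H).left ⁻¹ᵁ W := fun p hp => ⟨e1 hp, e2 hp⟩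
  have hinj := evalAt_injective (exists_good H hg hc hc') W eW
  have h1 (a : Chart f) : evalAt (generic H) W eW (restrict (gluedOver H) (inf_le_left : W ≤ U)
      (coordinate g f hf a)) = leftEmb f a := by
    refine (evalAt_restrict (generic H) inf_le_left eW _).trans ?_
    refine (DFunLike.congr_fun (evalAt_chartOpen (leftChart H) (θ := generic H) rfl) _).trans ?_
    exact congrArg (leftEmb f) (chartSections_coordinate hf a)
  have h2 (a : Chart f) : evalAt (generic H) W eW (pullSections (Y := gluedOver H)
      (Z := gluedOver H) φ.hom U W inf_le_right (coordinate g f hf a)) = ψ a := by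
    refine (DFunLike.congr_fun (evalAt_comp_pullSections (generic H) φ.hom eW inf_le_right e2)
      _).trans ?_
    refine (DFunLike.congr_fun (evalAt_chartOpen (leftChart H) hψ) _).trans ?_
    exact congrArg ψ (chartSections_coordinate hf a)
  have h3 : IsInducedBy g f hf γ φ ↔ _ :=
    moebius_relations_iff hinj (h1 (Chart.x f)) (h1 (Chart.z f)) (h2 (Chart.x f)) (h2 (Chart.z f))
  exact h3.trans ⟨fun h => ⟨h.1, h.2⟩, fun h => ⟨h.1, h.2⟩⟩

end Induced

/-! ### Surjectivity -/

section Surjective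

/-- A binary form of known degree is determined by p(X, 1), and hence by its value at a
transcendental x. -/
theorem binaryForm_ext {m : ℕ} {p q : MvPolynomial (Fin 2) ℂ} (hp : p ∈ BinaryForms m)
    (hq : q ∈ BinaryForms m) {S : Type*} [CommRing S] [Algebra ℂ S] {x : S}
    (hx : Function.Injective (aeval (R := ℂ) x))
    (h : MvPolynomial.aeval ![x, 1] p = MvPolynomial.aeval ![x, 1] q) : p = q := by
  have h1 (r : MvPolynomial (Fin 2) ℂ) :
      aeval x (MvPolynomial.aeval ![X, 1] r : ℂ[X]) = MvPolynomial.aeval ![x, 1] r := by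
    rw [aeval_pair_map, aeval_X, map_one]
  rw [← h1, ← h1] at h
  rw [← homogenize_eq_of_isHomogeneous hp rfl, hx h, homogenize_eq_of_isHomogeneous hq rfl]

theorem exists_coprime_fraction {P Q : ℂ[X]} (hP : P ≠ 0) :
    ∃ p q : ℂ[X], IsCoprime p q ∧ p ≠ 0 ∧ p * Q = q * P := by
  have hG : EuclideanDomain.gcd Q P ≠ 0 := fun h => hP (EuclideanDomain.gcd_eq_zero_iff.1 h).2
  have h1 := EuclideanDomain.mul_div_cancel' hG (EuclideanDomain.gcd_dvd_left Q P)
  have h2 := EuclideanDomain.mul_div_cancel' hG (EuclideanDomain.gcd_dvd_right Q P)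
  have h3 := EuclideanDomain.gcd_eq_gcd_ab Q P
  set G := EuclideanDomain.gcd Q P
  refine ⟨P / G, Q / G, ⟨EuclideanDomain.gcdB Q P, EuclideanDomain.gcdA Q P, ?_⟩, ?_, ?_⟩
  · refine mul_left_cancel₀ hG ?_
    rw [mul_one]
    conv_rhs => rw [h3]
    linear_combination EuclideanDomain.gcdB Q P * h2 + EuclideanDomain.gcdA Q P * h1
  · intro h
    exact hP (by rw [← h2, h, mul_zero])
  · refine mul_left_cancel₀ hG ?_
    linear_combination Q * h2 - P * h1

/-- Let y = q/p in lowest terms. From qᵐ P₀ = pᵐ Pₘ one gets P₀ = pᵐ r and Pₘ = qᵐ r, and with m ≥ 1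
the degree bounds leave deg p, deg q ≤ 1. -/
theorem exists_linear_fraction {K : Type*} [Field K] [Algebra ℂ K] {x y : K}
    (hx : Function.Injective (aeval (R := ℂ) x)) (hy : ∀ c : ℂ, y ≠ algebraMap ℂ K c) {m : ℕ}
    (hm : 1 ≤ m) {P₀ P₁ Pm : ℂ[X]} (h0 : P₀ ≠ 0) (hd0 : P₀.natDegree ≤ m)
    (hdm : Pm.natDegree ≤ m) (h1 : aeval x P₁ = y * aeval x P₀)
    (h2 : aeval x Pm = y ^ m * aeval x P₀) :
    ∃ a b c d e : ℂ, a * d - b * c ≠ 0 ∧ e ≠ 0 ∧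
      (c • x + algebraMap ℂ K d) * y = a • x + algebraMap ℂ K b ∧
      aeval x P₀ = e • (c • x + algebraMap ℂ K d) ^ m := by
  obtain ⟨p, q, hpq, hp, hpP⟩ := exists_coprime_fraction (Q := P₁) h0
  have hne {r : ℂ[X]} (hr : r ≠ 0) : aeval x r ≠ 0 := (map_ne_zero_iff _ hx).2 hr
  have hpy : aeval x p * y = aeval x q := by
    have h3 := congrArg (aeval x) hpP
    rw [map_mul, map_mul, h1, ← mul_assoc] at h3
    exact mul_right_cancel₀ (hne h0) h3
  have hq : q ≠ 0 := by
    rintro rfl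
    rw [map_zero, mul_eq_zero, or_iff_right (hne hp)] at hpy
    exact hy 0 (by rw [hpy, map_zero])
  have h3 : q ^ m * P₀ = p ^ m * Pm := hx (by
    rw [map_mul, map_mul, map_pow, map_pow, h2, ← hpy]
    ring)
  obtain ⟨r, hr⟩ := (hpq.pow (m := m) (n := m)).dvd_of_dvd_mul_left (Dvd.intro _ h3.symm)
  have h4 : Pm = q ^ m * r := mul_left_cancel₀ (pow_ne_zero m hp) (by
    rw [← h3, hr]
    ring)
  have hr0 : r ≠ 0 := by
    rintro rfl
    exact h0 (by rw [hr, mul_zero])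
  rw [hr, natDegree_mul (pow_ne_zero _ hp) hr0, natDegree_pow] at hd0
  rw [h4, natDegree_mul (pow_ne_zero _ hq) hr0, natDegree_pow] at hdm
  obtain ⟨c, d, rfl⟩ := exists_eq_X_add_C_of_natDegree_le_one (p := p) (by nlinarith)
  obtain ⟨a, b, rfl⟩ := exists_eq_X_add_C_of_natDegree_le_one (p := q) (by nlinarith)
  simp only [map_add, map_mul, aeval_X, aeval_C] at hpy
  -- With determinant 0 the polynomials p and q would be proportional and y constant.
  have hdet : a * d - b * c ≠ 0 := by
    intro hdet
    have hdet' := congrArg (algebraMap ℂ K) hdet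
    simp only [map_sub, map_mul, map_zero] at hdet'
    by_cases hc : c = 0
    · have hd : algebraMap ℂ K d ≠ 0 := by
        rw [_root_.map_ne_zero]
        rintro rfl
        exact hp (by simp [hc])
      refine hy (b / d) (mul_left_cancel₀ hd ?_)
      have ha : a = 0 := by
        have hd' : d ≠ 0 := fun h => hd (by rw [h, map_zero])
        rw [hc, mul_zero, sub_zero] at hdet
        exact (mul_eq_zero.1 hdet).resolve_right hd'
      rw [map_div₀, mul_div_cancel₀ _ hd]
      rw [hc, ha] at hpy
      simpa using hpy
    · have hc' : algebraMap ℂ K c ≠ 0 := (_root_.map_ne_zero _).2 hc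
      have hden := hne hp
      simp only [map_add, map_mul, aeval_X, aeval_C] at hden
      refine hy (a / c) (mul_left_cancel₀ hc' (mul_left_cancel₀ hden ?_))
      rw [map_div₀, mul_div_cancel₀ _ hc']
      linear_combination algebraMap ℂ K c * hpy - hdet'
  -- A non-constant r would use up part of the degree m, so p and q would be constant, a = c = 0,
  -- and the determinant would vanish.
  have hrdeg : r.natDegree = 0 := by
    by_contra hrd
    have hp0 : (C c * X + C d).natDegree = 0 := by
      by_contra hp0
      nlinarith [Nat.pos_of_ne_zero hp0, Nat.pos_of_ne_zero hrd]
    have hq0 : (C a * X + C b).natDegree = 0 := by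
      by_contra hq0
      nlinarith [Nat.pos_of_ne_zero hq0, Nat.pos_of_ne_zero hrd]
    have hc := coeff_eq_zero_of_natDegree_lt (n := 1) (hp0.trans_lt one_pos)
    have ha := coeff_eq_zero_of_natDegree_lt (n := 1) (hq0.trans_lt one_pos)
    simp [coeff_C] at hc ha
    exact hdet (by rw [hc, ha, zero_mul, mul_zero, sub_zero])
  obtain ⟨e, rfl⟩ := natDegree_eq_zero.1 hrdeg
  refine ⟨a, b, c, d, e, hdet, fun he => hr0 (by rw [he, map_zero]), ?_, ?_⟩
  · simpa only [Algebra.smul_def] using hpy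
  · rw [hr]
    simp only [map_add, map_mul, aeval_X, aeval_C, map_pow, Algebra.smul_def]
    ring

theorem exists_unimodular_fraction {K : Type*} [Field K] [Algebra ℂ K] {x y : K}
    (hx : Function.Injective (aeval (R := ℂ) x)) (hy : ∀ c : ℂ, y ≠ algebraMap ℂ K c) {m : ℕ}
    (hm : 1 ≤ m) {P₀ P₁ Pm : ℂ[X]} (h0 : P₀ ≠ 0) (hd0 : P₀.natDegree ≤ m)
    (hdm : Pm.natDegree ≤ m) (h1 : aeval x P₁ = y * aeval x P₀)
    (h2 : aeval x Pm = y ^ m * aeval x P₀) :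
    ∃ a b c d e : ℂ, a * d - b * c = 1 ∧ e ≠ 0 ∧
      (c • x + algebraMap ℂ K d) * y = a • x + algebraMap ℂ K b ∧
      aeval x P₀ = e • (c • x + algebraMap ℂ K d) ^ m := by
  obtain ⟨a, b, c, d, e, hdet, he, h3, h4⟩ := exists_linear_fraction hx hy hm h0 hd0 hdm h1 h2
  -- The matrix is divided by a square root s of its determinant, and sᵐ is absorbed into e.
  obtain ⟨s, hs⟩ := IsAlgClosed.exists_pow_nat_eq (a * d - b * c) two_pos
  have hs0 : s ≠ 0 := by
    rintro rfl
    exact hdet (by rw [← hs]; simp)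
  have hden : (s⁻¹ * c) • x + algebraMap ℂ K (s⁻¹ * d) =
      s⁻¹ • (c • x + algebraMap ℂ K d) := by
    simp only [Algebra.smul_def, map_mul]
    ring
  refine ⟨s⁻¹ * a, s⁻¹ * b, s⁻¹ * c, s⁻¹ * d, e * s ^ m, ?_, mul_ne_zero he (pow_ne_zero _ hs0),
    ?_, ?_⟩
  · field_simp
    exact hs.symm
  · rw [hden, smul_mul_assoc, h3]
    simp only [Algebra.smul_def, map_mul]
    ring
  · rw [hden, _root_.smul_pow, smul_smul, h4, mul_assoc, ← mul_pow, mul_inv_cancel₀ hs0, one_pow,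
      mul_one]

/-- For determinant 1 the derivative of (ax + b)/(cx + d) is (cx + d)^(-2), and dx has coefficient
2z with respect to dx/2z. -/
theorem moebius_derivation {f : ℂ[X]} [IsDomain (Chart f)] {a b c d : ℂ}
    {y : RationalFunctions f} (hdet : a * d - b * c = 1)
    (hy : (c • leftEmb f (Chart.x f) + algebraMap ℂ _ d) * y =
      a • leftEmb f (Chart.x f) + algebraMap ℂ _ b) :
    (c • leftEmb f (Chart.x f) + algebraMap ℂ _ d) ^ 2 * fieldDerivation f y =
      2 * leftEmb f (Chart.z f) := by
  have h1 := congrArg (fieldDerivation f) hy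
  have hdet' := congrArg (algebraMap ℂ (RationalFunctions f)) hdet
  rw [Derivation.leibniz, map_add, map_add, Derivation.map_smul, Derivation.map_smul,
    Derivation.map_algebraMap, Derivation.map_algebraMap, fieldDerivation_leftEmb,
    hamiltonian_x, map_mul, map_ofNat] at h1
  simp only [Algebra.smul_def, map_one, map_sub, map_mul, Algebra.algebraMap_self,
    RingHom.id_apply, add_zero] at hy h1 hdet' ⊢
  set A := algebraMap ℂ (RationalFunctions f) a
  set C' := algebraMap ℂ (RationalFunctions f) c
  set D := algebraMap ℂ (RationalFunctions f) d
  set Z := leftEmb f (Chart.z f)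
  linear_combination (C' * leftEmb f (Chart.x f) + D) * h1 - 2 * C' * Z * hy + 2 * Z * hdet'

variable {g : ℕ} {f k : ℂ[X]} (H : IsReversal (g + 1) f k) [IsDomain (Chart f)]

theorem pullForms_injective {Y : Over (Spec (CommRingCat.of ℂ))} (φ : Aut Y) :
    Function.Injective (pullForms φ) := by
  refine Function.LeftInverse.injective (g := pullForms (Iso.symm φ)) fun ω => ?_
  refine (pullForms_trans (Iso.symm φ) φ ω).symm.trans ?_
  refine (congrArg (fun χ : Y ≅ Y => pullForms χ ω) (Iso.symm_self_id φ)).trans (pullForms_refl ω)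

/-- P is the coefficient of the pullback of xⁱ dx/2z, again a global form; it is not 0 because
pullback along an automorphism is injective. -/
theorem exists_pullback_polynomial (hg : 2 ≤ g) (hc : IsCoprime f (derivative f))
    (hc' : IsCoprime k (derivative k)) {φ : Aut (gluedOver H)}
    {ψ : Chart f →ₐ[ℂ] RationalFunctions f}
    (hψ : generic H ≫ φ.hom = specOverMap ψ ≫ leftChart H) {i : ℕ} (hi : i ≤ g - 1) :
    ∃ P : ℂ[X], P ≠ 0 ∧ P.natDegree ≤ g - 1 ∧
      2 * ψ (Chart.z f) * aeval (leftEmb f (Chart.x f)) P =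
        ψ (Chart.x f) ^ i * fieldDerivation f (ψ (Chart.x f)) := by
  have hg' : 2 ≤ g + 1 := by omega
  obtain ⟨ω, hω⟩ := exists_form H hg' hc hc' (p := X ^ i) (by rw [natDegree_X_pow]; omega)
  obtain ⟨P, hP, hP'⟩ := exists_polynomial H hg' hc hc' (pullForms φ ω)
  refine ⟨P, ?_, by omega, ?_⟩
  · rintro rfl
    rw [map_zero, ← (curveCoeff H).map_zero] at hP'
    have h1 := curveCoeff_injective H hg' hc hc' hP'
    have h2 := pullForms_injective φ (h1.trans (map_zero (pullForms φ)).symm)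
    rw [h2, map_zero, map_pow, aeval_X] at hω
    exact pow_ne_zero _ leftEmb_x_ne_zero hω.symm
  · rw [← hP', curveCoeff_pullForms H hg' hc hc' hψ (a := Chart.x f ^ i), map_pow]
    rw [hω, map_pow, map_pow, aeval_X]

/-- Three pullbacks suffice: i = 0 and i = 1 exhibit y = φ^*x as a fraction P₁/P₀, and i = g - 1
bounds its degree. -/
theorem curveAut_surjective (hg : 2 ≤ g) (hg' : 2 ≤ g + 1) (hc : IsCoprime f (derivative f))
    (hc' : IsCoprime k (derivative k)) : Function.Surjective (curveAut H hg' hc hc') := by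
  intro φ
  obtain ⟨ψ, hψi, hψ⟩ := exists_generic_comp H hg' hc hc' φ
  have hx := aeval_leftEmb_injective (h := f)
  set x := leftEmb f (Chart.x f) with hx'
  set y := ψ (Chart.x f) with hy'
  have hy : ∀ c : ℂ, y ≠ algebraMap ℂ _ c := by
    intro c hc
    have h1 : Chart.x f = algebraMap ℂ _ c := hψi (by rw [AlgHom.commutes]; exact hc)
    have h2 : (X : ℂ[X]) = C c := hx (by
      rw [aeval_X, aeval_C, hx', h1, AlgHom.commutes])
    exact X_ne_C c h2
  have hz : ψ (Chart.z f) ≠ 0 := by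
    rw [map_ne_zero_iff ψ hψi]
    intro h0
    exact leftEmb_z_ne_zero (h := f) (by rw [h0, map_zero])
  obtain ⟨P₀, h0, hd0, hP0⟩ := exists_pullback_polynomial H hg hc hc' hψ (i := 0) (by omega)
  obtain ⟨P₁, -, -, hP1⟩ := exists_pullback_polynomial H hg hc hc' hψ (i := 1) (by omega)
  obtain ⟨Pm, -, hdm, hPm⟩ := exists_pullback_polynomial H hg hc hc' hψ (i := g - 1) le_rfl
  rw [pow_zero, one_mul] at hP0
  rw [← hP0, mul_left_comm] at hP1 hPm
  have hz2 : 2 * ψ (Chart.z f) ≠ 0 := mul_ne_zero two_ne_zero hz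
  obtain ⟨a, b, c, d, e, hdet, he, h1, h2⟩ := exists_unimodular_fraction hx hy (m := g - 1)
    (by omega) h0 hd0 hdm ((mul_left_cancel₀ hz2 hP1).trans (by rw [pow_one]))
    (mul_left_cancel₀ hz2 hPm)
  -- P₀ = e (cx + d)^(g-1) and 2 φ^*z P₀ = 2z/(cx + d)² give φ^*z = e⁻¹ z/(cx + d)^(g+1), hence u =
  -- e⁻¹.
  let γ : Matrix.SpecialLinearGroup (Fin 2) ℂ × ℂˣ :=
    (⟨!![a, b; c, d], by rw [Matrix.det_fin_two_of]; exact hdet⟩, (Units.mk0 e he)⁻¹)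
  have hT : Transforms g γ (leftEmb f) ψ := by
    refine ⟨h1, ?_⟩
    change (c • x + algebraMap ℂ _ d) ^ (g + 1) * ψ (Chart.z f) = e⁻¹ • leftEmb f (Chart.z f)
    have h3 := moebius_derivation hdet h1
    have he' : algebraMap ℂ (RationalFunctions f) e *
        algebraMap ℂ (RationalFunctions f) e⁻¹ = 1 := by
      rw [← map_mul, mul_inv_cancel₀ he, map_one]
    obtain ⟨m, rfl⟩ := Nat.exists_eq_add_of_le' (show 1 ≤ g by omega)
    rw [Nat.add_sub_cancel] at h2
    rw [h2] at hP0
    refine mul_left_cancel₀ (two_ne_zero (α := RationalFunctions f)) ?_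
    simp only [Algebra.smul_def] at h3 hP0 ⊢
    linear_combination (algebraMap ℂ _ c * x + algebraMap ℂ _ d) ^ 2 * algebraMap ℂ _ e⁻¹ * hP0 -
      2 * (algebraMap ℂ _ c * x + algebraMap ℂ _ d) ^ (m + 2) * ψ (Chart.z f) * he' +
      algebraMap ℂ _ e⁻¹ * h3
  have hγ : γ ∈ GammaRho g f := by
    change subst γ.1 (f.homogenize (2 * (g + 1))) = (γ.2 : ℂ) ^ 2 • f.homogenize (2 * (g + 1))
    -- At (x, 1) the left side is (cx + d)^(2g+2) f(y) = ((cx + d)^(g+1) φ^*z)² = u² z², which is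
    -- the right side.
    refine binaryForm_ext (subst_mem _ (isHomogeneous_homogenize f))
      (Submodule.smul_mem _ _ (isHomogeneous_homogenize f)) hx ?_
    have h3 := hT.z
    rw [aeval_subst, map_smul, ← Algebra.algebraMap_eq_smul_one, ← Algebra.algebraMap_eq_smul_one,
      ← hT.x, aeval_homogenize_mul_left H.natDegree_le, ← Chart.map_z_sq, mul_comm 2 (g + 1),
      pow_mul, ← mul_pow, h3, _root_.smul_pow, Chart.map_z_sq, mul_comm (g + 1) 2]
    congr 1
    have h4 := aeval_homogenize_mul_left H.natDegree_le x 1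
    rw [one_mul, one_pow, one_mul] at h4
    exact h4.symm
  exact ⟨⟨γ, hγ⟩, (curveAut_eq_iff H hg' hc hc' ⟨γ, hγ⟩ hψ).2 hT⟩

end Surjective

/-! ### Binary forms and global forms -/

section Representation

/-- Reversing q² t exhibits a square factor of f, so the reversal of q is constant and q can only be
a monomial of degree j. Then deg f ≤ N - 2j, and N ≤ deg f + 1 leaves j = 0: the point at infinity
is at most a simple root. -/
theorem squarefree_reflect {N : ℕ} {f : ℂ[X]} (hf : f.natDegree ≤ N) (hN : N ≤ f.natDegree + 1)
    (hsq : Squarefree f) : Squarefree (f.reflect N) := by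
  rintro q ⟨t, ht⟩
  have hft : f = (q * q * t).reflect N := by rw [← ht, reflect_reflect]
  have h0 : q * q * t ≠ 0 := by
    intro h0
    rw [h0, reflect_zero] at hft
    exact hsq.ne_zero hft
  have hd : (q * q * t).natDegree ≤ N := by
    rw [← ht]
    exact natDegree_reflect_le.trans (by simp [hf])
  rw [natDegree_mul (left_ne_zero_of_mul h0) (right_ne_zero_of_mul h0),
    natDegree_mul (left_ne_zero_of_mul (left_ne_zero_of_mul h0))
      (left_ne_zero_of_mul (left_ne_zero_of_mul h0))] at hd
  obtain ⟨s, rfl⟩ := Nat.exists_eq_add_of_le (le_of_add_le_left hd)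
  have hts : t.natDegree ≤ s := by omega
  rw [reflect_mul _ _ natDegree_mul_le hts, reflect_mul _ _ le_rfl le_rfl] at hft
  have hu : IsUnit (q.reflect q.natDegree) := hsq _ ⟨_, hft⟩
  have h1 : f.natDegree ≤ s := by
    rw [hft]
    refine natDegree_mul_le.trans ?_
    rw [natDegree_eq_zero_of_isUnit (hu.mul hu), zero_add]
    exact natDegree_reflect_le.trans (by simp [hts])
  obtain ⟨c, hc⟩ := natDegree_eq_zero.1 (show q.natDegree = 0 by omega)
  rw [← hc] at h0 ⊢
  refine isUnit_C.2 (isUnit_iff_ne_zero.2 ?_)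
  rintro rfl
  simp at h0

theorem natDegree_dehomogenize_le {m : ℕ} {p : MvPolynomial (Fin 2) ℂ} (hp : p ∈ BinaryForms m) :
    (MvPolynomial.aeval ![(X : ℂ[X]), 1] p).natDegree ≤ m := by
  rw [← homogenize_eq_of_isHomogeneous hp rfl, aeval_homogenize_eq_sum]
  refine natDegree_sum_le_of_forall_le _ _ fun i hi => ?_
  rw [one_pow, mul_one]
  exact (natDegree_C_mul_X_pow_le _ _).trans (Nat.lt_succ_iff.1 (Finset.mem_range.1 hi))

theorem aeval_binaryForm_mul {m : ℕ} {p : MvPolynomial (Fin 2) ℂ} (hp : p ∈ BinaryForms m)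
    {S : Type*} [CommRing S] [Algebra ℂ S] (y b : S) :
    MvPolynomial.aeval ![b * y, b] p = b ^ m * MvPolynomial.aeval ![y, 1] p := by
  have h1 := natDegree_dehomogenize_le hp
  rw [← homogenize_eq_of_isHomogeneous hp rfl, aeval_homogenize_mul_left h1]
  have h2 := aeval_homogenize_mul_left h1 y 1
  rw [one_mul, one_pow, one_mul] at h2
  rw [h2]

theorem mem_degreeLT_succ_iff {m : ℕ} {p : ℂ[X]} :
    p ∈ degreeLT ℂ (m + 1) ↔ p.natDegree ≤ m := by
  rw [mem_degreeLT, degree_lt_iff_coeff_zero, natDegree_le_iff_coeff_eq_zero]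
  rfl

/-- Polynomials of degree at most `m` as binary forms of degree `m`. -/
def homogenizeEquiv (m : ℕ) : degreeLT ℂ (m + 1) ≃ₗ[ℂ] BinaryForms m :=
  LinearEquiv.ofBijective
    ((homogenizeLM m).restrict (p := degreeLT ℂ (m + 1)) (q := BinaryForms m)
      fun p _ => isHomogeneous_homogenize p) (by
    constructor
    · rw [injective_iff_map_eq_zero]
      intro p hp
      exact Subtype.ext (eq_zero_of_homogenize_eq_zero (mem_degreeLT_succ_iff.1 p.2)
        (congrArg Subtype.val hp))
    · intro q
      exact ⟨⟨_, mem_degreeLT_succ_iff.2 (natDegree_dehomogenize_le q.2)⟩,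
        Subtype.ext (homogenize_eq_of_isHomogeneous q.2 rfl)⟩)

variable {g : ℕ} {f k : ℂ[X]}

variable (g f) in
/-- The function `2 p(x, 1)`, where `p` is a binary form. -/
def formFunction : BinaryForms (g - 1) →ₗ[ℂ] RationalFunctions f :=
  LinearMap.mulLeft ℂ 2 ∘ₗ (MvPolynomial.aeval ![leftEmb f (Chart.x f), 1]).toLinearMap ∘ₗ
    (BinaryForms (g - 1)).subtype

theorem formFunction_apply (p : BinaryForms (g - 1)) :
    formFunction g f p = 2 * MvPolynomial.aeval ![leftEmb f (Chart.x f), 1] p.1 := rfl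

theorem Transforms.aeval_subst {γ : Matrix.SpecialLinearGroup (Fin 2) ℂ × ℂˣ} {S : Type*}
    [CommRing S] [Algebra ℂ S] {ψ ψ' : Chart f →ₐ[ℂ] S} (h : Transforms g γ ψ ψ') {m : ℕ}
    {p : MvPolynomial (Fin 2) ℂ} (hp : p ∈ BinaryForms m) :
    MvPolynomial.aeval ![ψ (Chart.x f), 1] (subst γ.1 p) =
      (γ.1 1 0 • ψ (Chart.x f) + algebraMap ℂ _ (γ.1 1 1)) ^ m *
        MvPolynomial.aeval ![ψ' (Chart.x f), 1] p := by
  rw [HyperellipticDifferentials.aeval_subst, ← Algebra.algebraMap_eq_smul_one,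
    ← Algebra.algebraMap_eq_smul_one, ← h.x, aeval_binaryForm_mul hp]

/-- The elimination behind the transformation rule: dx contributes d^(-2) and 1/z contributes u⁻¹
d^(m+2). -/
theorem coeff_eq_of_relations {K : Type*} [Field K] [Algebra ℂ K] [CharZero K] {u : ℂ}
    (hu : u ≠ 0) {d N c P D Z : K} (hZ : Z ≠ 0) {m : ℕ} (h1 : 2 * N * c = 2 * P * D)
    (h2 : d ^ 2 * D = 2 * Z) (h3 : d ^ (m + 2) * N = u • Z) :
    c = 2 * (u⁻¹ • (d ^ m * P)) := by
  have hu' : algebraMap ℂ K u * algebraMap ℂ K u⁻¹ = 1 := by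
    rw [← map_mul, mul_inv_cancel₀ hu, map_one]
  rw [Algebra.smul_def] at h3 ⊢
  refine mul_left_cancel₀ (mul_ne_zero (left_ne_zero_of_mul_eq_one hu')
    (mul_ne_zero hZ two_ne_zero)) ?_
  linear_combination d ^ (m + 2) * h1 + 2 * d ^ m * P * h2 - 2 * c * h3 - 4 * Z * d ^ m * P * hu'

variable [IsDomain (Chart f)]

theorem formFunction_injective : Function.Injective (formFunction g f) := fun p q hpq =>
  Subtype.ext (binaryForm_ext p.2 q.2 aeval_leftEmb_injective
    (mul_left_cancel₀ (two_ne_zero (α := RationalFunctions f)) hpq))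

variable (H : IsReversal (g + 1) f k) (hg : 2 ≤ g + 1) (hc : IsCoprime f (derivative f))
  (hc' : IsCoprime k (derivative k))

-- Coefficients are taken with respect to dx/2z, while a binary form stands for p(x, 1) dx/z; this
-- is the factor 2 in `formFunction`.
include hg hc hc' in
theorem range_formFunction :
    LinearMap.range (formFunction g f) = LinearMap.range (curveCoeff H) := by
  ext t
  constructor
  · rintro ⟨p, rfl⟩
    obtain ⟨ω, hω⟩ := exists_form H hg hc hc' (p := C 2 * MvPolynomial.aeval ![X, 1] p.1)
      ((natDegree_C_mul_le _ _).trans ((natDegree_dehomogenize_le p.2).trans (by omega)))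
    refine ⟨ω, hω.trans ?_⟩
    rw [map_mul, aeval_pair_map, aeval_X, map_one, aeval_C, map_ofNat, formFunction_apply]
  · rintro ⟨ω, rfl⟩
    obtain ⟨p, hp, hω⟩ := exists_polynomial H hg hc hc' ω
    refine ⟨⟨(C 2⁻¹ * p).homogenize (g - 1), isHomogeneous_homogenize _⟩, ?_⟩
    have h1 := aeval_homogenize_of_eq_one (n := g - 1) (p := C 2⁻¹ * p)
      ((natDegree_C_mul_le _ _).trans (hp.trans (by omega))) ![leftEmb f (Chart.x f), 1] rfl
    have h2 : 2 * algebraMap ℂ (RationalFunctions f) 2⁻¹ = 1 := by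
      rw [map_inv₀, map_ofNat, mul_inv_cancel₀ two_ne_zero]
    rw [formFunction_apply, h1, hω, map_mul, ← mul_assoc, aeval_C, h2, one_mul]
    rfl

/-- The binary form `p` as the differential form `p(x, 1) dx / z`. -/
def formsEquiv : BinaryForms (g - 1) ≃ₗ[ℂ] GlobalForms (gluedOver H) :=
  LinearEquiv.ofInjective _ formFunction_injective ≪≫ₗ
    LinearEquiv.ofEq _ _ (range_formFunction H hg hc hc') ≪≫ₗ
      (LinearEquiv.ofInjective _ (curveCoeff_injective H hg hc hc')).symm

theorem curveCoeff_formsEquiv (p : BinaryForms (g - 1)) :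
    curveCoeff H (formsEquiv H hg hc hc' p) = formFunction g f p := by
  have h1 := (LinearEquiv.ofInjective _ (curveCoeff_injective H hg hc hc')).apply_symm_apply
    (LinearEquiv.ofEq _ _ (range_formFunction H hg hc hc')
      (LinearEquiv.ofInjective _ formFunction_injective p))
  exact congrArg Subtype.val h1

theorem curveCoeff_formsEquiv_symRep
    (γ : Matrix.SpecialLinearGroup (Fin 2) ℂ × ℂˣ) (p : BinaryForms (g - 1)) :
    curveCoeff H (formsEquiv H hg hc hc' (symRep (g - 1) (-1) (MulOpposite.op γ) p)) =
      2 * ((γ.2 : ℂ)⁻¹ •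
        MvPolynomial.aeval ![leftEmb f (Chart.x f), 1] (subst γ.1 p.1)) := by
  rw [curveCoeff_formsEquiv, formFunction_apply, ← map_smul]
  have h1 : (symRep (g - 1) (-1) (MulOpposite.op γ) p).1 =
      ((γ.2 ^ (-1 : ℤ) : ℂˣ) : ℂ) • subst γ.1 p.1 := rfl
  rw [h1, zpow_neg_one, Units.val_inv_eq_inv_val]

theorem pullForms_formsEquiv (γ : GammaRho g f) (p : BinaryForms (g - 1)) :
    pullForms (curveAut H hg hc hc' γ) (formsEquiv H hg hc hc' p) =
      formsEquiv H hg hc hc' (symRep (g - 1) (-1) (MulOpposite.op γ.1) p) := by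
  apply curveCoeff_injective H hg hc hc'
  obtain ⟨ψ, hψ⟩ := exists_generic_transforms H.natDegree_le γ
  have h1 : generic H ≫ (curveAut H hg hc hc' γ).hom = specOverMap ψ ≫ leftChart H :=
    generic_curveHom H hψ
  have h2 := curveCoeff_pullForms H hg hc hc' h1 (ω := formsEquiv H hg hc hc' p)
    (a := 2 * MvPolynomial.aeval ![Chart.x f, 1] p.1) (by
      rw [curveCoeff_formsEquiv, formFunction_apply, map_mul, map_ofNat, aeval_pair_map, map_one])
  rw [map_mul, map_ofNat, aeval_pair_map, map_one] at h2
  have h3 := γ.1.1.det_coe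
  rw [Matrix.det_fin_two] at h3
  have h7 := hψ.z
  -- The exponent g + 1 splits into the degree g - 1 of the binary form and the 2 coming from dx.
  rw [show g + 1 = (g - 1) + 2 by omega] at h7
  rw [curveCoeff_formsEquiv_symRep, hψ.aeval_subst p.2]
  exact coeff_eq_of_relations γ.1.2.ne_zero leftEmb_z_ne_zero h2 (moebius_derivation h3 hψ.x) h7

end Representation

/-! ### The forms xⁱ dx/z and the monomial basis -/

section Standard

theorem IsGood.smul_eq_pow_smul_D {K : Type} [Field K] [Algebra ℂ K]
    {Y : Over (Spec (CommRingCat.of ℂ))} {ι : specOver K ⟶ Y} {δ : Ω[K⁄ℂ] →ₗ[K] K}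
    {V : Y.left.affineOpens} (hV : IsGood ι δ V) {x z : Sections Y V.1}
    {w : Ω[Sections Y V.1⁄ℂ]} {i : ℕ} {X Z W : K} (hx : evalAt ι V.1 hV.le x = X)
    (hz : evalAt ι V.1 hV.le z = Z) (hw : formCoeff ι δ V.1 hV.le w = W)
    (h : Z * W = X ^ i * δ (KaehlerDifferential.D ℂ K X)) :
    z • w = x ^ i • KaehlerDifferential.D ℂ (Sections Y V.1) x := by
  apply hV.coeff_injective
  rw [formCoeff_smul, formCoeff_smul, formCoeff_apply _ _ _ (KaehlerDifferential.D ℂ _ x),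
    kaehlerMap_D, map_pow, hx, hz, hw, h]

variable {g : ℕ} {f : ℂ[X]}

theorem formFunction_monomialForm (i : Fin g) :
    formFunction g f (monomialForm g i) = 2 * leftEmb f (Chart.x f) ^ (i : ℕ) := by
  rw [formFunction_apply, monomialForm]
  simp

variable (hf : f.natDegree ≤ 2 * g + 2) [IsDomain (Chart f)]

theorem isStandardForm_of_curveCoeff (hc : IsCoprime f (derivative f)) {i : ℕ}
    {ω : GlobalForms (Curve g f hf)}
    (hω : curveCoeff (isReversal_reflect hf) ω = 2 * leftEmb f (Chart.x f) ^ i) :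
    IsStandardForm g f hf i ω := by
  set H := isReversal_reflect hf
  have h1 (a : Chart f) : evalAt (generic H) (chartOpen (leftChart H)).1
      (le_preimage_of_eq (leftChart H) (θ := generic H) rfl) (coordinate g f hf a) =
        leftEmb f a := by
    refine (DFunLike.congr_fun (evalAt_chartOpen (leftChart H) (θ := generic H) rfl) _).trans ?_
    exact congrArg (leftEmb f) (chartSections_coordinate hf a)
  refine (isGood_left H hc).smul_eq_pow_smul_D (h1 _) (h1 _) hω ?_
  rw [fieldCoeff_D, fieldDerivation_leftEmb, hamiltonian_x, map_mul, map_ofNat]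
  ring

variable (g) in
/-- The monomials `X ^ i Y ^ (g-1-i)`, as a basis of the binary forms of degree `g - 1`. -/
def monomialBasis (hg : 1 ≤ g) : Module.Basis (Fin g) ℂ (BinaryForms (g - 1)) :=
  ((degreeLT.basis ℂ (g - 1 + 1)).reindex (finCongr (Nat.sub_add_cancel hg))).map
    (homogenizeEquiv (g - 1))

theorem monomialBasis_apply (hg : 1 ≤ g) (i : Fin g) : monomialBasis g hg i = monomialForm g i := by
  apply Subtype.ext
  rw [monomialBasis, Module.Basis.map_apply, Module.Basis.reindex_apply]
  change homogenize (degreeLT.basis ℂ (g - 1 + 1) _ : ℂ[X]) (g - 1) = _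
  rw [degreeLT.basis_val]
  exact homogenize_X_pow (Nat.le_sub_one_of_lt i.2)

end Standard

/-- Transport of a representation along a linear equivalence. -/
def transportRep {G V W : Type*} [Monoid G] [AddCommGroup V] [Module ℂ V] [AddCommGroup W]
    [Module ℂ W] (L : V ≃ₗ[ℂ] W) (σ : Representation ℂ G W) : Representation ℂ G V where
  toFun a := L.symm.toLinearMap ∘ₗ σ a ∘ₗ L.toLinearMap
  map_one' := by ext; simp
  map_mul' a b := by ext; simp

theorem apply_transportRep {G V W : Type*} [Monoid G] [AddCommGroup V] [Module ℂ V]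
    [AddCommGroup W] [Module ℂ W] (L : V ≃ₗ[ℂ] W) (σ : Representation ℂ G W) (a : G) (v : V) :
    L (transportRep L σ a v) = σ a (L v) :=
  L.apply_symm_apply _

end HyperellipticDifferentials

end

theorem mainTheorem7 (g : ℕ) (hg : 2 ≤ g) (f : ℂ[X]) (hf : f.natDegree ≤ 2 * g + 2)
    (hf' : 2 * g + 1 ≤ f.natDegree) (hsq : Squarefree f) :
    ∃ α : GammaRho g f →* Aut (Curve g f hf),
      (∀ (h : GammaRho g f) (φ : Aut (Curve g f hf)), IsInducedBy g f hf h.1 φ ↔ α h = φ) ∧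
      Function.Surjective α ∧
      ∃ V : Representation ℂ (Aut (Curve g f hf))ᵐᵒᵖ (BinaryForms (g - 1)),
        (∀ h : GammaRho g f,
          V (MulOpposite.op (α h)) = symRep (g - 1) (-1) (MulOpposite.op h.1)) ∧
        ∃ (ω : Module.Basis (Fin g) ℂ (GlobalForms (Curve g f hf)))
          (Φ : V.Equiv (formsRep (Curve g f hf))),
          ∀ i : Fin g, IsStandardForm g f hf i (ω i) ∧ Φ (monomialForm g i) = ω i := by
  have hc : IsCoprime f (derivative f) := PerfectField.separable_iff_squarefree.2 hsq
  have hc' : IsCoprime (f.reflect (2 * (g + 1))) (derivative (f.reflect (2 * (g + 1)))) :=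
    PerfectField.separable_iff_squarefree.2 (squarefree_reflect (by omega) (by omega) hsq)
  have hdom : IsDomain (Chart f) := Chart.isDomain hsq fun hu => by
    have := natDegree_eq_zero_of_isUnit hu
    omega
  have hg1 : 2 ≤ g + 1 := by omega
  have hg2 : 1 ≤ g := by omega
  let L : BinaryForms (g - 1) ≃ₗ[ℂ] GlobalForms (Curve g f hf) :=
    formsEquiv (isReversal_reflect hf) hg1 hc hc'
  refine ⟨curveAut (isReversal_reflect hf) hg1 hc hc', ?_,
    curveAut_surjective (isReversal_reflect hf) hg hg1 hc hc',
    -- Transport along `L` yields a representation of the automorphism group from the start, so that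
    -- the action of Γ(ρ) factors through it reduces to equivariance of `L`.
    transportRep L (formsRep (Curve g f hf)), ?_, (monomialBasis g hg2).map L,
    Representation.Equiv.mk L fun φ => ?_, fun i => ⟨?_, ?_⟩⟩
  · intro h φ
    -- Any automorphism has coordinates `ψ` at the generic point, and both conditions say that `ψ`
    -- is the transform of (x, z).
    obtain ⟨ψ, -, hψ⟩ := exists_generic_comp (isReversal_reflect hf) hg1 hc hc' φ
    exact (isInducedBy_iff hf hg1 hc hc' h.1 hψ).trans
      (curveAut_eq_iff (isReversal_reflect hf) hg1 hc hc' h hψ).symm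
  · intro h
    refine LinearMap.ext fun p => L.injective ?_
    exact (apply_transportRep L (formsRep (Curve g f hf)) _ p).trans
      (pullForms_formsEquiv (isReversal_reflect hf) hg1 hc hc' h p)
  · exact LinearMap.ext fun p => apply_transportRep L (formsRep (Curve g f hf)) φ p
  · refine isStandardForm_of_curveCoeff hf hc ?_
    rw [Module.Basis.map_apply, monomialBasis_apply]
    exact (curveCoeff_formsEquiv (isReversal_reflect hf) hg1 hc hc' _).trans
      (formFunction_monomialForm i)
  · rw [Module.Basis.map_apply, monomialBasis_apply]
    rfl
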